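/- **Conventions.** Fields are smooth on an open subset $O$ of a two-dimensional coordinate space; $\tau=\tau_\mu dx^\mu$, $e=e_\mu dx^\mu$ with $\det(\tau,e)>0$, and $v^\mu,e^\mu$ are the dual vectors, $v^\mu\tau_\mu=-1$, $e^\mu e_\mu=1$, $v^\mu e_\mu=0=e^\mu\tau_\mu$. Put $K=2e^\mu v^\nu\partial_{[\mu}e_{\nu]}$, $\hat\omega_\mu=-2e^\nu\partial_{[\mu}\tau_{\nu]}$, $R=4e^\mu v^\nu\partial_{[\mu}\hat\omega_{\nu]}$. For a compact region $D\subseteq O$ the 2d magnetic Carroll dilaton gravity action is $$I_{\rm Car}[\tau,e,X,C,X_{\rm P}]=\frac{k}{4\pi}\int_D d^2x\,\det(\tau,e)\Big(XR+2C\,v^\mu\partial_\mu X+2X_{\rm P}K-U(X)(e^\mu\partial_\mu X)^2+2V(X)\Big).$$ A boundary term is $\int_D d^2x\,\partial_\mu J^\mu$, where $J^\mu(x)$ is one fixed function (the same for all field configurations) of the values and first derivatives of the fields at $x$, smooth in $x$ whenever the fields are. Magnetic Carroll gravity in $d+1$ dimensions (without cosmological constant) has the action $\frac{1}{16\pi G_M}\int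 d^{d+1}x\,\det(\tau,e^a)\,\mathcal R$ with $\mathcal R=-2v^\mu e_b^\nu\Omega^b_{\mu\nu}+e_a^\mu e_b^\nu\Omega^{ab}_{\mu\nu}$, $\Omega^a=d\omega^a+\omega^a{}_b\wedge\omega^b$, $\Omega^{ab}=d\omega^{ab}+\omega^a{}_c\wedge\omega^{cb}$. Its fields are $\tau$, $e^a$ and a symmetric $C^{ab}$; the connection is the solution $$\omega^a_\mu=\tau_\mu v^\nu e^{a\sigma}\partial_{[\nu}\tau_{\sigma]}-e^{\nu a}\partial_{[\mu}\tau_{\nu]}+C^{ab}e_{\mu b},\qquad \omega^{ab}_\mu=2e^{\rho[a}\partial_{[\mu}e^{b]}_{\rho]}-e_{\mu c}e^{\rho a}e^{\nu b}\partial_{[\rho}e^c_{\nu]}$$ of the torsion constraints. A spherically symmetric configuration on $O\times S^{d-1}$ is given by 2d data $(\tau,e,\Phi,C,\varphi)$, $\Phi>0$: $\tau$ is pulled back from $O$, $e^1=e$ and $e^l=\Phi\bar e^l$ with $\bar e^l=\frac{2}{1+|y|^2}dy^l$ the orthonormal coframe of the unit sphere in stereographic coordinates $y$, and $C^{11}=C$,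 $C^{1l}=0$, $C^{lm}=(\varphi/\Phi)\delta^{lm}$ (so that $\omega^1=\hat\omega+Ce$ and $\omega^l=\varphi\,\bar e^l$). **1. Spherical reduction.** Let $d\ge2$, $\lambda>0$, $G_M>0$ and $$k=\frac{\pi^{d/2}}{2\Gamma(d/2)G_M}\Big(\frac{d-1}{\lambda}\Big)^{d-1},\qquad U(X)=-\frac{d-2}{(d-1)X},\qquad V(X)=\lambda^2\frac{d-2}{2(d-1)}X^{\frac{d-3}{d-1}}.$$ The field redefinition $(X,C',X_{\rm P})\mapsto(\Phi,C,\varphi)$, $$\Phi=\tfrac{d-1}{\lambda}X^{\frac1{d-1}},\qquad \varphi=-\tfrac{X_{\rm P}}{\lambda}X^{\frac{2-d}{d-1}},\qquad C=C'-\varphi\lambda\tfrac{d-2}{d-1}X^{\frac1{1-d}}$$ is a bijection from $\{X>0\}$ to $\{\Phi>0\}$, and for all smooth fields with $X>0$ the $(d+1)$-dimensional Lagrangian is integrable over $D\times S^{d-1}$ and the magnetic Carroll gravity action of the spherically symmetric configuration $(\tau,e,\Phi,C,\varphi)$ over $D\times S^{d-1}$ equals $I_{\rm Car}[\tau,e,X,C',X_{\rm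 P}]$ with these $k,U,V$, up to a boundary term. **2. Magnetic limit.** Let $U,V$ be arbitrary smooth functions on an open set of dilaton values. Consider $$I_{\rm rel}[g,X]=\frac{k_{\rm rel}}{4\pi}c^3\int_D d^2x\sqrt{-g}\,\big(X\overset{\rm (LC)}{R}-U(X)(\partial X)^2+2V(X)\big),\qquad g_{\mu\nu}=-c^2T_\mu T_\nu+E_\mu E_\nu,$$ with $\det(T,E)>0$, and let $\mathcal K$, $W=V^\mu\partial_\mu X$, $R$ be built from $(T,E)$ as $K$, $v^\mu\partial_\mu X$, $R$ are from $(\tau,e)$. (a) For every $c>0$, up to a boundary term, $I_{\rm rel}=c^2I_2+c^4I_4$ with $$I_2=\frac{k_{\rm rel}}{4\pi}\int_D\det(T,E)\big(2\mathcal KW+UW^2\big),\qquad I_4=\frac{k_{\rm rel}}{4\pi}\int_D\det(T,E)\big(XR-U(E^\mu\partial_\mu X)^2+2V\big).$$ (b) (Hubbard–Stratonovich step.) Where $W\ne0$ and $\mathcal K+UW\ne0$, let $$I_2^{\rm aux}=\frac{k_{\rm rel}}{4\pi}\int_D\det(T,E)\Big(-c^4\frac{\mathcal K}{W}X_{\rm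 P}^2+2c^2X_{\rm P}\mathcal K-c^4\frac{W}{\mathcal K+UW}C^2+2c^2CW\Big).$$ The equations of motion of the auxiliary fields $X_{\rm P},C$ have a smooth solution, and on every solution the Lagrangian of $I_2^{\rm aux}$ equals that of $I_2$. (c) Let $T,E,X,C,X_{\rm P}$ depend smoothly on $(c^2,x)$ up to $c^2=0$, with $\det(T,E)>0$ throughout, let $\tau,e,X,C,X_{\rm P}$ denote their values at $c=0$, and assume $v^\mu\partial_\mu X\ne0$ and $K+Uv^\mu\partial_\mu X\neq0$ at $c=0$. Then with $k=k_{\rm rel}c^4$ held fixed, $$\lim_{c\to0^+}\big(c^2I_2^{\rm aux}+c^4I_4\big)=I_{\rm Car}[\tau,e,X,C,X_{\rm P}].$$ **3. Commutativity.** In particular, with $k,U,V$ as in 1, the limit in 2(c) equals, up to the boundary term of 1, the magnetic Carroll gravity action of the spherically symmetric configuration that corresponds to $(\tau,e,X,C,X_{\rm P})$. -/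

import Mathlib

open scoped ContDiff
open Set Filter Topology MeasureTheory

noncomputable section

namespace CarrollGravity

/-! ## Coordinate calculus -/

/-- The partial derivative `∂_μ f`. -/
def pd {m : ℕ} (μ : Fin m) (f : (Fin m → ℝ) → ℝ) (x : Fin m → ℝ) : ℝ :=
  fderiv ℝ f x (Pi.single μ 1)

/-- The components `∂_μ w_ν - ∂_ν w_μ` of the exterior derivative of the one-form `w`. -/
def curl {m : ℕ} (w : (Fin m → ℝ) → Fin m → ℝ) (μ ν : Fin m) (x : Fin m → ℝ) : ℝ :=
  pd μ (fun y => w y ν) x - pd ν (fun y => w y μ) x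

/-- The divergence `∂_μ J^μ` of a vector density. -/
def divergence {m : ℕ} (J : (Fin m → ℝ) → Fin m → ℝ) (x : Fin m → ℝ) : ℝ :=
  ∑ μ, pd μ (fun y => J y μ) x

/-! ## Magnetic Carroll gravity in `d + 1` dimensions (second order form, no cosmological constant)

The fields are the clock form `τ`, the spatial coframe `e^a` and the symmetric tensor `C^{ab}`, the
part of the boost connection which the torsion constraints leave free. -/

section HigherDim

variable {d : ℕ}

/-- The matrix whose rows are `τ, e^1, …, e^d`. -/
def coframeMatrix (τ : (Fin (d + 1) → ℝ) → Fin (d + 1) → ℝ)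
    (e : Fin d → (Fin (d + 1) → ℝ) → Fin (d + 1) → ℝ) (x : Fin (d + 1) → ℝ) :
    Matrix (Fin (d + 1)) (Fin (d + 1)) ℝ :=
  Matrix.of (Fin.cons (τ x) (fun a => e a x))

/-- The Carroll vector `v^μ`: `v^μ τ_μ = -1`, `v^μ e^a_μ = 0`. -/
def carrollVector (τ : (Fin (d + 1) → ℝ) → Fin (d + 1) → ℝ)
    (e : Fin d → (Fin (d + 1) → ℝ) → Fin (d + 1) → ℝ) (x : Fin (d + 1) → ℝ)
    (μ : Fin (d + 1)) : ℝ :=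
  -(coframeMatrix τ e x)⁻¹ μ 0

/-- The dual spatial frame `e_a^μ`: `e_a^μ τ_μ = 0`, `e_a^μ e^b_μ = δ_a^b`. -/
def spatialFrame (τ : (Fin (d + 1) → ℝ) → Fin (d + 1) → ℝ)
    (e : Fin d → (Fin (d + 1) → ℝ) → Fin (d + 1) → ℝ) (a : Fin d) (x : Fin (d + 1) → ℝ)
    (μ : Fin (d + 1)) : ℝ :=
  (coframeMatrix τ e x)⁻¹ μ a.succ

/-- The boost connection `ω^a_μ`; with the rotation connection below it is the general solution of the
torsion constraints `T = 0`, `T^{[a}(v, e^{b]}) = 0`, `T^a(e^b, e^c) = 0`, for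
`T = dτ + ω^a ∧ e_a`, `T^a = de^a + ω^a_b ∧ e^b`:
`ω^a_μ = τ_μ v^ν e^{aσ} ∂_[ν τ_σ] - e^{νa} ∂_[μ τ_ν] + C^{ab} e_{μb}`. -/
def boostConnection (τ : (Fin (d + 1) → ℝ) → Fin (d + 1) → ℝ)
    (e : Fin d → (Fin (d + 1) → ℝ) → Fin (d + 1) → ℝ)
    (C : Fin d → Fin d → (Fin (d + 1) → ℝ) → ℝ) (a : Fin d)
    (x : Fin (d + 1) → ℝ) (μ : Fin (d + 1)) : ℝ :=
  (1 / 2) * τ x μ *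
      ∑ ν, ∑ σ, carrollVector τ e x ν * spatialFrame τ e a x σ * curl τ ν σ x
    - (1 / 2) * ∑ ν, spatialFrame τ e a x ν * curl τ μ ν x
    + ∑ b, C a b x * e b x μ

/-- The rotation connection `ω^{ab}_μ`, with
`ω^{ab}_μ = 2 e^{ρ[a} ∂_[μ e_ρ]^{b]} - e_{μc} e^{ρa} e^{νb} ∂_[ρ e_ν]^c`. -/
def rotationConnection (τ : (Fin (d + 1) → ℝ) → Fin (d + 1) → ℝ)
    (e : Fin d → (Fin (d + 1) → ℝ) → Fin (d + 1) → ℝ) (a b : Fin d)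
    (x : Fin (d + 1) → ℝ) (μ : Fin (d + 1)) : ℝ :=
  (1 / 2) * ∑ ρ, (spatialFrame τ e a x ρ * curl (e b) μ ρ x
      - spatialFrame τ e b x ρ * curl (e a) μ ρ x)
    - (1 / 2) * ∑ c, ∑ ρ, ∑ ν, e c x μ * spatialFrame τ e a x ρ * spatialFrame τ e b x ν
        * curl (e c) ρ ν x

/-- The components of the boost curvature `Ω^a = dω^a + ω^a_b ∧ ω^b`. -/
def boostCurvature (τ : (Fin (d + 1) → ℝ) → Fin (d + 1) → ℝ)
    (e : Fin d → (Fin (d + 1) → ℝ) → Fin (d + 1) → ℝ)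
    (C : Fin d → Fin d → (Fin (d + 1) → ℝ) → ℝ) (a : Fin d) (μ ν : Fin (d + 1))
    (x : Fin (d + 1) → ℝ) : ℝ :=
  curl (boostConnection τ e C a) μ ν x
    + ∑ b, (rotationConnection τ e a b x μ * boostConnection τ e C b x ν
      - rotationConnection τ e a b x ν * boostConnection τ e C b x μ)

/-- The components of the rotation curvature `Ω^{ab} = dω^{ab} + ω^a_c ∧ ω^{cb}`. -/
def rotationCurvature (τ : (Fin (d + 1) → ℝ) → Fin (d + 1) → ℝ)
    (e : Fin d → (Fin (d + 1) → ℝ) → Fin (d + 1) → ℝ) (a b : Fin d) (μ ν : Fin (d + 1))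
    (x : Fin (d + 1) → ℝ) : ℝ :=
  curl (rotationConnection τ e a b) μ ν x
    + ∑ c, (rotationConnection τ e a c x μ * rotationConnection τ e c b x ν
      - rotationConnection τ e a c x ν * rotationConnection τ e c b x μ)

/-- The Carroll curvature scalar
`𝓡 = -2 v^μ e_b^ν Ω^b_{μν} + e_a^μ e_b^ν Ω^{ab}_{μν}`. -/
def carrollScalar (τ : (Fin (d + 1) → ℝ) → Fin (d + 1) → ℝ)
    (e : Fin d → (Fin (d + 1) → ℝ) → Fin (d + 1) → ℝ)
    (C : Fin d → Fin d → (Fin (d + 1) → ℝ) → ℝ) (x : Fin (d + 1) → ℝ) : ℝ :=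
  -2 * ∑ b, ∑ μ, ∑ ν,
      carrollVector τ e x μ * spatialFrame τ e b x ν * boostCurvature τ e C b μ ν x
    + ∑ a, ∑ b, ∑ μ, ∑ ν,
      spatialFrame τ e a x μ * spatialFrame τ e b x ν * rotationCurvature τ e a b μ ν x

/-- The Lagrangian density `det(τ, e^a) 𝓡`. -/
def magneticLagrangian (τ : (Fin (d + 1) → ℝ) → Fin (d + 1) → ℝ)
    (e : Fin d → (Fin (d + 1) → ℝ) → Fin (d + 1) → ℝ)
    (C : Fin d → Fin d → (Fin (d + 1) → ℝ) → ℝ) (x : Fin (d + 1) → ℝ) : ℝ :=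
  (coframeMatrix τ e x).det * carrollScalar τ e C x

/-- The action `1 / (16 π G_M) ∫ d^{d+1}x det(τ, e^a) 𝓡` over a region of coordinate space. -/
def magneticAction (G : ℝ) (τ : (Fin (d + 1) → ℝ) → Fin (d + 1) → ℝ)
    (e : Fin d → (Fin (d + 1) → ℝ) → Fin (d + 1) → ℝ)
    (C : Fin d → Fin d → (Fin (d + 1) → ℝ) → ℝ) (region : Set (Fin (d + 1) → ℝ)) : ℝ :=
  1 / (16 * Real.pi * G) * ∫ x in region, magneticLagrangian τ e C x

end HigherDim

/-! ## Two-dimensional fields -/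

/-- Coordinate space in two dimensions. -/
abbrev Plane := Fin 2 → ℝ

/-- The values of a field multiplet `(τ_μ, e_μ, X, C, X_P)` at a point. -/
abbrev FieldVal := (Fin 2 → ℝ) × (Fin 2 → ℝ) × ℝ × ℝ × ℝ

/-- A field multiplet `(τ_μ, e_μ, X, C, X_P)`. The same type is used for the pre-Carroll variables
`(T_μ, E_μ, X, C, X_P)` and for the spherically symmetric data `(τ_μ, e_μ, Φ, C, φ)`. -/
abbrev Fields := Plane → FieldVal

/-- The temporal einbein `τ_μ`. -/
def clock (ψ : Fields) (x : Plane) : Fin 2 → ℝ := (ψ x).1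

/-- The spatial einbein `e_μ`. -/
def ruler (ψ : Fields) (x : Plane) : Fin 2 → ℝ := (ψ x).2.1

/-- The dilaton `X` (or the radius `Φ`). -/
def dil (ψ : Fields) (x : Plane) : ℝ := (ψ x).2.2.1

/-- The field `C`. -/
def fieldC (ψ : Fields) (x : Plane) : ℝ := (ψ x).2.2.2.1

/-- The field `X_P` (or `φ`). -/
def fieldP (ψ : Fields) (x : Plane) : ℝ := (ψ x).2.2.2.2

/-- `det(τ, e)`. -/
def frameDet (ψ : Fields) (x : Plane) : ℝ :=
  clock ψ x 0 * ruler ψ x 1 - clock ψ x 1 * ruler ψ x 0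

/-- The vector `v^μ`: `v^μ τ_μ = -1`, `v^μ e_μ = 0`. -/
def vecV (ψ : Fields) (x : Plane) : Fin 2 → ℝ :=
  ![-ruler ψ x 1 / frameDet ψ x, ruler ψ x 0 / frameDet ψ x]

/-- The vector `e^μ`: `e^μ τ_μ = 0`, `e^μ e_μ = 1`. -/
def vecE (ψ : Fields) (x : Plane) : Fin 2 → ℝ :=
  ![-clock ψ x 1 / frameDet ψ x, clock ψ x 0 / frameDet ψ x]

/-- `v^μ ∂_μ X`. -/
def derivV (ψ : Fields) (x : Plane) : ℝ := ∑ μ, vecV ψ x μ * pd μ (dil ψ) x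

/-- `e^μ ∂_μ X`. -/
def derivE (ψ : Fields) (x : Plane) : ℝ := ∑ μ, vecE ψ x μ * pd μ (dil ψ) x

/-- The extrinsic curvature `K = 2 e^μ v^ν ∂_[μ e_ν]`. -/
def extrinsicK (ψ : Fields) (x : Plane) : ℝ :=
  ∑ μ, ∑ ν, vecE ψ x μ * vecV ψ x ν * curl (ruler ψ) μ ν x

/-- The boost connection `ω̂_μ = -2 e^ν ∂_[μ τ_ν]`. -/
def omegaHat (ψ : Fields) (x : Plane) (μ : Fin 2) : ℝ :=
  -∑ ν, vecE ψ x ν * curl (clock ψ) μ ν x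

/-- The curvature scalar `R = 4 e^μ v^ν ∂_[μ ω̂_ν]`. -/
def scalarR (ψ : Fields) (x : Plane) : ℝ :=
  2 * ∑ μ, ∑ ν, vecE ψ x μ * vecV ψ x ν * curl (omegaHat ψ) μ ν x

/-- Smooth fields on `O`, positively oriented, with dilaton values in `I`. -/
def IsAdmissible (I : Set ℝ) (O : Set Plane) (ψ : Fields) : Prop :=
  ContDiffOn ℝ ∞ ψ O ∧ ∀ x ∈ O, 0 < frameDet ψ x ∧ dil ψ x ∈ I

/-- Vector densities `J^μ` that are built locally, from the values and the first derivatives of the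
fields. The integral of `∂_μ J^μ` is what "boundary term" means. -/
abbrev Current := FieldVal × (Plane →L[ℝ] FieldVal) → Plane

/-- The vector density `J^μ` evaluated on a field configuration. -/
def Current.eval (j : Current) (ψ : Fields) (x : Plane) : Plane := j (ψ x, fderiv ℝ ψ x)

/-! ## Two-dimensional magnetic Carroll dilaton gravity -/

/-- `det(τ,e) (X R + 2 C v^μ ∂_μ X + 2 X_P K - U(X) (e^μ ∂_μ X)^2 + 2 V(X))`. -/
def carrollDilatonLagrangian (U V : ℝ → ℝ) (ψ : Fields) (x : Plane) : ℝ :=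
  frameDet ψ x * (dil ψ x * scalarR ψ x + 2 * fieldC ψ x * derivV ψ x
    + 2 * fieldP ψ x * extrinsicK ψ x - U (dil ψ x) * derivE ψ x ^ 2 + 2 * V (dil ψ x))

/-- The second order magnetic Carroll dilaton gravity action on the region `D`. -/
def carrollDilatonAction (k : ℝ) (U V : ℝ → ℝ) (ψ : Fields) (D : Set Plane) : ℝ :=
  k / (4 * Real.pi) * ∫ x in D, carrollDilatonLagrangian U V ψ x

/-! ## Spherical symmetry -/

section Spherical

variable {n : ℕ}

/-- The first two of `n + 2` coordinates. -/
def baseCoord (p : Fin (n + 1 + 1) → ℝ) : Plane := ![p 0, p 1]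

/-- The remaining `n` coordinates: stereographic coordinates on the unit sphere `S^n` (they cover the
sphere up to one point). -/
def sphereCoord (p : Fin (n + 1 + 1) → ℝ) (l : Fin n) : ℝ := p l.succ.succ

/-- The conformal factor `2 / (1 + |y|^2)`: the round metric of the unit sphere is
`∑_l ē^l ⊗ ē^l` with `ē^l = 2 / (1 + |y|^2) dy^l`. -/
def roundFactor (p : Fin (n + 1 + 1) → ℝ) : ℝ := 2 / (1 + ∑ l, sphereCoord p l ^ 2)

/-- A two-dimensional one-form, pulled back to `n + 2` dimensions. -/
def pullBack (w : Plane → Fin 2 → ℝ) (p : Fin (n + 1 + 1) → ℝ) : Fin (n + 1 + 1) → ℝ :=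
  Fin.cons (w (baseCoord p) 0) (Fin.cons (w (baseCoord p) 1) (fun _ => 0))

/-- The spherically symmetric clock form. -/
def sphericalClock (ψ : Fields) : (Fin (n + 1 + 1) → ℝ) → Fin (n + 1 + 1) → ℝ :=
  pullBack (clock ψ)

/-- The spherically symmetric coframe `e^1 = e`, `e^l = Φ ē^l`, so that the spatial metric is
`e ⊗ e + Φ^2 dΩ^2`. -/
def sphericalCoframe (ψ : Fields) :
    Fin (n + 1) → (Fin (n + 1 + 1) → ℝ) → Fin (n + 1 + 1) → ℝ :=
  Fin.cons (pullBack (ruler ψ))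
    (fun l p => Pi.single l.succ.succ (dil ψ (baseCoord p) * roundFactor p))

/-- The spherically symmetric tensor `C^{11} = C`, `C^{1l} = 0`, `C^{lm} = (φ / Φ) δ^{lm}`; it is the
one for which `ω^1 = ω̂ + C e` and `ω^l = φ ē^l`. -/
def sphericalC (ψ : Fields) : Fin (n + 1) → Fin (n + 1) → (Fin (n + 1 + 1) → ℝ) → ℝ :=
  fun a b p => if a = b then
    (Fin.cons (fieldC ψ (baseCoord p))
      (fun _ => fieldP ψ (baseCoord p) / dil ψ (baseCoord p)) : Fin (n + 1) → ℝ) a else 0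

end Spherical

/-- `k = π^{d/2} / (2 Γ(d/2) G_M) ((d-1)/λ)^{d-1}`. -/
def sphericalK (d : ℕ) (lam G : ℝ) : ℝ :=
  Real.pi ^ ((d : ℝ) / 2) / (2 * Real.Gamma ((d : ℝ) / 2) * G)
    * (((d : ℝ) - 1) / lam) ^ ((d : ℝ) - 1)

/-- `U(X) = -(d-2) / ((d-1) X)`. -/
def sphericalU (d : ℕ) (X : ℝ) : ℝ := -((d : ℝ) - 2) / (((d : ℝ) - 1) * X)

/-- `V(X) = λ^2 (d-2) / (2 (d-1)) X^{(d-3)/(d-1)}`. -/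
def sphericalV (d : ℕ) (lam X : ℝ) : ℝ :=
  lam ^ 2 * (((d : ℝ) - 2) / (2 * ((d : ℝ) - 1))) * X ^ (((d : ℝ) - 3) / ((d : ℝ) - 1))

/-- The field redefinition from `(τ, e, X, C', X_P)` to the spherically symmetric data
`(τ, e, Φ, C, φ)`: `Φ = (d-1)/λ X^{1/(d-1)}`, `φ = -(X_P/λ) X^{(2-d)/(d-1)}`,
`C = C' - φ λ (d-2)/(d-1) X^{1/(1-d)}`. -/
def fieldRedef (d : ℕ) (lam : ℝ) (w : FieldVal) : FieldVal :=
  let X := w.2.2.1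
  let φ := -(w.2.2.2.2 / lam) * X ^ ((2 - (d : ℝ)) / ((d : ℝ) - 1))
  (w.1, w.2.1, ((d : ℝ) - 1) / lam * X ^ (1 / ((d : ℝ) - 1)),
    w.2.2.2.1 - φ * lam * (((d : ℝ) - 2) / ((d : ℝ) - 1)) * X ^ (1 / (1 - (d : ℝ))), φ)

/-- The action of `(d+1)`-dimensional magnetic Carroll gravity, `d = n + 1`, on the spherically
symmetric configuration with data `χ = (τ, e, Φ, C, φ)` over `D × S^n`. -/
def sphericalAction (n : ℕ) (G : ℝ) (χ : Fields) (D : Set Plane) : ℝ :=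
  magneticAction (d := n + 1) G (sphericalClock χ) (sphericalCoframe χ) (sphericalC χ)
    {p | baseCoord p ∈ D}

/-! ## Lorentzian two-dimensional dilaton gravity -/

section Lorentzian

variable {m : ℕ}

/-- The Christoffel symbols `Γ^ρ_{μν}` of the Levi-Civita connection of `g`. -/
def christoffel (g : (Fin m → ℝ) → Matrix (Fin m) (Fin m) ℝ) (ρ μ ν : Fin m)
    (x : Fin m → ℝ) : ℝ :=
  (1 / 2) * ∑ α, (g x)⁻¹ ρ α *
    (pd μ (fun y => g y α ν) x + pd ν (fun y => g y α μ) x - pd α (fun y => g y μ ν) x)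

/-- The Ricci tensor `R_{μσ} = R^λ_{μλσ}`, with
`R^λ_{μνσ} = ∂_ν Γ^λ_{σμ} + Γ^λ_{νβ} Γ^β_{σμ} - (ν ↔ σ)`. -/
def ricci (g : (Fin m → ℝ) → Matrix (Fin m) (Fin m) ℝ) (μ σ : Fin m) (x : Fin m → ℝ) : ℝ :=
  ∑ l, (pd l (christoffel g l σ μ) x + ∑ β, christoffel g l l β x * christoffel g β σ μ x
    - (pd σ (christoffel g l l μ) x + ∑ β, christoffel g l σ β x * christoffel g β l μ x))

/-- The Ricci scalar. -/
def ricciScalar (g : (Fin m → ℝ) → Matrix (Fin m) (Fin m) ℝ) (x : Fin m → ℝ) : ℝ :=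
  ∑ μ, ∑ σ, (g x)⁻¹ μ σ * ricci g μ σ x

end Lorentzian

/-- The action
`k_rel / (4π) c^3 ∫ d^2x √(-g) (X R - U(X) g^{μν} ∂_μ X ∂_ν X + 2 V(X))`. -/
def lorentzianAction (c krel : ℝ) (U V : ℝ → ℝ) (g : Plane → Matrix (Fin 2) (Fin 2) ℝ)
    (X : Plane → ℝ) (D : Set Plane) : ℝ :=
  krel / (4 * Real.pi) * c ^ 3 * ∫ x in D, Real.sqrt (-(g x).det) *
    (X x * ricciScalar g x - U (X x) * (∑ μ, ∑ ν, (g x)⁻¹ μ ν * pd μ X x * pd ν X x)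
      + 2 * V (X x))

/-- The metric `g_{μν} = -c^2 T_μ T_ν + E_μ E_ν` in pre-Carroll variables. -/
def preCarrollMetric (c : ℝ) (ψ : Fields) (x : Plane) : Matrix (Fin 2) (Fin 2) ℝ :=
  Matrix.of fun μ ν => -c ^ 2 * clock ψ x μ * clock ψ x ν + ruler ψ x μ * ruler ψ x ν

/-- The coefficient of `c^2` in the Lagrangian:
`det(T,E) (2 K V^μ ∂_μ X + U(X) (V^μ ∂_μ X)^2)`. -/
def lagrangianTwo (U : ℝ → ℝ) (ψ : Fields) (x : Plane) : ℝ :=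
  frameDet ψ x * (2 * extrinsicK ψ x * derivV ψ x + U (dil ψ x) * derivV ψ x ^ 2)

/-- The coefficient of `c^4` in the Lagrangian:
`det(T,E) (X R - U(X) (E^μ ∂_μ X)^2 + 2 V(X))`. -/
def lagrangianFour (U V : ℝ → ℝ) (ψ : Fields) (x : Plane) : ℝ :=
  frameDet ψ x * (dil ψ x * scalarR ψ x - U (dil ψ x) * derivE ψ x ^ 2 + 2 * V (dil ψ x))

/-- The integrand of the Hubbard-Stratonovich transformation, as a function of the values `p` and `q`
of the auxiliary fields `X_P` and `C`; here `K` is the extrinsic curvature, `W = V^μ ∂_μ X` and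
`u = U(X)`. -/
def auxDensity (c K W u p q : ℝ) : ℝ :=
  -c ^ 4 * (K / W) * p ^ 2 + 2 * c ^ 2 * p * K
    - c ^ 4 * (W / (K + u * W)) * q ^ 2 + 2 * c ^ 2 * q * W

/-- The denominators of the auxiliary terms do not vanish on `O`. -/
def IsNondegenerate (U : ℝ → ℝ) (O : Set Plane) (ψ : Fields) : Prop :=
  ∀ x ∈ O, derivV ψ x ≠ 0 ∧ extrinsicK ψ x + U (dil ψ x) * derivV ψ x ≠ 0

/-- The `c^2` Lagrangian with auxiliary fields. -/
def lagrangianTwoAux (c : ℝ) (U : ℝ → ℝ) (ψ : Fields) (x : Plane) : ℝ :=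
  frameDet ψ x *
    auxDensity c (extrinsicK ψ x) (derivV ψ x) (U (dil ψ x)) (fieldP ψ x) (fieldC ψ x)

/-- The fields `X_P` and `C` satisfy their (algebraic) equations of motion at `x`. -/
def AuxOnShell (c : ℝ) (U : ℝ → ℝ) (ψ : Fields) (x : Plane) : Prop :=
  deriv (fun p => auxDensity c (extrinsicK ψ x) (derivV ψ x) (U (dil ψ x)) p (fieldC ψ x))
      (fieldP ψ x) = 0 ∧
  deriv (fun q => auxDensity c (extrinsicK ψ x) (derivV ψ x) (U (dil ψ x)) (fieldP ψ x) q)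
      (fieldC ψ x) = 0

/-- The Lorentzian action after the Hubbard-Stratonovich step. -/
def auxAction (c krel : ℝ) (U V : ℝ → ℝ) (ψ : Fields) (D : Set Plane) : ℝ :=
  krel / (4 * Real.pi) *
    ∫ x in D, (c ^ 2 * lagrangianTwoAux c U ψ x + c ^ 4 * lagrangianFour U V ψ x)

/-- Pre-Carroll variables and auxiliary fields that are smooth in `s = c^2` up to `s = 0`, and
whose leading order is nondegenerate. -/
def IsPreCarrollFamily (I : Set ℝ) (U : ℝ → ℝ) (ε : ℝ) (O : Set Plane) (Ψ : ℝ → Fields) : Prop :=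
  ContDiffOn ℝ ∞ (fun q : ℝ × Plane => Ψ q.1 q.2) (Ico 0 ε ×ˢ O) ∧
  (∀ s ∈ Ico 0 ε, IsAdmissible I O (Ψ s)) ∧ IsNondegenerate U O (Ψ 0)

end CarrollGravity

end

open CarrollGravity

/-!
*Spherical reduction.* On `O × S^n`, `n = d - 1`, the frame is block diagonal, and `ω^{1l}` and
`ω^{lm}` only have components along the sphere: with `ρ = 2 / (1 + |y|²)` they are
`-(e^μ ∂_μ Φ) ρ dy^l` and `ρ (y_l dy^m - y_m dy^l)`. With `ω^1 = ω̂ + C e` and `ω^l = φ ρ dy^l` the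
curvature scalar becomes a function on the plane, `reducedScalar` (`carrollScalar_spherical`), and
`det(τ, e^a) = det(τ, e) Φ^n ρ^n`. By Fubini's theorem the integral over the sphere contributes its
volume `2 π^{(n+1)/2} / Γ((n+1)/2)` (`integral_stereographic_volume`), which turns `1 / (16 π G)`
into `k / (4 π)` because `Φ^n = (n/λ)^n X`. What remains is an identity of densities on the plane
(`reducedLagrangian_eq`): since `∂_μ (det v^μ) = -det K`, moving the derivatives of `C`, `φ` and
`e^μ ∂_μ Φ` onto the dilaton yields the dilaton gravity Lagrangian and the divergence of
`(-2 X C' + (2/n) X_P) det v^μ - 2 (e^ν ∂_ν X) det e^μ`. All powers of `X` which occur are rational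
in `X` and `X^{1/n}`, so that the identity is algebraic in the fields and their derivatives.

*Magnetic expansion.* The Levi-Civita connection of `g = -c² T T + E E` is, in the zweibein, the
abelian connection `s = ω̂ + c⁻² K E` (`christoffel_preCarrollMetric`). Hence its Ricci scalar is
`2 (∂_0 s_1 - ∂_1 s_0) / det` (`ricciScalar_preCarrollMetric`), that is `R` plus `2 c⁻²` times the
curl of `K E` over `det`; integrating the latter by parts against `X` gives `2 K W` and the divergence
of `-2 c² X K det V^μ`.

*Auxiliary fields and the limit.* The auxiliary Lagrangian is a pair of quadratic polynomials with
stationary points `X_P = W / c²` (any `X_P` where `K = 0`) and `C = (K + U W) / c²`. Divided by `c⁴`, the Lagrangian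
`c² I_2^aux + c⁴ I_4` is a function of `s = c²` which is continuous up to `s = 0` on a strip around
the compact region `D`, and which is the Carroll Lagrangian at `s = 0`; dominated convergence gives
the limit (`tendsto_auxAction`). Commutativity is the combination with the spherical reduction.
-/

noncomputable section

namespace CarrollGravity

/-! ### Rules for partial derivatives -/

section PartialDerivatives

variable {m : ℕ} {μ : Fin m} {f g : (Fin m → ℝ) → ℝ} {x : Fin m → ℝ}

lemma pd_congr (h : f =ᶠ[𝓝 x] g) : pd μ f x = pd μ g x := by
  simp only [pd, h.fderiv_eq]

lemma pd_congr_of_isOpen {O : Set (Fin m → ℝ)} (hO : IsOpen O) (hx : x ∈ O)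
    (h : ∀ y ∈ O, f y = g y) : pd μ f x = pd μ g x :=
  pd_congr (Filter.eventuallyEq_of_mem (hO.mem_nhds hx) h)

@[simp] lemma pd_const (c : ℝ) : pd μ (fun _ => c) x = 0 := by simp [pd]

lemma pd_add (hf : DifferentiableAt ℝ f x) (hg : DifferentiableAt ℝ g x) :
    pd μ (fun y => f y + g y) x = pd μ f x + pd μ g x := by
  simp only [pd, fderiv_fun_add hf hg, add_apply]

lemma pd_sub (hf : DifferentiableAt ℝ f x) (hg : DifferentiableAt ℝ g x) :
    pd μ (fun y => f y - g y) x = pd μ f x - pd μ g x := by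
  simp only [pd, fderiv_fun_sub hf hg, sub_apply]

lemma pd_neg : pd μ (fun y => -f y) x = -pd μ f x := by
  simp only [pd, fderiv_fun_neg, neg_apply]

lemma pd_mul (hf : DifferentiableAt ℝ f x) (hg : DifferentiableAt ℝ g x) :
    pd μ (fun y => f y * g y) x = pd μ f x * g x + f x * pd μ g x := by
  simp only [pd, fderiv_fun_mul hf hg, add_apply,
    smul_apply, smul_eq_mul]
  ring

lemma pd_const_mul (c : ℝ) (hf : DifferentiableAt ℝ f x) :
    pd μ (fun y => c * f y) x = c * pd μ f x := by
  rw [pd_mul (differentiableAt_const c) hf]; simp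

/-- The chain rule for a function of one variable. -/
lemma pd_comp {h : ℝ → ℝ} {h' : ℝ} (hh : HasDerivAt h h' (f x)) (hf : DifferentiableAt ℝ f x) :
    pd μ (fun y => h (f y)) x = h' * pd μ f x := by
  have := (hh.comp_hasFDerivAt x hf.hasFDerivAt).fderiv
  simp only [Function.comp_def] at this
  simp [pd, this]

lemma pd_div (hf : DifferentiableAt ℝ f x) (hg : DifferentiableAt ℝ g x) (h0 : g x ≠ 0) :
    pd μ (fun y => f y / g y) x = (pd μ f x * g x - f x * pd μ g x) / g x ^ 2 := by
  simp only [div_eq_mul_inv]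
  rw [pd_mul hf (hg.fun_inv h0), pd_comp (hasDerivAt_inv h0) hg]
  field_simp
  ring

/-- Partial derivatives of a `C^∞` function commute. -/
lemma pd_comm (ν : Fin m) (hf : ContDiffAt ℝ ∞ f x) :
    pd μ (pd ν f) x = pd ν (pd μ f) x := by
  have hs : IsSymmSndFDerivAt ℝ f x := hf.isSymmSndFDerivAt (by
    rw [minSmoothness_of_isRCLikeNormedField]; exact WithTop.coe_le_coe.2 (le_top : (2 : ℕ∞) ≤ ⊤))
  have hd : DifferentiableAt ℝ (fderiv ℝ f) x :=
    (hf.fderiv_right (m := ∞) (by simp)).differentiableAt (by simp)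
  have key : ∀ κ ι : Fin m, pd κ (pd ι f) x
      = fderiv ℝ (fderiv ℝ f) x (Pi.single κ 1) (Pi.single ι 1) := by
    intro κ ι
    have : pd ι f = fun y => fderiv ℝ f y (Pi.single ι 1) := rfl
    rw [pd, this, fderiv_clm_apply hd (differentiableAt_const _)]
    simp
  rw [key, key, hs.eq]

lemma pd_sum {ι : Type*} {s : Finset ι} {F : ι → (Fin m → ℝ) → ℝ}
    (hF : ∀ i ∈ s, DifferentiableAt ℝ (F i) x) :
    pd μ (fun y => ∑ i ∈ s, F i y) x = ∑ i ∈ s, pd μ (F i) x := by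
  simp only [pd, fderiv_fun_sum hF, sum_apply]

/-- A partial derivative of a smooth family of functions is a smooth family, also at boundary values
of the parameter. -/
lemma contDiffOn_pd_family {S : Set ℝ} {O : Set (Fin m → ℝ)} (hO : IsOpen O)
    {F : ℝ → (Fin m → ℝ) → ℝ} (μ : Fin m)
    (hF : ContDiffOn ℝ ∞ (fun q : ℝ × (Fin m → ℝ) => F q.1 q.2) (S ×ˢ O)) :
    ContDiffOn ℝ ∞ (fun q : ℝ × (Fin m → ℝ) => pd μ (F q.1) q.2) (S ×ˢ O) := by
  intro q hq
  have h1 : ContDiffWithinAt ℝ ∞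
      (Function.uncurry fun (p : ℝ × (Fin m → ℝ)) (y : Fin m → ℝ) => F p.1 y)
      ((S ×ˢ O) ×ˢ O) (q, q.2) := by
    have h2 := hF q hq
    refine ContDiffWithinAt.comp (g := fun q : ℝ × (Fin m → ℝ) => F q.1 q.2)
      (f := fun r : (ℝ × (Fin m → ℝ)) × (Fin m → ℝ) => (r.1.1, r.2)) (q, q.2) h2 ?_ ?_
    · exact (by fun_prop : ContDiff ℝ ∞
        fun r : (ℝ × (Fin m → ℝ)) × (Fin m → ℝ) => (r.1.1, r.2)).contDiffWithinAt
    · rintro ⟨⟨a, b⟩, y⟩ ⟨⟨ha, -⟩, hy⟩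
      exact ⟨ha, hy⟩
  have h3 := h1.fderivWithin_apply (m := ∞) (g := Prod.snd) (k := fun _ => Pi.single μ 1)
    contDiffWithinAt_snd contDiffWithinAt_const hO.uniqueDiffOn (by simp) hq (fun p hp => hp.2)
  refine h3.congr (fun p hp => ?_) ?_
  · simp only [pd, fderivWithin_of_isOpen hO hp.2]
  · simp only [pd, fderivWithin_of_isOpen hO hq.2]

/-- Smoothness in the coordinates is smoothness of the constant family. -/
lemma contDiffOn_const_family_iff {O : Set (Fin m → ℝ)} {E : Type*} [NormedAddCommGroup E]
    [NormedSpace ℝ E] {F : (Fin m → ℝ) → E} :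
    ContDiffOn ℝ ∞ (fun q : ℝ × (Fin m → ℝ) => F q.2) (univ ×ˢ O) ↔ ContDiffOn ℝ ∞ F O := by
  constructor
  · intro h
    exact h.comp (f := fun x => ((0 : ℝ), x)) (by fun_prop) (fun x hx => ⟨mem_univ _, hx⟩)
  · intro h
    exact h.comp contDiffOn_snd (fun q hq => hq.2)

lemma contDiffOn_pd {O : Set (Fin m → ℝ)} (hO : IsOpen O) (μ : Fin m)
    (hf : ContDiffOn ℝ ∞ f O) : ContDiffOn ℝ ∞ (pd μ f) O :=
  contDiffOn_const_family_iff.1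
    (contDiffOn_pd_family hO μ (F := fun _ => f) (contDiffOn_const_family_iff.2 hf))

end PartialDerivatives

lemma differentiableAt_of_contDiffOn {E F : Type*} [NormedAddCommGroup E] [NormedSpace ℝ E]
    [NormedAddCommGroup F] [NormedSpace ℝ F] {O : Set E} (hO : IsOpen O) {f : E → F}
    (hf : ContDiffOn ℝ ∞ f O) {x : E} (hx : x ∈ O) : DifferentiableAt ℝ f x :=
  (hf.contDiffAt (hO.mem_nhds hx)).differentiableAt (by simp)

/-! ### Zweibein formulas in two dimensions -/

section Zweibein

variable {ψ : Fields} {x : Plane}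

lemma curl_self {m : ℕ} (w : (Fin m → ℝ) → Fin m → ℝ) (μ : Fin m) (x : Fin m → ℝ) :
    curl w μ μ x = 0 := sub_self _

lemma curl_antisymm {m : ℕ} (w : (Fin m → ℝ) → Fin m → ℝ) (μ ν : Fin m) (x : Fin m → ℝ) :
    curl w μ ν x = -curl w ν μ x := by simp [curl]

lemma sum_frame_curl (h : frameDet ψ x ≠ 0) (w : Plane → Fin 2 → ℝ) :
    ∑ μ, ∑ ν, vecE ψ x μ * vecV ψ x ν * curl w μ ν x = curl w 0 1 x / frameDet ψ x := by
  simp only [Fin.sum_univ_two, curl_self, curl_antisymm w 1 0, vecE, vecV, Matrix.cons_val_zero,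
    Matrix.cons_val_one]
  field_simp
  simp only [frameDet]
  ring

lemma extrinsicK_eq (h : frameDet ψ x ≠ 0) :
    extrinsicK ψ x = curl (ruler ψ) 0 1 x / frameDet ψ x := sum_frame_curl h _

lemma scalarR_eq (h : frameDet ψ x ≠ 0) :
    scalarR ψ x = 2 * (curl (omegaHat ψ) 0 1 x / frameDet ψ x) := by
  rw [scalarR, sum_frame_curl h]

/-- In two dimensions `ω̂` is proportional to the clock form. -/
lemma omegaHat_eq (μ : Fin 2) :
    omegaHat ψ x μ = -(curl (clock ψ) 0 1 x / frameDet ψ x) * clock ψ x μ := by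
  fin_cases μ <;>
  simp [omegaHat, Fin.sum_univ_two, curl_self, curl_antisymm (clock ψ) 1 0, vecE] <;> ring

end Zweibein

/-! ### Smoothness of the geometric quantities -/

section Smoothness

/-- A family of field multiplets which is smooth in the parameter and in the coordinates, with
nondegenerate frames. The interval of parameters may have end points. -/
structure IsSmoothFamily (S : Set ℝ) (O : Set Plane) (Ψ : ℝ → Fields) : Prop where
  smooth : ContDiffOn ℝ ∞ (fun q : ℝ × Plane => Ψ q.1 q.2) (S ×ˢ O)
  det_ne_zero : ∀ s ∈ S, ∀ x ∈ O, frameDet (Ψ s) x ≠ 0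

variable {S : Set ℝ} {O : Set Plane} {Ψ : ℝ → Fields}

lemma IsSmoothFamily.clock (h : IsSmoothFamily S O Ψ) (μ : Fin 2) :
    ContDiffOn ℝ ∞ (fun q : ℝ × Plane => CarrollGravity.clock (Ψ q.1) q.2 μ) (S ×ˢ O) :=
  contDiffOn_pi.1 h.smooth.fst μ

lemma IsSmoothFamily.ruler (h : IsSmoothFamily S O Ψ) (μ : Fin 2) :
    ContDiffOn ℝ ∞ (fun q : ℝ × Plane => CarrollGravity.ruler (Ψ q.1) q.2 μ) (S ×ˢ O) :=
  contDiffOn_pi.1 h.smooth.snd.fst μ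

lemma IsSmoothFamily.dil (h : IsSmoothFamily S O Ψ) :
    ContDiffOn ℝ ∞ (fun q : ℝ × Plane => CarrollGravity.dil (Ψ q.1) q.2) (S ×ˢ O) :=
  h.smooth.snd.snd.fst

lemma IsSmoothFamily.fieldC (h : IsSmoothFamily S O Ψ) :
    ContDiffOn ℝ ∞ (fun q : ℝ × Plane => CarrollGravity.fieldC (Ψ q.1) q.2) (S ×ˢ O) :=
  h.smooth.snd.snd.snd.fst

lemma IsSmoothFamily.fieldP (h : IsSmoothFamily S O Ψ) :
    ContDiffOn ℝ ∞ (fun q : ℝ × Plane => CarrollGravity.fieldP (Ψ q.1) q.2) (S ×ˢ O) :=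
  h.smooth.snd.snd.snd.snd

lemma IsSmoothFamily.frameDet (h : IsSmoothFamily S O Ψ) :
    ContDiffOn ℝ ∞ (fun q : ℝ × Plane => CarrollGravity.frameDet (Ψ q.1) q.2) (S ×ˢ O) :=
  ((h.clock 0).mul (h.ruler 1)).sub ((h.clock 1).mul (h.ruler 0))

lemma IsSmoothFamily.vecV (h : IsSmoothFamily S O Ψ) (μ : Fin 2) :
    ContDiffOn ℝ ∞ (fun q : ℝ × Plane => CarrollGravity.vecV (Ψ q.1) q.2 μ) (S ×ˢ O) := by
  have hd : ∀ q ∈ S ×ˢ O, CarrollGravity.frameDet (Ψ q.1) q.2 ≠ 0 :=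
    fun q hq => h.det_ne_zero _ hq.1 _ hq.2
  fin_cases μ
  · exact (h.ruler 1).neg.div h.frameDet hd
  · exact (h.ruler 0).div h.frameDet hd

lemma IsSmoothFamily.vecE (h : IsSmoothFamily S O Ψ) (μ : Fin 2) :
    ContDiffOn ℝ ∞ (fun q : ℝ × Plane => CarrollGravity.vecE (Ψ q.1) q.2 μ) (S ×ˢ O) := by
  have hd : ∀ q ∈ S ×ˢ O, CarrollGravity.frameDet (Ψ q.1) q.2 ≠ 0 :=
    fun q hq => h.det_ne_zero _ hq.1 _ hq.2
  fin_cases μ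
  · exact (h.clock 1).neg.div h.frameDet hd
  · exact (h.clock 0).div h.frameDet hd

lemma IsSmoothFamily.derivV (h : IsSmoothFamily S O Ψ) (hO : IsOpen O) :
    ContDiffOn ℝ ∞ (fun q : ℝ × Plane => CarrollGravity.derivV (Ψ q.1) q.2) (S ×ˢ O) :=
  ContDiffOn.sum fun μ _ => (h.vecV μ).mul
    (contDiffOn_pd_family hO μ (F := fun s => CarrollGravity.dil (Ψ s)) h.dil)

lemma IsSmoothFamily.derivE (h : IsSmoothFamily S O Ψ) (hO : IsOpen O) :
    ContDiffOn ℝ ∞ (fun q : ℝ × Plane => CarrollGravity.derivE (Ψ q.1) q.2) (S ×ˢ O) :=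
  ContDiffOn.sum fun μ _ => (h.vecE μ).mul
    (contDiffOn_pd_family hO μ (F := fun s => CarrollGravity.dil (Ψ s)) h.dil)

lemma contDiffOn_curl_family {m : ℕ} {O : Set (Fin m → ℝ)} (hO : IsOpen O)
    {w : ℝ → (Fin m → ℝ) → Fin m → ℝ}
    (hw : ∀ μ, ContDiffOn ℝ ∞ (fun q : ℝ × (Fin m → ℝ) => w q.1 q.2 μ) (S ×ˢ O)) (μ ν : Fin m) :
    ContDiffOn ℝ ∞ (fun q : ℝ × (Fin m → ℝ) => curl (w q.1) μ ν q.2) (S ×ˢ O) :=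
  (contDiffOn_pd_family hO μ (F := fun s y => w s y ν) (hw ν)).sub
    (contDiffOn_pd_family hO ν (F := fun s y => w s y μ) (hw μ))

lemma IsSmoothFamily.extrinsicK (h : IsSmoothFamily S O Ψ) (hO : IsOpen O) :
    ContDiffOn ℝ ∞ (fun q : ℝ × Plane => CarrollGravity.extrinsicK (Ψ q.1) q.2) (S ×ˢ O) :=
  ContDiffOn.sum fun μ _ => ContDiffOn.sum fun ν _ => ((h.vecE μ).mul (h.vecV ν)).mul
    (contDiffOn_curl_family hO (w := fun s => CarrollGravity.ruler (Ψ s)) h.ruler μ ν)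

lemma IsSmoothFamily.omegaHat (h : IsSmoothFamily S O Ψ) (hO : IsOpen O) (μ : Fin 2) :
    ContDiffOn ℝ ∞ (fun q : ℝ × Plane => CarrollGravity.omegaHat (Ψ q.1) q.2 μ) (S ×ˢ O) :=
  (ContDiffOn.sum fun ν _ => (h.vecE ν).mul
    (contDiffOn_curl_family hO (w := fun s => CarrollGravity.clock (Ψ s)) h.clock μ ν)).neg

lemma IsSmoothFamily.scalarR (h : IsSmoothFamily S O Ψ) (hO : IsOpen O) :
    ContDiffOn ℝ ∞ (fun q : ℝ × Plane => CarrollGravity.scalarR (Ψ q.1) q.2) (S ×ˢ O) :=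
  contDiffOn_const.mul (ContDiffOn.sum fun μ _ => ContDiffOn.sum fun ν _ =>
    ((h.vecE μ).mul (h.vecV ν)).mul
      (contDiffOn_curl_family hO (w := fun s => CarrollGravity.omegaHat (Ψ s)) (h.omegaHat hO) μ ν))

/-- A constant family of admissible fields is a smooth family. -/
lemma IsAdmissible.isSmoothFamily {I : Set ℝ} {ψ : Fields} (h : IsAdmissible I O ψ) :
    IsSmoothFamily univ O (fun _ => ψ) :=
  ⟨contDiffOn_const_family_iff.2 h.1, fun _ _ x hx => (h.2 x hx).1.ne'⟩

end Smoothness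

/-! ### Elimination of the auxiliary fields -/

section Auxiliary

lemma deriv_auxDensity_left (c K W u p q : ℝ) :
    deriv (fun p => auxDensity c K W u p q) p = -c ^ 4 * (K / W) * (2 * p) + 2 * c ^ 2 * K := by
  have h : HasDerivAt (fun p => auxDensity c K W u p q)
      (-c ^ 4 * (K / W) * (2 * p) + 2 * c ^ 2 * K) p := by
    have h1 := ((((hasDerivAt_id p).pow 2).const_mul (-c ^ 4 * (K / W))).add
      (((hasDerivAt_id p).const_mul (2 * c ^ 2)).mul_const K))
    have h2 := (h1.sub_const (c ^ 4 * (W / (K + u * W)) * q ^ 2)).add_const (2 * c ^ 2 * q * W)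
    refine (h2.congr_deriv ?_).congr_of_eventuallyEq (Eventually.of_forall fun y => ?_)
    · simp
    · simp [auxDensity]
  exact h.deriv

lemma deriv_auxDensity_right (c K W u p q : ℝ) :
    deriv (fun q => auxDensity c K W u p q) q
      = -c ^ 4 * (W / (K + u * W)) * (2 * q) + 2 * c ^ 2 * W := by
  have h : HasDerivAt (fun q => auxDensity c K W u p q)
      (-c ^ 4 * (W / (K + u * W)) * (2 * q) + 2 * c ^ 2 * W) q := by
    have h1 := ((((hasDerivAt_id q).pow 2).const_mul (-c ^ 4 * (W / (K + u * W)))).add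
      (((hasDerivAt_id q).const_mul (2 * c ^ 2)).mul_const W))
    have h2 := h1.add_const (-c ^ 4 * (K / W) * p ^ 2 + 2 * c ^ 2 * p * K)
    refine (h2.congr_deriv ?_).congr_of_eventuallyEq (Eventually.of_forall fun y => ?_)
    · simp
    · simp [auxDensity]; ring
  exact h.deriv

lemma auxOnShell_iff {c : ℝ} {U : ℝ → ℝ} {ψ : Fields} {x : Plane} :
    AuxOnShell c U ψ x ↔
      -c ^ 4 * (extrinsicK ψ x / derivV ψ x) * (2 * fieldP ψ x) + 2 * c ^ 2 * extrinsicK ψ x = 0 ∧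
      -c ^ 4 * (derivV ψ x / (extrinsicK ψ x + U (dil ψ x) * derivV ψ x)) * (2 * fieldC ψ x)
        + 2 * c ^ 2 * derivV ψ x = 0 := by
  rw [AuxOnShell, deriv_auxDensity_left, deriv_auxDensity_right]

/-- At its stationary points the auxiliary Lagrangian equals the `c^2` Lagrangian. For `K = 0` the
value of `X_P` is not determined there, but `X_P` drops out. -/
lemma lagrangianTwoAux_eq_of_auxOnShell {c : ℝ} (hc : c ≠ 0) {U : ℝ → ℝ} {ψ : Fields} {x : Plane}
    (hW : derivV ψ x ≠ 0) (hZ : extrinsicK ψ x + U (dil ψ x) * derivV ψ x ≠ 0)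
    (h : AuxOnShell c U ψ x) : lagrangianTwoAux c U ψ x = lagrangianTwo U ψ x := by
  obtain ⟨h1, h2⟩ := auxOnShell_iff.1 h
  rw [lagrangianTwoAux, lagrangianTwo, auxDensity]
  generalize extrinsicK ψ x = K at *
  generalize derivV ψ x = W at *
  generalize U (dil ψ x) = u at *
  generalize fieldP ψ x = p at *
  generalize fieldC ψ x = q at *
  generalize hZdef : K + u * W = Z at *
  have hq : c ^ 2 * q = Z := by
    have h3 : (2 * c ^ 2 * W) * (Z - c ^ 2 * q) = 0 := by
      have := congrArg (Z * ·) h2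
      field_simp at this
      linear_combination this
    linarith [(mul_eq_zero.1 h3).resolve_left (by positivity)]
  have hp : K = 0 ∨ c ^ 2 * p = W := by
    by_cases hK : K = 0
    · exact Or.inl hK
    · right
      have h3 : (2 * c ^ 2 * K) * (W - c ^ 2 * p) = 0 := by
        have := congrArg (W * ·) h1
        field_simp at this
        linear_combination this
      linarith [(mul_eq_zero.1 h3).resolve_left (by positivity)]
  have e2 : -c ^ 4 * (W / Z) * q ^ 2 + 2 * c ^ 2 * q * W = W * Z := by
    have : -c ^ 4 * (W / Z) * q ^ 2 + 2 * c ^ 2 * q * W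
      = -(W / Z) * (c ^ 2 * q) ^ 2 + 2 * (c ^ 2 * q) * W := by ring
    rw [this, hq]; field_simp; ring
  have e1 : -c ^ 4 * (K / W) * p ^ 2 + 2 * c ^ 2 * p * K = K * W := by
    rcases hp with rfl | hp
    · simp
    · have : -c ^ 4 * (K / W) * p ^ 2 + 2 * c ^ 2 * p * K
        = -(K / W) * (c ^ 2 * p) ^ 2 + 2 * (c ^ 2 * p) * K := by ring
      rw [this, hp]; field_simp; ring
  linear_combination frameDet ψ x * (e1 + e2 - W * hZdef)

lemma contDiffOn_field_quantity {O : Set Plane} {F : Plane → ℝ}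
    (h : ContDiffOn ℝ ∞ (fun q : ℝ × Plane => F q.2) (univ ×ˢ O)) : ContDiffOn ℝ ∞ F O :=
  contDiffOn_const_family_iff.1 h

lemma exists_auxOnShell (c : ℝ) {I : Set ℝ} {U : ℝ → ℝ}
    (hU : ContDiffOn ℝ ∞ U I) {O : Set Plane} (hO : IsOpen O) {ψ : Fields}
    (hψ : IsAdmissible I O ψ) (hnd : IsNondegenerate U O ψ) :
    ∃ ψ' : Fields, IsAdmissible I O ψ' ∧
      ∀ x ∈ O, clock ψ' x = clock ψ x ∧ ruler ψ' x = ruler ψ x ∧ dil ψ' x = dil ψ x ∧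
        AuxOnShell c U ψ' x := by
  have hs := hψ.isSmoothFamily
  have hK := contDiffOn_field_quantity (hs.extrinsicK hO)
  have hW := contDiffOn_field_quantity (hs.derivV hO)
  have hUX : ContDiffOn ℝ ∞ (fun x => U (dil ψ x)) O :=
    hU.comp (contDiffOn_field_quantity hs.dil) (fun x hx => (hψ.2 x hx).2)
  -- The stationary point is `X_P = W / c^2`, `C = (K + U W) / c^2`.
  let ψ' : Fields := fun x => (clock ψ x, ruler ψ x, dil ψ x,
    (extrinsicK ψ x + U (dil ψ x) * derivV ψ x) / c ^ 2, derivV ψ x / c ^ 2)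
  refine ⟨ψ', ⟨?_, fun x hx => hψ.2 x hx⟩, fun x hx => ⟨rfl, rfl, rfl, ?_⟩⟩
  · exact hψ.1.fst.prodMk (hψ.1.snd.fst.prodMk (hψ.1.snd.snd.fst.prodMk
      (((hK.add (hUX.mul hW)).div_const _).prodMk (hW.div_const _))))
  · obtain ⟨h1, h2⟩ := hnd x hx
    rw [auxOnShell_iff]
    change -c ^ 4 * (extrinsicK ψ x / derivV ψ x) * (2 * (derivV ψ x / c ^ 2))
        + 2 * c ^ 2 * extrinsicK ψ x = 0 ∧
      -c ^ 4 * (derivV ψ x / (extrinsicK ψ x + U (dil ψ x) * derivV ψ x))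
        * (2 * ((extrinsicK ψ x + U (dil ψ x) * derivV ψ x) / c ^ 2)) + 2 * c ^ 2 * derivV ψ x = 0
    generalize extrinsicK ψ x + U (dil ψ x) * derivV ψ x = Z at *
    constructor <;> field_simp <;> ring

end Auxiliary

/-! ### The magnetic limit -/

section Limit

/-- Integrals over a compact set depend continuously on a parameter if the integrand does. -/
lemma tendsto_setIntegral_of_continuousOn {E : Type*} [TopologicalSpace E] [MeasurableSpace E]
    [OpensMeasurableSpace E] [T2Space E] {ν : Measure E} [IsFiniteMeasureOnCompacts ν]
    {δ : ℝ} (hδ : 0 < δ) {D : Set E} (hD : IsCompact D)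
    {F : ℝ → E → ℝ} (hF : ContinuousOn (fun q : ℝ × E => F q.1 q.2) (Icc 0 δ ×ˢ D)) :
    Tendsto (fun s => ∫ x in D, F s x ∂ν) (𝓝[Icc 0 δ] 0) (𝓝 (∫ x in D, F 0 x ∂ν)) := by
  obtain ⟨B, hB⟩ := (isCompact_Icc.prod hD).exists_bound_of_continuousOn hF
  have h0 : (0 : ℝ) ∈ Icc 0 δ := ⟨le_rfl, hδ.le⟩
  have hsec : ∀ s ∈ Icc 0 δ, ContinuousOn (F s) D := fun s hs =>
    hF.comp (f := fun x => (s, x)) (by fun_prop) (fun x hx => ⟨hs, hx⟩)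
  refine tendsto_integral_filter_of_dominated_convergence (fun _ => B) ?_ ?_ ?_ ?_
  · filter_upwards [self_mem_nhdsWithin] with s hs
    exact (hsec s hs).aestronglyMeasurable_of_isCompact hD hD.measurableSet
  · filter_upwards [self_mem_nhdsWithin] with s hs
    filter_upwards [ae_restrict_mem hD.measurableSet] with x hx
    exact hB (s, x) ⟨hs, hx⟩
  · exact integrableOn_const hD.measure_lt_top.ne
  · filter_upwards [ae_restrict_mem hD.measurableSet] with x hx
    have : ContinuousOn (fun s => F s x) (Icc 0 δ) :=
      hF.comp (f := fun s => (s, x)) (by fun_prop) (fun s hs => ⟨hs, hx⟩)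
    exact this 0 h0

/-- A continuous function without zeros on `{0} × D` has no zeros on a strip `[0, δ] × D`. -/
lemma exists_strip_ne_zero {E : Type*} [TopologicalSpace E] {ε : ℝ} (hε : 0 < ε) {O D : Set E}
    (hD : IsCompact D) (hDO : D ⊆ O) {F : ℝ → E → ℝ}
    (hF : ContinuousOn (fun q : ℝ × E => F q.1 q.2) (Ico 0 ε ×ˢ O)) (h0 : ∀ x ∈ D, F 0 x ≠ 0) :
    ∃ δ, 0 < δ ∧ δ < ε ∧ ∀ s ∈ Icc 0 δ, ∀ x ∈ D, F s x ≠ 0 := by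
  have key : ∀ᶠ s in 𝓝 (0 : ℝ), ∀ x ∈ D, (s, x) ∈ Ico 0 ε ×ˢ O → F s x ≠ 0 := by
    refine hD.eventually_forall_of_forall_eventually fun x hx => ?_
    have h1 := hF (0, x) ⟨⟨le_rfl, hε⟩, hDO hx⟩
    exact eventually_nhdsWithin_iff.1 (h1.eventually_ne (h0 x hx))
  obtain ⟨r, hr, hball⟩ := Metric.eventually_nhds_iff.1 key
  refine ⟨min (r / 2) (ε / 2), by positivity, by
    have := min_le_right (r / 2) (ε / 2); linarith, fun s hs x hx => ?_⟩
  have h1 := hs.2.trans (min_le_left _ _)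
  have h2 := hs.2.trans (min_le_right _ _)
  refine hball ?_ x hx ⟨⟨hs.1, by linarith⟩, hDO hx⟩
  rw [Real.dist_eq, sub_zero, abs_of_nonneg hs.1]
  linarith

/-- The Lagrangian of `c^2 I_2^aux + c^4 I_4`, divided by `c^4`, as a function of `s = c^2`. It is
defined at `s = 0`, where it is the Carroll Lagrangian. -/
def rescaledAuxLagrangian (U V : ℝ → ℝ) (s : ℝ) (ψ : Fields) (x : Plane) : ℝ :=
  frameDet ψ x * (-s * (extrinsicK ψ x / derivV ψ x) * fieldP ψ x ^ 2
      + 2 * fieldP ψ x * extrinsicK ψ x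
      - s * (derivV ψ x / (extrinsicK ψ x + U (dil ψ x) * derivV ψ x)) * fieldC ψ x ^ 2
      + 2 * fieldC ψ x * derivV ψ x)
    + lagrangianFour U V ψ x

lemma rescaledAuxLagrangian_zero (U V : ℝ → ℝ) (ψ : Fields) (x : Plane) :
    rescaledAuxLagrangian U V 0 ψ x = carrollDilatonLagrangian U V ψ x := by
  simp only [rescaledAuxLagrangian, lagrangianFour, carrollDilatonLagrangian]
  ring

lemma auxAction_eq_rescaled {c : ℝ} (hc : c ≠ 0) (k : ℝ) (U V : ℝ → ℝ) (ψ : Fields)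
    (D : Set Plane) :
    auxAction c (k / c ^ 4) U V ψ D
      = k / (4 * Real.pi) * ∫ x in D, rescaledAuxLagrangian U V (c ^ 2) ψ x := by
  have h : ∀ x, c ^ 2 * lagrangianTwoAux c U ψ x + c ^ 4 * lagrangianFour U V ψ x
      = c ^ 4 * rescaledAuxLagrangian U V (c ^ 2) ψ x := fun x => by
    simp only [lagrangianTwoAux, auxDensity, rescaledAuxLagrangian]
    ring
  simp only [auxAction, h, integral_const_mul]
  field_simp

/-- With `k = k_rel c^4` fixed, the relativistic action converges to the magnetic Carroll action. -/
theorem tendsto_auxAction {I : Set ℝ} {U V : ℝ → ℝ} (hU : ContDiffOn ℝ ∞ U I)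
    (hV : ContDiffOn ℝ ∞ V I) (k : ℝ) {ε : ℝ} (hε : 0 < ε) {O : Set Plane} (hO : IsOpen O)
    {Ψ : ℝ → Fields} (hΨ : IsPreCarrollFamily I U ε O Ψ) {D : Set Plane} (hD : IsCompact D)
    (hDO : D ⊆ O) :
    Tendsto (fun c : ℝ => auxAction c (k / c ^ 4) U V (Ψ (c ^ 2)) D) (𝓝[>] 0)
      (𝓝 (carrollDilatonAction k U V (Ψ 0) D)) := by
  obtain ⟨hsm, hadm, hnd⟩ := hΨ
  have hs : IsSmoothFamily (Ico 0 ε) O Ψ := ⟨hsm, fun s hs x hx => ((hadm s hs).2 x hx).1.ne'⟩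
  have hX : ∀ q ∈ Ico 0 ε ×ˢ O, dil (Ψ q.1) q.2 ∈ I :=
    fun q hq => ((hadm q.1 hq.1).2 q.2 hq.2).2
  have cK := (hs.extrinsicK hO).continuousOn
  have cW := (hs.derivV hO).continuousOn
  have cU : ContinuousOn (fun q : ℝ × Plane => U (dil (Ψ q.1) q.2)) (Ico 0 ε ×ˢ O) :=
    hU.continuousOn.comp hs.dil.continuousOn hX
  have cV : ContinuousOn (fun q : ℝ × Plane => V (dil (Ψ q.1) q.2)) (Ico 0 ε ×ˢ O) :=
    hV.continuousOn.comp hs.dil.continuousOn hX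
  -- The auxiliary terms are regular on a strip `0 ≤ s ≤ δ`.
  obtain ⟨δ, hδ, hδε, hne⟩ := exists_strip_ne_zero hε hD hDO
    (F := fun s x => derivV (Ψ s) x *
      (extrinsicK (Ψ s) x + U (dil (Ψ s) x) * derivV (Ψ s) x))
    (cW.mul (cK.add (cU.mul cW)))
    (fun x hx => mul_ne_zero (hnd x (hDO hx)).1 (hnd x (hDO hx)).2)
  have hsub : Icc 0 δ ×ˢ D ⊆ Ico 0 ε ×ˢ O :=
    prod_mono (fun s hs => ⟨hs.1, hs.2.trans_lt hδε⟩) hDO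
  have hcont : ContinuousOn (fun q : ℝ × Plane => rescaledAuxLagrangian U V q.1 (Ψ q.1) q.2)
      (Icc 0 δ ×ˢ D) := by
    have cs : ContinuousOn (fun q : ℝ × Plane => q.1) (Icc 0 δ ×ˢ D) := continuousOn_fst
    have cD := hs.frameDet.continuousOn.mono hsub
    have cX := hs.dil.continuousOn.mono hsub
    have cP := hs.fieldP.continuousOn.mono hsub
    have cC := hs.fieldC.continuousOn.mono hsub
    have cE := (hs.derivE hO).continuousOn.mono hsub
    have cR := (hs.scalarR hO).continuousOn.mono hsub
    replace cK := cK.mono hsub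
    replace cW := cW.mono hsub
    replace cU := cU.mono hsub
    replace cV := cV.mono hsub
    have c1 := cK.div cW (fun q hq => left_ne_zero_of_mul (hne q.1 hq.1 q.2 hq.2))
    have c2 := cW.div (cK.add (cU.mul cW)) (fun q hq => right_ne_zero_of_mul (hne q.1 hq.1 q.2 hq.2))
    have c3 : ContinuousOn (fun q : ℝ × Plane => lagrangianFour U V (Ψ q.1) q.2)
        (Icc 0 δ ×ˢ D) :=
      cD.mul (((cX.mul cR).sub (cU.mul (cE.pow 2))).add (continuousOn_const.mul cV))
    exact (cD.mul (((((cs.neg.mul c1).mul (cP.pow 2)).add ((continuousOn_const.mul cP).mul cK)).sub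
      ((cs.mul c2).mul (cC.pow 2))).add ((continuousOn_const.mul cC).mul cW))).add c3
  have hlim := tendsto_setIntegral_of_continuousOn (ν := volume) hδ hD
    (F := fun s x => rescaledAuxLagrangian U V s (Ψ s) x) hcont
  have hsq : Tendsto (fun c : ℝ => c ^ 2) (𝓝[>] 0) (𝓝[Icc 0 δ] 0) := by
    refine tendsto_nhdsWithin_iff.2 ⟨?_, ?_⟩
    · have : Tendsto (fun c : ℝ => c ^ 2) (𝓝 0) (𝓝 (0 ^ 2)) := by
        exact (continuous_pow 2).tendsto 0
      rw [zero_pow two_ne_zero] at this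
      exact this.mono_left nhdsWithin_le_nhds
    · have : ∀ᶠ c : ℝ in 𝓝 0, c ^ 2 < δ :=
        (continuous_pow 2).tendsto' 0 0 (by simp) |>.eventually_lt_const hδ
      filter_upwards [nhdsWithin_le_nhds this] with c hc
      exact ⟨sq_nonneg c, hc.le⟩
  have := (hlim.comp hsq).const_mul (k / (4 * Real.pi))
  simp only [rescaledAuxLagrangian_zero] at this
  refine this.congr' ?_
  filter_upwards [self_mem_nhdsWithin] with c hc
  exact (auxAction_eq_rescaled (ne_of_gt hc) k U V _ D).symm

end Limit

/-! ### Field components of admissible configurations -/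

section Components

variable {I : Set ℝ} {O : Set Plane} {ψ : Fields} {x : Plane}

lemma IsAdmissible.contDiffOn_clock (h : IsAdmissible I O ψ) (μ : Fin 2) :
    ContDiffOn ℝ ∞ (fun x => clock ψ x μ) O := contDiffOn_pi.1 h.1.fst μ

lemma IsAdmissible.contDiffOn_ruler (h : IsAdmissible I O ψ) (μ : Fin 2) :
    ContDiffOn ℝ ∞ (fun x => ruler ψ x μ) O := contDiffOn_pi.1 h.1.snd.fst μ

lemma IsAdmissible.contDiffOn_dil (h : IsAdmissible I O ψ) : ContDiffOn ℝ ∞ (dil ψ) O :=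
  h.1.snd.snd.fst

lemma IsAdmissible.contDiffOn_fieldC (h : IsAdmissible I O ψ) : ContDiffOn ℝ ∞ (fieldC ψ) O :=
  h.1.snd.snd.snd.fst

lemma IsAdmissible.contDiffOn_fieldP (h : IsAdmissible I O ψ) : ContDiffOn ℝ ∞ (fieldP ψ) O :=
  h.1.snd.snd.snd.snd

lemma IsAdmissible.contDiffOn_frameDet (h : IsAdmissible I O ψ) :
    ContDiffOn ℝ ∞ (frameDet ψ) O := contDiffOn_field_quantity h.isSmoothFamily.frameDet

lemma IsAdmissible.contDiffOn_vecV (h : IsAdmissible I O ψ) (μ : Fin 2) :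
    ContDiffOn ℝ ∞ (fun x => vecV ψ x μ) O :=
  contDiffOn_field_quantity (h.isSmoothFamily.vecV μ)

lemma IsAdmissible.contDiffOn_vecE (h : IsAdmissible I O ψ) (μ : Fin 2) :
    ContDiffOn ℝ ∞ (fun x => vecE ψ x μ) O :=
  contDiffOn_field_quantity (h.isSmoothFamily.vecE μ)

lemma IsAdmissible.contDiffOn_derivV (h : IsAdmissible I O ψ) (hO : IsOpen O) :
    ContDiffOn ℝ ∞ (derivV ψ) O := contDiffOn_field_quantity (h.isSmoothFamily.derivV hO)

lemma IsAdmissible.contDiffOn_derivE (h : IsAdmissible I O ψ) (hO : IsOpen O) :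
    ContDiffOn ℝ ∞ (derivE ψ) O := contDiffOn_field_quantity (h.isSmoothFamily.derivE hO)

lemma IsAdmissible.contDiffOn_extrinsicK (h : IsAdmissible I O ψ) (hO : IsOpen O) :
    ContDiffOn ℝ ∞ (extrinsicK ψ) O := contDiffOn_field_quantity (h.isSmoothFamily.extrinsicK hO)

lemma IsAdmissible.contDiffOn_omegaHat (h : IsAdmissible I O ψ) (hO : IsOpen O) (μ : Fin 2) :
    ContDiffOn ℝ ∞ (fun x => omegaHat ψ x μ) O :=
  contDiffOn_field_quantity (h.isSmoothFamily.omegaHat hO μ)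

lemma IsAdmissible.contDiffOn_scalarR (h : IsAdmissible I O ψ) (hO : IsOpen O) :
    ContDiffOn ℝ ∞ (scalarR ψ) O := contDiffOn_field_quantity (h.isSmoothFamily.scalarR hO)

/-- The components of the first jet of `ψ` are the partial derivatives of the fields. -/
lemma fderiv_ruler_apply (h : DifferentiableAt ℝ ψ x) (μ ν : Fin 2) :
    (fderiv ℝ ψ x (Pi.single μ 1)).2.1 ν = pd μ (fun y => ruler ψ y ν) x := by
  have h1 := hasFDerivAt_pi'.1 h.hasFDerivAt.snd.fst ν
  rw [pd, show (fun y => ruler ψ y ν) = fun y => (ψ y).2.1 ν from rfl, h1.fderiv]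
  rfl

lemma fderiv_dil_apply (h : DifferentiableAt ℝ ψ x) (μ : Fin 2) :
    (fderiv ℝ ψ x (Pi.single μ 1)).2.2.1 = pd μ (dil ψ) x := by
  rw [pd, show dil ψ = fun y => (ψ y).2.2.1 from rfl, h.hasFDerivAt.snd.snd.fst.fderiv]
  rfl

lemma ContDiffOn.integrableOn_compact {f : Plane → ℝ} (hf : ContDiffOn ℝ ∞ f O) {D : Set Plane}
    (hD : IsCompact D) (hDO : D ⊆ O) : IntegrableOn f D :=
  (hf.continuousOn.mono hDO).integrableOn_compact hD

lemma contDiffOn_divergence {m : ℕ} {O : Set (Fin m → ℝ)} (hO : IsOpen O)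
    {J : (Fin m → ℝ) → Fin m → ℝ} (hJ : ContDiffOn ℝ ∞ J O) :
    ContDiffOn ℝ ∞ (divergence J) O :=
  ContDiffOn.sum fun μ _ => contDiffOn_pd hO μ (contDiffOn_pi.1 hJ μ)

end Components

/-! ### The Levi-Civita connection of the pre-Carroll metric -/

section LeviCivita

/-- The Riemann tensor `R^l_{μνσ}`. -/
def riemann {m : ℕ} (g : (Fin m → ℝ) → Matrix (Fin m) (Fin m) ℝ) (l μ ν σ : Fin m)
    (x : Fin m → ℝ) : ℝ :=
  pd ν (christoffel g l σ μ) x + ∑ β, christoffel g l ν β x * christoffel g β σ μ x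
    - (pd σ (christoffel g l ν μ) x + ∑ β, christoffel g l σ β x * christoffel g β ν μ x)

lemma ricci_eq_sum_riemann {m : ℕ} (g : (Fin m → ℝ) → Matrix (Fin m) (Fin m) ℝ) (μ σ : Fin m)
    (x : Fin m → ℝ) : ricci g μ σ x = ∑ l, riemann g l μ l σ x := rfl

/-- The Lorentzian spin connection `s = ω̂ + c⁻² K e` of the zweibein `(T, E)`; it solves
`dT + s ∧ E = 0` and `dE + c² s ∧ T = 0`. -/
def spinConnection (c : ℝ) (ψ : Fields) (x : Plane) (μ : Fin 2) : ℝ :=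
  omegaHat ψ x μ + extrinsicK ψ x / c ^ 2 * ruler ψ x μ

variable {I : Set ℝ} {O : Set Plane} {ψ : Fields} {x : Plane} {c : ℝ}

lemma det_preCarrollMetric : (preCarrollMetric c ψ x).det = -(c * frameDet ψ x) ^ 2 := by
  simp only [preCarrollMetric, Matrix.det_fin_two, Matrix.of_apply, frameDet]
  ring

lemma sqrt_neg_det_preCarrollMetric (hc : 0 < c) (h : 0 < frameDet ψ x) :
    Real.sqrt (-(preCarrollMetric c ψ x).det) = c * frameDet ψ x := by
  rw [det_preCarrollMetric, neg_neg, Real.sqrt_sq (by positivity)]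

/-- The inverse metric `g^{μν} = -c⁻² v^μ v^ν + e^μ e^ν`. -/
lemma inv_preCarrollMetric (hc : c ≠ 0) (h : frameDet ψ x ≠ 0) :
    (preCarrollMetric c ψ x)⁻¹ =
      Matrix.of fun μ ν => -(vecV ψ x μ * vecV ψ x ν) / c ^ 2 + vecE ψ x μ * vecE ψ x ν := by
  refine Matrix.inv_eq_right_inv ?_
  have hD := h
  ext μ ν
  fin_cases μ <;> fin_cases ν <;>
  · simp [preCarrollMetric, Matrix.mul_apply, Fin.sum_univ_two, vecV, vecE]
    field_simp
    simp only [frameDet]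
    ring

lemma pd_preCarrollMetric (hO : IsOpen O) (h : IsAdmissible I O ψ) (hx : x ∈ O)
    (κ μ ν : Fin 2) :
    pd κ (fun y => preCarrollMetric c ψ y μ ν) x =
      -c ^ 2 * (pd κ (fun y => clock ψ y μ) x * clock ψ x ν
        + clock ψ x μ * pd κ (fun y => clock ψ y ν) x)
      + (pd κ (fun y => ruler ψ y μ) x * ruler ψ x ν
        + ruler ψ x μ * pd κ (fun y => ruler ψ y ν) x) := by
  have ht := fun i => differentiableAt_of_contDiffOn hO (h.contDiffOn_clock i) hx
  have he := fun i => differentiableAt_of_contDiffOn hO (h.contDiffOn_ruler i) hx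
  have : (fun y => preCarrollMetric c ψ y μ ν) = fun y =>
      -c ^ 2 * (clock ψ y μ * clock ψ y ν) + ruler ψ y μ * ruler ψ y ν := by
    funext y; simp only [preCarrollMetric, Matrix.of_apply]; ring
  rw [this, pd_add (((ht μ).fun_mul (ht ν)).const_mul _) ((he μ).fun_mul (he ν)),
    pd_const_mul _ ((ht μ).fun_mul (ht ν)), pd_mul (ht μ) (ht ν), pd_mul (he μ) (he ν)]

/-- The vielbein postulate: in the zweibein, the Levi-Civita connection is the spin connection. -/
lemma christoffel_preCarrollMetric (hc : c ≠ 0) (hO : IsOpen O) (h : IsAdmissible I O ψ)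
    (hx : x ∈ O) (ρ μ ν : Fin 2) :
    christoffel (preCarrollMetric c ψ) ρ μ ν x =
      -vecV ψ x ρ * (pd μ (fun y => clock ψ y ν) x + spinConnection c ψ x μ * ruler ψ x ν)
      + vecE ψ x ρ * (pd μ (fun y => ruler ψ y ν) x
        + c ^ 2 * spinConnection c ψ x μ * clock ψ x ν) := by
  have hD := (h.2 x hx).1.ne'
  simp only [christoffel, inv_preCarrollMetric hc hD, pd_preCarrollMetric hO h hx,
    spinConnection, omegaHat_eq, extrinsicK_eq hD, curl, Fin.sum_univ_two, Matrix.of_apply]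
  generalize pd (0 : Fin 2) (fun y => clock ψ y 0) x = t00
  generalize ht01 : pd (0 : Fin 2) (fun y => clock ψ y 1) x = t01
  generalize ht10 : pd (1 : Fin 2) (fun y => clock ψ y 0) x = t10
  fin_cases ρ <;> fin_cases μ <;> fin_cases ν <;>
  · simp [vecV, vecE, ht01, ht10]
    field_simp
    simp only [frameDet]
    ring

end LeviCivita

/-! ### The curvature of the pre-Carroll metric -/

section LeviCivitaCurvature

variable {I : Set ℝ} {O : Set Plane} {ψ : Fields} {x : Plane} {c : ℝ}

lemma contDiffOn_spinConnection (hO : IsOpen O) (h : IsAdmissible I O ψ) (μ : Fin 2) :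
    ContDiffOn ℝ ∞ (fun x => spinConnection c ψ x μ) O :=
  (h.contDiffOn_omegaHat hO μ).add
    (((h.contDiffOn_extrinsicK hO).div_const _).mul (h.contDiffOn_ruler μ))

lemma contDiffOn_christoffel (hc : c ≠ 0) (hO : IsOpen O) (h : IsAdmissible I O ψ)
    (ρ μ ν : Fin 2) : ContDiffOn ℝ ∞ (christoffel (preCarrollMetric c ψ) ρ μ ν) O := by
  refine ContDiffOn.congr ?_ fun y hy => christoffel_preCarrollMetric hc hO h hy ρ μ ν
  have s := contDiffOn_spinConnection (c := c) hO h μ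
  exact ((h.contDiffOn_vecV ρ).neg.mul ((contDiffOn_pd hO μ (h.contDiffOn_clock ν)).add
    (s.mul (h.contDiffOn_ruler ν)))).add ((h.contDiffOn_vecE ρ).mul
    ((contDiffOn_pd hO μ (h.contDiffOn_ruler ν)).add
      ((contDiffOn_const.mul s).mul (h.contDiffOn_clock ν))))

lemma sum_clock_vecV (h : frameDet ψ x ≠ 0) :
    clock ψ x 0 * vecV ψ x 0 + clock ψ x 1 * vecV ψ x 1 = -1 := by
  simp only [vecV, Matrix.cons_val_zero, Matrix.cons_val_one]
  field_simp
  simp only [frameDet]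
  ring

lemma sum_clock_vecE :
    clock ψ x 0 * vecE ψ x 0 + clock ψ x 1 * vecE ψ x 1 = 0 := by
  simp only [vecE, Matrix.cons_val_zero, Matrix.cons_val_one]
  ring

lemma sum_ruler_vecV :
    ruler ψ x 0 * vecV ψ x 0 + ruler ψ x 1 * vecV ψ x 1 = 0 := by
  simp only [vecV, Matrix.cons_val_zero, Matrix.cons_val_one]
  ring

lemma sum_ruler_vecE (h : frameDet ψ x ≠ 0) :
    ruler ψ x 0 * vecE ψ x 0 + ruler ψ x 1 * vecE ψ x 1 = 1 := by
  simp only [vecE, Matrix.cons_val_zero, Matrix.cons_val_one]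
  field_simp
  simp only [frameDet]
  ring

/-- A vector is determined by its contractions with the clock form and the ruler form. -/
lemma vector_eq_of_contractions (h : frameDet ψ x ≠ 0) {Z : Fin 2 → ℝ} {a b : ℝ}
    (ha : ∑ ρ, clock ψ x ρ * Z ρ = a) (hb : ∑ ρ, ruler ψ x ρ * Z ρ = b) (ρ : Fin 2) :
    Z ρ = -vecV ψ x ρ * a + vecE ψ x ρ * b := by
  rw [← ha, ← hb]
  simp only [Fin.sum_univ_two]
  fin_cases ρ <;>
  · simp [vecV, vecE]
    field_simp
    simp only [frameDet]
    ring

lemma sum_clock_christoffel (hc : c ≠ 0) (hO : IsOpen O) (h : IsAdmissible I O ψ)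
    (hx : x ∈ O) (μ ν : Fin 2) :
    ∑ ρ, clock ψ x ρ * christoffel (preCarrollMetric c ψ) ρ μ ν x =
      pd μ (fun y => clock ψ y ν) x + spinConnection c ψ x μ * ruler ψ x ν := by
  have hD := (h.2 x hx).1.ne'
  simp only [christoffel_preCarrollMetric hc hO h hx, Fin.sum_univ_two]
  linear_combination -(pd μ (fun y => clock ψ y ν) x + spinConnection c ψ x μ * ruler ψ x ν)
      * sum_clock_vecV hD + (pd μ (fun y => ruler ψ y ν) x
        + c ^ 2 * spinConnection c ψ x μ * clock ψ x ν) * sum_clock_vecE (ψ := ψ) (x := x)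

lemma sum_ruler_christoffel (hc : c ≠ 0) (hO : IsOpen O) (h : IsAdmissible I O ψ)
    (hx : x ∈ O) (μ ν : Fin 2) :
    ∑ ρ, ruler ψ x ρ * christoffel (preCarrollMetric c ψ) ρ μ ν x =
      pd μ (fun y => ruler ψ y ν) x + c ^ 2 * spinConnection c ψ x μ * clock ψ x ν := by
  have hD := (h.2 x hx).1.ne'
  simp only [christoffel_preCarrollMetric hc hO h hx, Fin.sum_univ_two]
  linear_combination -(pd μ (fun y => clock ψ y ν) x + spinConnection c ψ x μ * ruler ψ x ν)
      * sum_ruler_vecV (ψ := ψ) (x := x) + (pd μ (fun y => ruler ψ y ν) x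
        + c ^ 2 * spinConnection c ψ x μ * clock ψ x ν) * sum_ruler_vecE hD

/-- If `f_ρ Γ^ρ_{μν} = ∂_μ f_ν + s_μ h_ν` and `h_ρ Γ^ρ_{μν} = ∂_μ h_ν + a s_μ f_ν`, then
`f_ρ R^ρ_{μνσ} = (ds)_{νσ} h_μ`: in two dimensions the curvature is that of an abelian
connection. -/
lemma contraction_riemann {g : Plane → Matrix (Fin 2) (Fin 2) ℝ} (hO : IsOpen O) (hx : x ∈ O)
    (hΓ : ∀ ρ μ ν, ContDiffOn ℝ ∞ (christoffel g ρ μ ν) O)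
    {f h s : Plane → Fin 2 → ℝ} {a b : ℝ} (hf : ∀ i, ContDiffOn ℝ ∞ (fun y => f y i) O)
    (hh : ∀ i, ContDiffOn ℝ ∞ (fun y => h y i) O) (hs : ∀ i, ContDiffOn ℝ ∞ (fun y => s y i) O)
    (H1 : ∀ y ∈ O, ∀ μ ν, ∑ ρ, f y ρ * christoffel g ρ μ ν y
      = pd μ (fun z => f z ν) y + b * s y μ * h y ν)
    (H2 : ∀ y ∈ O, ∀ μ ν, ∑ ρ, h y ρ * christoffel g ρ μ ν y
      = pd μ (fun z => h z ν) y + a * s y μ * f y ν) (μ ν σ : Fin 2) :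
    ∑ ρ, f x ρ * riemann g ρ μ ν σ x = b * curl s ν σ x * h x μ := by
  have df := fun i => differentiableAt_of_contDiffOn hO (hf i) hx
  have dh := fun i => differentiableAt_of_contDiffOn hO (hh i) hx
  have ds := fun i => differentiableAt_of_contDiffOn hO (hs i) hx
  have dΓ := fun ρ μ ν => differentiableAt_of_contDiffOn hO (hΓ ρ μ ν) hx
  have dpf := fun μ i => differentiableAt_of_contDiffOn hO (contDiffOn_pd hO μ (hf i)) hx
  -- The derivative of the first relation.
  have E : ∀ κ μ ν, ∑ ρ, (pd κ (fun y => f y ρ) x * christoffel g ρ μ ν x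
        + f x ρ * pd κ (christoffel g ρ μ ν) x)
      = pd κ (pd μ (fun z => f z ν)) x + b * (pd κ (fun y => s y μ) x * h x ν
        + s x μ * pd κ (fun y => h y ν) x) := by
    intro κ μ ν
    have h1 := pd_congr_of_isOpen (μ := κ) hO hx (fun y hy => H1 y hy μ ν)
    rw [pd_sum (fun ρ _ => (df ρ).fun_mul (dΓ ρ μ ν)),
      pd_add (dpf μ ν) (((ds μ).const_mul b).fun_mul (dh ν)),
      pd_mul ((ds μ).const_mul b) (dh ν), pd_const_mul b (ds μ)] at h1
    simp only [fun ρ => pd_mul (μ := κ) (df ρ) (dΓ ρ μ ν)] at h1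
    rw [h1]; ring
  have comm := pd_comm (μ := ν) σ ((hf μ).contDiffAt (hO.mem_nhds hx))
  have e1 := E ν σ μ
  have e2 := E σ ν μ
  have F := H1 x hx
  have G := H2 x hx
  simp only [Fin.sum_univ_two] at e1 e2 F G
  simp only [riemann, curl, Fin.sum_univ_two]
  linear_combination e1 - e2 + comm
    + christoffel g 0 σ μ x * F ν 0 + christoffel g 1 σ μ x * F ν 1
    - christoffel g 0 ν μ x * F σ 0 - christoffel g 1 ν μ x * F σ 1
    + b * s x ν * G σ μ - b * s x σ * G ν μ

lemma riemann_preCarrollMetric (hc : c ≠ 0) (hO : IsOpen O) (h : IsAdmissible I O ψ)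
    (hx : x ∈ O) (l μ ν σ : Fin 2) :
    riemann (preCarrollMetric c ψ) l μ ν σ x =
      (-vecV ψ x l * ruler ψ x μ + c ^ 2 * vecE ψ x l * clock ψ x μ)
        * curl (spinConnection c ψ) ν σ x := by
  have h1 := contraction_riemann (a := c ^ 2) (b := 1) hO hx (contDiffOn_christoffel hc hO h)
    h.contDiffOn_clock h.contDiffOn_ruler (contDiffOn_spinConnection (c := c) hO h)
    (fun y hy μ ν => by rw [sum_clock_christoffel hc hO h hy, one_mul])
    (fun y hy μ ν => sum_ruler_christoffel hc hO h hy μ ν) μ ν σ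
  have h2 := contraction_riemann (a := 1) (b := c ^ 2) hO hx (contDiffOn_christoffel hc hO h)
    h.contDiffOn_ruler h.contDiffOn_clock (contDiffOn_spinConnection (c := c) hO h)
    (fun y hy μ ν => sum_ruler_christoffel hc hO h hy μ ν)
    (fun y hy μ ν => by rw [sum_clock_christoffel hc hO h hy, one_mul]) μ ν σ
  rw [vector_eq_of_contractions (Z := fun l => riemann (preCarrollMetric c ψ) l μ ν σ x)
    (h.2 x hx).1.ne' h1 h2 l]
  ring

lemma ricciScalar_preCarrollMetric (hc : c ≠ 0) (hO : IsOpen O) (h : IsAdmissible I O ψ)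
    (hx : x ∈ O) :
    ricciScalar (preCarrollMetric c ψ) x =
      2 * (curl (spinConnection c ψ) 0 1 x / frameDet ψ x) := by
  have hD := (h.2 x hx).1.ne'
  simp only [ricciScalar, ricci_eq_sum_riemann, riemann_preCarrollMetric hc hO h hx,
    inv_preCarrollMetric hc hD, Fin.sum_univ_two, Matrix.of_apply, curl_self,
    curl_antisymm (spinConnection c ψ) 1 0]
  simp [vecV, vecE]
  field_simp
  simp only [frameDet]
  ring

end LeviCivitaCurvature

/-! ### Expansion of the Lorentzian action -/

section MagneticExpansion

variable {I : Set ℝ} {O : Set Plane} {ψ : Fields} {x : Plane} {c : ℝ}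

/-- The current `-2 c² X K det(T, E) V^μ`, a function of the first jet of the fields. -/
def magneticCurrent (c : ℝ) : Current := fun w =>
  let K := ((w.2 (Pi.single 0 1)).2.1 1 - (w.2 (Pi.single 1 1)).2.1 0)
    / (w.1.1 0 * w.1.2.1 1 - w.1.1 1 * w.1.2.1 0)
  ![2 * c ^ 2 * (w.1.2.2.1 * K * w.1.2.1 1), -2 * c ^ 2 * (w.1.2.2.1 * K * w.1.2.1 0)]

lemma magneticCurrent_eval (hO : IsOpen O) (h : IsAdmissible I O ψ) (hx : x ∈ O) :
    (magneticCurrent c).eval ψ x = ![2 * c ^ 2 * (dil ψ x * extrinsicK ψ x * ruler ψ x 1),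
      -2 * c ^ 2 * (dil ψ x * extrinsicK ψ x * ruler ψ x 0)] := by
  have hd := differentiableAt_of_contDiffOn hO h.1 hx
  simp only [Current.eval, magneticCurrent, fderiv_ruler_apply hd]
  rw [extrinsicK_eq (h.2 x hx).1.ne']
  rfl

lemma contDiffOn_magneticCurrent (hO : IsOpen O) (h : IsAdmissible I O ψ) :
    ContDiffOn ℝ ∞ ((magneticCurrent c).eval ψ) O := by
  refine ContDiffOn.congr (contDiffOn_pi.2 fun μ => ?_) fun y hy => magneticCurrent_eval hO h hy
  have hXK := h.contDiffOn_dil.mul (h.contDiffOn_extrinsicK hO)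
  fin_cases μ
  · exact contDiffOn_const.mul (hXK.mul (h.contDiffOn_ruler 1))
  · exact contDiffOn_const.mul (hXK.mul (h.contDiffOn_ruler 0))

lemma divergence_magneticCurrent (hO : IsOpen O) (h : IsAdmissible I O ψ) (hx : x ∈ O) :
    divergence ((magneticCurrent c).eval ψ) x = 2 * c ^ 2 *
      (pd 0 (fun y => dil ψ y * extrinsicK ψ y * ruler ψ y 1) x
        - pd 1 (fun y => dil ψ y * extrinsicK ψ y * ruler ψ y 0) x) := by
  have hXK : ∀ i, DifferentiableAt ℝ (fun y => dil ψ y * extrinsicK ψ y * ruler ψ y i) x :=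
    fun i => differentiableAt_of_contDiffOn hO
      ((h.contDiffOn_dil.mul (h.contDiffOn_extrinsicK hO)).mul (h.contDiffOn_ruler i)) hx
  have e := fun μ : Fin 2 => pd_congr_of_isOpen (μ := μ) hO hx
    (fun y hy => congrFun (magneticCurrent_eval (c := c) hO h hy) μ)
  simp only [divergence, Fin.sum_univ_two, e]
  simp only [Matrix.cons_val_zero, Matrix.cons_val_one, pd_const_mul _ (hXK _)]
  ring

/-- Leibniz rule for the curl of a rescaled one-form. -/
lemma curl_mul {m : ℕ} {x : Fin m → ℝ} {f : (Fin m → ℝ) → ℝ} {w : (Fin m → ℝ) → Fin m → ℝ}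
    (hf : DifferentiableAt ℝ f x)
    (hw : ∀ i, DifferentiableAt ℝ (fun y => w y i) x) (μ ν : Fin m) :
    curl (fun y i => f y * w y i) μ ν x
      = f x * curl w μ ν x + (pd μ f x * w x ν - pd ν f x * w x μ) := by
  simp only [curl, pd_mul hf (hw _)]
  ring

lemma curl_add {m : ℕ} {x : Fin m → ℝ} {w w' : (Fin m → ℝ) → Fin m → ℝ}
    (hw : ∀ i, DifferentiableAt ℝ (fun y => w y i) x)
    (hw' : ∀ i, DifferentiableAt ℝ (fun y => w' y i) x) (μ ν : Fin m) :
    curl (fun y i => w y i + w' y i) μ ν x = curl w μ ν x + curl w' μ ν x := by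
  simp only [curl, pd_add (hw _) (hw' _)]
  ring

/-- The expansion of the Lorentzian Lagrangian in powers of `c²`. The term `c⁻² K e` of the spin
connection is the only source of a `c²` term with second derivatives; moving the derivative to `X`
produces `2 K W` and the divergence. -/
lemma lorentzianLagrangian_eq (hc : 0 < c) (U V : ℝ → ℝ) (hO : IsOpen O)
    (h : IsAdmissible I O ψ) (hx : x ∈ O) :
    c ^ 3 * (Real.sqrt (-(preCarrollMetric c ψ x).det) *
      (dil ψ x * ricciScalar (preCarrollMetric c ψ) x
        - U (dil ψ x) * (∑ μ, ∑ ν, (preCarrollMetric c ψ x)⁻¹ μ ν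
            * pd μ (dil ψ) x * pd ν (dil ψ) x) + 2 * V (dil ψ x)))
      = c ^ 2 * lagrangianTwo U ψ x + c ^ 4 * lagrangianFour U V ψ x
        + divergence ((magneticCurrent c).eval ψ) x := by
  have hD := (h.2 x hx).1.ne'
  have dX := differentiableAt_of_contDiffOn hO h.contDiffOn_dil hx
  have dK := differentiableAt_of_contDiffOn hO (h.contDiffOn_extrinsicK hO) hx
  have de := fun i => differentiableAt_of_contDiffOn hO (h.contDiffOn_ruler i) hx
  have dω := fun i => differentiableAt_of_contDiffOn hO (h.contDiffOn_omegaHat hO i) hx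
  have hcurl : curl (spinConnection c ψ) 0 1 x = curl (omegaHat ψ) 0 1 x
      + 1 / c ^ 2 * (pd 0 (fun y => extrinsicK ψ y * ruler ψ y 1) x
        - pd 1 (fun y => extrinsicK ψ y * ruler ψ y 0) x) := by
    have e : spinConnection c ψ = fun y i => omegaHat ψ y i
        + (fun z j => 1 / c ^ 2 * (extrinsicK ψ z * ruler ψ z j)) y i := by
      funext y i; simp only [spinConnection]; ring
    rw [e, curl_add dω (fun i => ((dK.fun_mul (de i)).const_mul _))]
    simp only [curl, pd_const_mul _ (dK.fun_mul (de _))]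
    ring
  have hdiv : divergence ((magneticCurrent c).eval ψ) x = 2 * c ^ 2 * (dil ψ x
        * (pd 0 (fun y => extrinsicK ψ y * ruler ψ y 1) x
          - pd 1 (fun y => extrinsicK ψ y * ruler ψ y 0) x)
      + extrinsicK ψ x * (pd 0 (dil ψ) x * ruler ψ x 1 - pd 1 (dil ψ) x * ruler ψ x 0)) := by
    rw [divergence_magneticCurrent hO h hx]
    simp only [mul_assoc]
    rw [pd_mul dX (dK.fun_mul (de 1)), pd_mul dX (dK.fun_mul (de 0))]
    ring
  rw [sqrt_neg_det_preCarrollMetric hc (h.2 x hx).1, ricciScalar_preCarrollMetric hc.ne' hO h hx,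
    hcurl, hdiv, lagrangianTwo, lagrangianFour, scalarR_eq hD, derivV, derivE,
    inv_preCarrollMetric hc.ne' hD]
  generalize pd 0 (fun y => extrinsicK ψ y * ruler ψ y 1) x
    - pd 1 (fun y => extrinsicK ψ y * ruler ψ y 0) x = Z
  generalize extrinsicK ψ x = K
  simp only [Fin.sum_univ_two, Matrix.of_apply, vecV, vecE, Matrix.cons_val_zero,
    Matrix.cons_val_one]
  field_simp
  ring

/-- Up to a boundary term the Lorentzian action is `c² I_2 + c⁴ I_4`. -/
theorem lorentzianAction_eq (hc : 0 < c) {U V : ℝ → ℝ} (hU : ContDiffOn ℝ ∞ U I)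
    (hV : ContDiffOn ℝ ∞ V I) (hO : IsOpen O) (h : IsAdmissible I O ψ) (krel : ℝ) {D : Set Plane}
    (hD : IsCompact D) (hDO : D ⊆ O) :
    lorentzianAction c krel U V (preCarrollMetric c ψ) (dil ψ) D
      = krel / (4 * Real.pi) * (c ^ 2 * (∫ x in D, lagrangianTwo U ψ x)
          + c ^ 4 * (∫ x in D, lagrangianFour U V ψ x)
          + ∫ x in D, divergence ((magneticCurrent c).eval ψ) x) := by
  have hX := h.contDiffOn_dil
  have hUX : ContDiffOn ℝ ∞ (fun x => U (dil ψ x)) O := hU.comp hX fun x hx => (h.2 x hx).2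
  have hVX : ContDiffOn ℝ ∞ (fun x => V (dil ψ x)) O := hV.comp hX fun x hx => (h.2 x hx).2
  have hW := h.contDiffOn_derivV hO
  have h2 : ContDiffOn ℝ ∞ (lagrangianTwo U ψ) O := h.contDiffOn_frameDet.mul
    (((contDiffOn_const.mul (h.contDiffOn_extrinsicK hO)).mul hW).add (hUX.mul (hW.pow 2)))
  have h4 : ContDiffOn ℝ ∞ (lagrangianFour U V ψ) O := h.contDiffOn_frameDet.mul
    (((hX.mul (h.contDiffOn_scalarR hO)).sub (hUX.mul ((h.contDiffOn_derivE hO).pow 2))).add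
      (contDiffOn_const.mul hVX))
  have hj := contDiffOn_divergence hO (contDiffOn_magneticCurrent (c := c) hO h)
  have i2 := (ContDiffOn.integrableOn_compact h2 hD hDO).const_mul (c ^ 2)
  have i4 := (ContDiffOn.integrableOn_compact h4 hD hDO).const_mul (c ^ 4)
  have i24 : IntegrableOn (fun x => c ^ 2 * lagrangianTwo U ψ x + c ^ 4 * lagrangianFour U V ψ x) D :=
    i2.add i4
  have ij := ContDiffOn.integrableOn_compact hj hD hDO
  rw [lorentzianAction, mul_assoc, ← integral_const_mul,
    setIntegral_congr_fun hD.measurableSet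
      (fun x hx => lorentzianLagrangian_eq hc U V hO h (hDO hx)),
    integral_add i24 ij, integral_add i2 i4, integral_const_mul, integral_const_mul]

end MagneticExpansion

/-! ### Calculus on the product of the plane and the stereographic chart -/

section ProductCalculus

variable {n : ℕ}

lemma sum_base_sphere (A : Fin (n + 1 + 1) → ℝ) :
    ∑ μ, A μ = A 0 + A 1 + ∑ l : Fin n, A l.succ.succ := by
  rw [Fin.sum_univ_succ, Fin.sum_univ_succ]
  exact (add_assoc (A 0) (A 1) _).symm

@[simp] lemma zero_ne_succ_succ (l : Fin n) : (0 : Fin (n + 1 + 1)) ≠ l.succ.succ :=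
  (Fin.succ_ne_zero _).symm

@[simp] lemma one_ne_succ_succ (l : Fin n) : (1 : Fin (n + 1 + 1)) ≠ l.succ.succ := by
  rw [← Fin.succ_zero_eq_one]
  exact fun h => Fin.succ_ne_zero _ (Fin.succ_injective _ h).symm

@[simp] lemma succ_succ_ne_one (l : Fin n) : l.succ.succ ≠ (1 : Fin (n + 1 + 1)) :=
  (one_ne_succ_succ l).symm

@[simp] lemma pullBack_zero (w : Plane → Fin 2 → ℝ) (p : Fin (n + 1 + 1) → ℝ) :
    pullBack w p 0 = w (baseCoord p) 0 := rfl

@[simp] lemma pullBack_one (w : Plane → Fin 2 → ℝ) (p : Fin (n + 1 + 1) → ℝ) :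
    pullBack w p 1 = w (baseCoord p) 1 := rfl

@[simp] lemma pullBack_succ_succ (w : Plane → Fin 2 → ℝ) (p : Fin (n + 1 + 1) → ℝ) (l : Fin n) :
    pullBack w p l.succ.succ = 0 := rfl

/-- The projection to the plane as a linear map. -/
def baseCoordL : (Fin (n + 1 + 1) → ℝ) →L[ℝ] Plane :=
  ContinuousLinearMap.pi ![ContinuousLinearMap.proj 0, ContinuousLinearMap.proj 1]

lemma baseCoordL_apply (p : Fin (n + 1 + 1) → ℝ) : baseCoordL p = baseCoord p := by
  funext i; fin_cases i <;> rfl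

lemma contDiff_baseCoord :
    ContDiff ℝ ∞ (baseCoord : (Fin (n + 1 + 1) → ℝ) → Plane) := by
  have : (baseCoord : (Fin (n + 1 + 1) → ℝ) → Plane) = baseCoordL :=
    funext fun p => (baseCoordL_apply p).symm
  rw [this]; exact baseCoordL.contDiff

lemma isOpen_preimage_baseCoord {O : Set Plane} (hO : IsOpen O) :
    IsOpen {p : Fin (n + 1 + 1) → ℝ | baseCoord p ∈ O} :=
  hO.preimage contDiff_baseCoord.continuous

section PullBackFunctions

variable {p : Fin (n + 1 + 1) → ℝ} {f : Plane → ℝ}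

lemma differentiableAt_comp_baseCoord (hf : DifferentiableAt ℝ f (baseCoord p)) :
    DifferentiableAt ℝ (fun q => f (baseCoord q)) p :=
  hf.comp p (contDiff_baseCoord.differentiable (by simp) p)

lemma pd_comp_baseCoord (hf : DifferentiableAt ℝ f (baseCoord p)) (μ : Fin (n + 1 + 1)) :
    pd μ (fun q => f (baseCoord q)) p
      = fderiv ℝ f (baseCoord p) (baseCoord (Pi.single μ 1)) := by
  have h : HasFDerivAt (baseCoord : (Fin (n + 1 + 1) → ℝ) → Plane) baseCoordL p := by
    have : (baseCoord : (Fin (n + 1 + 1) → ℝ) → Plane) = baseCoordL :=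
      funext fun p => (baseCoordL_apply p).symm
    rw [this]; exact baseCoordL.hasFDerivAt
  have := (hf.hasFDerivAt.comp p h).fderiv
  simp only [Function.comp_def] at this
  rw [pd, this, ContinuousLinearMap.comp_apply, baseCoordL_apply]

lemma pd_zero_comp_baseCoord (hf : DifferentiableAt ℝ f (baseCoord p)) :
    pd 0 (fun q => f (baseCoord q)) p = pd 0 f (baseCoord p) := by
  rw [pd_comp_baseCoord hf, pd]
  congr 1; funext i; fin_cases i <;> simp [baseCoord]

lemma pd_one_comp_baseCoord (hf : DifferentiableAt ℝ f (baseCoord p)) :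
    pd 1 (fun q => f (baseCoord q)) p = pd 1 f (baseCoord p) := by
  rw [pd_comp_baseCoord hf, pd]
  congr 1; funext i; fin_cases i <;> simp [baseCoord]

lemma pd_sphere_comp_baseCoord (hf : DifferentiableAt ℝ f (baseCoord p)) (l : Fin n) :
    pd l.succ.succ (fun q => f (baseCoord q)) p = 0 := by
  have : baseCoord (Pi.single l.succ.succ (1 : ℝ) : Fin (n + 1 + 1) → ℝ) = 0 := by
    funext i; fin_cases i <;> simp [baseCoord]
  rw [pd_comp_baseCoord hf, this, map_zero]

end PullBackFunctions

lemma pd_coord {m : ℕ} (μ ν : Fin m) (p : Fin m → ℝ) :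
    pd μ (fun q => q ν) p = if ν = μ then 1 else 0 := by
  have : HasFDerivAt (fun q : Fin m → ℝ => q ν) (ContinuousLinearMap.proj ν) p :=
    (ContinuousLinearMap.proj (R := ℝ) (φ := fun _ : Fin m => ℝ) ν).hasFDerivAt
  rw [pd, this.fderiv]
  simp [Pi.single_apply]

variable (p : Fin (n + 1 + 1) → ℝ)

lemma roundDenominator_pos : 0 < 1 + ∑ l, sphereCoord p l ^ 2 := by positivity

lemma roundFactor_pos : 0 < roundFactor p := div_pos two_pos (roundDenominator_pos p)

/-- The identity `ρ² |y|² = 2 ρ - ρ²` for the conformal factor `ρ` of the unit sphere. -/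
lemma roundFactor_sq_mul :
    roundFactor p ^ 2 * ∑ l, sphereCoord p l ^ 2 = 2 * roundFactor p - roundFactor p ^ 2 := by
  have := (roundDenominator_pos p).ne'
  rw [roundFactor]
  field_simp
  ring

lemma contDiff_sphereCoord (l : Fin n) :
    ContDiff ℝ ∞ (fun q : Fin (n + 1 + 1) → ℝ => sphereCoord q l) := by
  unfold sphereCoord; fun_prop

lemma contDiff_roundFactor :
    ContDiff ℝ ∞ (roundFactor : (Fin (n + 1 + 1) → ℝ) → ℝ) :=
  contDiff_const.div (contDiff_const.add (ContDiff.sum fun l _ => (contDiff_sphereCoord l).pow 2))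
    (fun q => (roundDenominator_pos q).ne')

lemma pd_roundFactor (μ : Fin (n + 1 + 1)) :
    pd μ roundFactor p
      = -roundFactor p ^ 2 * ∑ l : Fin n, (if l.succ.succ = μ then sphereCoord p l else 0) := by
  have h0 := (roundDenominator_pos p).ne'
  have hd : ∀ l : Fin n, DifferentiableAt ℝ (fun q : Fin (n + 1 + 1) → ℝ => sphereCoord q l) p :=
    fun l => (contDiff_sphereCoord l).differentiable (by simp) p
  have h1 : pd μ (fun q : Fin (n + 1 + 1) → ℝ => 1 + ∑ l, sphereCoord q l ^ 2) p
      = 2 * ∑ l : Fin n, (if l.succ.succ = μ then sphereCoord p l else 0) := by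
    rw [pd_add (differentiableAt_const _) (DifferentiableAt.fun_sum fun l _ => (hd l).fun_pow 2),
      pd_const, pd_sum (fun l _ => (hd l).fun_pow 2), zero_add, Finset.mul_sum]
    refine Finset.sum_congr rfl fun l _ => ?_
    rw [pd_comp (h := fun t => t ^ 2) (hasDerivAt_pow 2 _) (hd l)]
    simp only [sphereCoord, pd_coord]
    split_ifs <;> simp
  have h2 : DifferentiableAt ℝ (fun q : Fin (n + 1 + 1) → ℝ => 1 + ∑ l, sphereCoord q l ^ 2) p :=
    (differentiableAt_const _).add (DifferentiableAt.fun_sum fun l _ => (hd l).pow 2)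
  have h3 : (roundFactor : (Fin (n + 1 + 1) → ℝ) → ℝ)
      = fun q => 2 / (1 + ∑ l, sphereCoord q l ^ 2) := rfl
  rw [h3, pd_div (differentiableAt_const _) h2 h0, h1, pd_const]
  field_simp
  ring

@[simp] lemma pd_zero_roundFactor : pd 0 roundFactor p = 0 := by
  simp [pd_roundFactor]

@[simp] lemma pd_one_roundFactor : pd 1 roundFactor p = 0 := by
  simp [pd_roundFactor]

@[simp] lemma pd_sphere_roundFactor (l : Fin n) :
    pd l.succ.succ roundFactor p = -roundFactor p ^ 2 * sphereCoord p l := by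
  simp [pd_roundFactor]

variable {p}

lemma differentiableAt_roundFactor : DifferentiableAt ℝ roundFactor p :=
  contDiff_roundFactor.differentiable (by simp) p

section WarpedFunctions

variable {f : Plane → ℝ}

lemma pd_zero_warped (hf : DifferentiableAt ℝ f (baseCoord p)) :
    pd 0 (fun q => f (baseCoord q) * roundFactor q) p
      = pd 0 f (baseCoord p) * roundFactor p := by
  rw [pd_mul (differentiableAt_comp_baseCoord hf) differentiableAt_roundFactor,
    pd_zero_comp_baseCoord hf]
  simp

lemma pd_one_warped (hf : DifferentiableAt ℝ f (baseCoord p)) :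
    pd 1 (fun q => f (baseCoord q) * roundFactor q) p
      = pd 1 f (baseCoord p) * roundFactor p := by
  rw [pd_mul (differentiableAt_comp_baseCoord hf) differentiableAt_roundFactor,
    pd_one_comp_baseCoord hf]
  simp

lemma pd_sphere_warped (hf : DifferentiableAt ℝ f (baseCoord p)) (l : Fin n) :
    pd l.succ.succ (fun q => f (baseCoord q) * roundFactor q) p
      = -f (baseCoord p) * roundFactor p ^ 2 * sphereCoord p l := by
  rw [pd_mul (differentiableAt_comp_baseCoord hf) differentiableAt_roundFactor,
    pd_sphere_comp_baseCoord hf, pd_sphere_roundFactor]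
  ring

end WarpedFunctions

lemma curl_congr_of_isOpen {m : ℕ} {O : Set (Fin m → ℝ)} (hO : IsOpen O) {x : Fin m → ℝ}
    (hx : x ∈ O) {w w' : (Fin m → ℝ) → Fin m → ℝ} (h : ∀ y ∈ O, ∀ i, w y i = w' y i)
    (μ ν : Fin m) : curl w μ ν x = curl w' μ ν x := by
  simp only [curl, fun i j => pd_congr_of_isOpen (μ := i) hO hx (fun y hy => h y hy j)]

lemma curl_single {m : ℕ} (i : Fin m) (f : (Fin m → ℝ) → ℝ) (μ ν : Fin m) (x : Fin m → ℝ) :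
    curl (fun q => Pi.single i (f q)) μ ν x
      = (if ν = i then pd μ f x else 0) - (if μ = i then pd ν f x else 0) := by
  have : ∀ κ j : Fin m, pd κ (fun q => (Pi.single i (f q) : Fin m → ℝ) j) x
      = if j = i then pd κ f x else 0 := by
    intro κ j
    simp only [Pi.single_apply]
    split_ifs with h
    · rfl
    · exact pd_const 0
  simp only [curl, this]

section PullBackCurl

variable {w : Plane → Fin 2 → ℝ}

lemma curl_pullBack_base (hw : ∀ i, DifferentiableAt ℝ (fun y => w y i) (baseCoord p)) :
    curl (pullBack w) 0 1 p = curl w 0 1 (baseCoord p) := by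
  simp only [curl, pullBack_zero, pullBack_one]
  rw [pd_zero_comp_baseCoord (f := fun y => w y 1) (hw 1),
    pd_one_comp_baseCoord (f := fun y => w y 0) (hw 0)]

lemma curl_pullBack_sphere_right (hw : ∀ i, DifferentiableAt ℝ (fun y => w y i) (baseCoord p))
    (μ : Fin (n + 1 + 1)) (l : Fin n) : curl (pullBack w) μ l.succ.succ p = 0 := by
  have h : ∀ j : Fin (n + 1 + 1), pd l.succ.succ (fun q => pullBack w q j) p = 0 := by
    intro j
    refine Fin.cases ?_ (fun j => Fin.cases ?_ (fun j => ?_) j) j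
    · exact pd_sphere_comp_baseCoord (f := fun y => w y 0) (hw 0) l
    · exact pd_sphere_comp_baseCoord (f := fun y => w y 1) (hw 1) l
    · simp only [pullBack_succ_succ, pd_const]
  simp only [curl, h, pullBack_succ_succ, pd_const, sub_zero]

lemma curl_pullBack_sphere_left (hw : ∀ i, DifferentiableAt ℝ (fun y => w y i) (baseCoord p))
    (l : Fin n) (ν : Fin (n + 1 + 1)) : curl (pullBack w) l.succ.succ ν p = 0 := by
  rw [curl_antisymm, curl_pullBack_sphere_right hw, neg_zero]

end PullBackCurl

end ProductCalculus

/-! ### The frame of a spherically symmetric configuration -/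

section SphericalFrame

variable {n : ℕ} {χ : Fields} {p : Fin (n + 1 + 1) → ℝ}

@[simp] lemma sphericalCoframe_zero :
    sphericalCoframe (n := n) χ 0 = pullBack (ruler χ) := rfl

@[simp] lemma sphericalCoframe_succ (l : Fin n) :
    sphericalCoframe χ l.succ
      = fun p => Pi.single l.succ.succ (dil χ (baseCoord p) * roundFactor p) := rfl

/-- The matrix of the dual frame `-v, e_1, …, e_{n+1}` of a spherically symmetric configuration. -/
def sphericalDualFrame (χ : Fields) (p : Fin (n + 1 + 1) → ℝ) :
    Matrix (Fin (n + 1 + 1)) (Fin (n + 1 + 1)) ℝ :=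
  Matrix.of fun μ => Fin.cons (-pullBack (vecV χ) p μ) (Fin.cons (pullBack (vecE χ) p μ)
    fun l => (Pi.single l.succ.succ (1 / (dil χ (baseCoord p) * roundFactor p)) :
      Fin (n + 1 + 1) → ℝ) μ)

lemma inv_coframeMatrix_spherical (hD : frameDet χ (baseCoord p) ≠ 0)
    (hΦ : dil χ (baseCoord p) ≠ 0) :
    (coframeMatrix (sphericalClock χ) (sphericalCoframe χ) p)⁻¹ = sphericalDualFrame χ p := by
  refine Matrix.inv_eq_right_inv ?_
  have hρ := (roundFactor_pos p).ne'
  have c1 := sum_clock_vecV hD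
  have c2 := sum_clock_vecE (ψ := χ) (x := baseCoord p)
  have c3 := sum_ruler_vecV (ψ := χ) (x := baseCoord p)
  have c4 := sum_ruler_vecE hD
  ext a b
  rw [Matrix.mul_apply, sum_base_sphere]
  refine Fin.cases ?_ (fun a => Fin.cases ?_ (fun l => ?_) a) a <;>
    refine Fin.cases ?_ (fun b => Fin.cases ?_ (fun m => ?_) b) b <;>
    simp [coframeMatrix, sphericalDualFrame, sphericalClock, Matrix.one_apply, Pi.single_apply]
  · linarith
  · linarith
  · linarith
  · linarith
  · by_cases h : l = m
    · subst h; simp; field_simp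
    · simp [h, Ne.symm h]

lemma sum_carrollVector_spherical (hD : frameDet χ (baseCoord p) ≠ 0)
    (hΦ : dil χ (baseCoord p) ≠ 0) (A : Fin (n + 1 + 1) → ℝ) :
    ∑ μ, carrollVector (sphericalClock χ) (sphericalCoframe χ) p μ * A μ
      = vecV χ (baseCoord p) 0 * A 0 + vecV χ (baseCoord p) 1 * A 1 := by
  simp [sum_base_sphere, carrollVector, inv_coframeMatrix_spherical hD hΦ, sphericalDualFrame]

lemma sum_spatialFrame_spherical_zero (hD : frameDet χ (baseCoord p) ≠ 0)
    (hΦ : dil χ (baseCoord p) ≠ 0) (A : Fin (n + 1 + 1) → ℝ) :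
    ∑ μ, spatialFrame (sphericalClock χ) (sphericalCoframe χ) 0 p μ * A μ
      = vecE χ (baseCoord p) 0 * A 0 + vecE χ (baseCoord p) 1 * A 1 := by
  simp [sum_base_sphere, spatialFrame, inv_coframeMatrix_spherical hD hΦ, sphericalDualFrame,
    -Fin.succ_zero_eq_one]

lemma sum_spatialFrame_spherical_succ (hD : frameDet χ (baseCoord p) ≠ 0)
    (hΦ : dil χ (baseCoord p) ≠ 0) (l : Fin n) (A : Fin (n + 1 + 1) → ℝ) :
    ∑ μ, spatialFrame (sphericalClock χ) (sphericalCoframe χ) l.succ p μ * A μ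
      = A l.succ.succ / (dil χ (baseCoord p) * roundFactor p) := by
  simp [spatialFrame, inv_coframeMatrix_spherical hD hΦ, sphericalDualFrame,
    Pi.single_apply]
  ring

end SphericalFrame

/-! ### Connection and curvature of a spherically symmetric configuration -/

section SphericalConnection

variable {n : ℕ} {O : Set Plane} {χ : Fields} {p : Fin (n + 1 + 1) → ℝ}

/-- The rotation connection as a contraction of exterior derivatives with the frame. -/
lemma rotationConnection_eq_contraction {d : ℕ} (τ : (Fin (d + 1) → ℝ) → Fin (d + 1) → ℝ)
    (e : Fin d → (Fin (d + 1) → ℝ) → Fin (d + 1) → ℝ) (a b : Fin d)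
    (x : Fin (d + 1) → ℝ) (μ : Fin (d + 1)) :
    rotationConnection τ e a b x μ =
      (1 / 2) * (∑ ρ, spatialFrame τ e a x ρ * curl (e b) μ ρ x
        - ∑ ρ, spatialFrame τ e b x ρ * curl (e a) μ ρ x)
      - (1 / 2) * ∑ c, e c x μ * ∑ ρ, spatialFrame τ e a x ρ *
          ∑ ν, spatialFrame τ e b x ν * curl (e c) ρ ν x := by
  simp only [rotationConnection, Finset.sum_sub_distrib, Finset.mul_sum, mul_assoc]

/-- The boost connection as a contraction of the exterior derivative of the clock form. -/
lemma boostConnection_eq_contraction {d : ℕ} (τ : (Fin (d + 1) → ℝ) → Fin (d + 1) → ℝ)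
    (e : Fin d → (Fin (d + 1) → ℝ) → Fin (d + 1) → ℝ)
    (C : Fin d → Fin d → (Fin (d + 1) → ℝ) → ℝ) (a : Fin d)
    (x : Fin (d + 1) → ℝ) (μ : Fin (d + 1)) :
    boostConnection τ e C a x μ =
      (1 / 2) * τ x μ * ∑ ν, carrollVector τ e x ν *
          ∑ σ, spatialFrame τ e a x σ * curl τ ν σ x
        - (1 / 2) * ∑ ν, spatialFrame τ e a x ν * curl τ μ ν x
        + ∑ b, C a b x * e b x μ := by
  simp only [boostConnection, Finset.mul_sum, mul_assoc]

/-- The Carroll curvature scalar as a contraction with the frame. -/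
lemma carrollScalar_eq_contraction {d : ℕ} (τ : (Fin (d + 1) → ℝ) → Fin (d + 1) → ℝ)
    (e : Fin d → (Fin (d + 1) → ℝ) → Fin (d + 1) → ℝ)
    (C : Fin d → Fin d → (Fin (d + 1) → ℝ) → ℝ) (x : Fin (d + 1) → ℝ) :
    carrollScalar τ e C x =
      -2 * ∑ b, ∑ μ, carrollVector τ e x μ *
          ∑ ν, spatialFrame τ e b x ν * boostCurvature τ e C b μ ν x
        + ∑ a, ∑ b, ∑ μ, spatialFrame τ e a x μ *
          ∑ ν, spatialFrame τ e b x ν * rotationCurvature τ e a b μ ν x := by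
  simp only [carrollScalar, Finset.mul_sum, mul_assoc]

/-- The first component of the boost connection, `ω^1 = ω̂ + C e`, as a one-form on the plane. -/
def reducedBoost (χ : Fields) (x : Plane) (μ : Fin 2) : ℝ :=
  omegaHat χ x μ + fieldC χ x * ruler χ x μ

lemma differentiableAt_clock_component (hO : IsOpen O) (h : IsAdmissible (Ioi 0) O χ)
    (hp : baseCoord p ∈ O) (i : Fin 2) :
    DifferentiableAt ℝ (fun y => clock χ y i) (baseCoord p) :=
  differentiableAt_of_contDiffOn hO (h.contDiffOn_clock i) hp

lemma differentiableAt_ruler_component (hO : IsOpen O) (h : IsAdmissible (Ioi 0) O χ)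
    (hp : baseCoord p ∈ O) (i : Fin 2) :
    DifferentiableAt ℝ (fun y => ruler χ y i) (baseCoord p) :=
  differentiableAt_of_contDiffOn hO (h.contDiffOn_ruler i) hp

lemma boostConnection_spherical_zero (hO : IsOpen O) (h : IsAdmissible (Ioi 0) O χ)
    (hp : baseCoord p ∈ O) (μ : Fin (n + 1 + 1)) :
    boostConnection (sphericalClock χ) (sphericalCoframe χ) (sphericalC χ) 0 p μ
      = pullBack (reducedBoost χ) p μ := by
  have hD := (h.2 _ hp).1.ne'
  have hΦ : dil χ (baseCoord p) ≠ 0 := ne_of_gt (h.2 _ hp).2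
  have dτ := differentiableAt_clock_component hO h hp
  have hC : ∀ l : Fin n, sphericalC (n := n) χ 0 l.succ p = 0 := fun l => by
    simp [sphericalC, (Fin.succ_ne_zero l).symm]
  have hC0 : sphericalC (n := n) χ 0 0 p = fieldC χ (baseCoord p) := by simp [sphericalC]
  have c1 : curl (sphericalClock (n := n) χ) 0 1 p = curl (clock χ) 0 1 (baseCoord p) :=
    curl_pullBack_base dτ
  have c2 : curl (sphericalClock (n := n) χ) 1 0 p = -curl (clock χ) 0 1 (baseCoord p) := by
    rw [curl_antisymm, c1]
  have t0 : sphericalClock (n := n) χ p 0 = clock χ (baseCoord p) 0 := rfl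
  have t1 : sphericalClock (n := n) χ p 1 = clock χ (baseCoord p) 1 := rfl
  have t2 : ∀ l : Fin n, sphericalClock χ p l.succ.succ = 0 := fun _ => rfl
  have c3 : ∀ (l : Fin n) ν, curl (sphericalClock χ) l.succ.succ ν p = 0 :=
    curl_pullBack_sphere_left dτ
  rw [boostConnection_eq_contraction, sum_carrollVector_spherical hD hΦ,
    Fin.sum_univ_succ (fun b => sphericalC χ 0 b p * _)]
  simp only [sum_spatialFrame_spherical_zero hD hΦ, hC, hC0, sphericalCoframe_zero, zero_mul,
    Finset.sum_const_zero, add_zero, c1, c2, curl_self]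
  refine Fin.cases ?_ (fun μ => Fin.cases ?_ (fun l => ?_) μ) μ
  · simp [c1, curl_self, t0, reducedBoost, omegaHat_eq, vecE, vecV]
    field_simp
    simp only [frameDet]
    ring
  · simp [c2, curl_self, t1, reducedBoost, omegaHat_eq, vecE, vecV]
    field_simp
    simp only [frameDet]
    ring
  · simp [c3, t2]

lemma boostConnection_spherical_succ (hO : IsOpen O) (h : IsAdmissible (Ioi 0) O χ)
    (hp : baseCoord p ∈ O) (l : Fin n) (μ : Fin (n + 1 + 1)) :
    boostConnection (sphericalClock χ) (sphericalCoframe χ) (sphericalC χ) l.succ p μ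
      = (Pi.single l.succ.succ (fieldP χ (baseCoord p) * roundFactor p) :
          Fin (n + 1 + 1) → ℝ) μ := by
  have hD := (h.2 _ hp).1.ne'
  have hΦ : dil χ (baseCoord p) ≠ 0 := ne_of_gt (h.2 _ hp).2
  have dτ := differentiableAt_clock_component hO h hp
  have hC : ∀ b : Fin (n + 1), sphericalC (n := n) χ l.succ b p
      = if l.succ = b then fieldP χ (baseCoord p) / dil χ (baseCoord p) else 0 := fun b => by
    simp [sphericalC]
  have hρ := (roundFactor_pos p).ne'
  have c : ∀ μ, curl (sphericalClock (n := n) χ) μ l.succ.succ p = 0 := fun μ =>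
    curl_pullBack_sphere_right dτ μ l
  rw [boostConnection_eq_contraction, sum_carrollVector_spherical hD hΦ]
  simp only [sum_spatialFrame_spherical_succ hD hΦ, hC, c, ite_mul, zero_mul, Finset.sum_ite_eq, Finset.mem_univ, if_true,
    sphericalCoframe_succ, Pi.single_apply]
  split_ifs
  · field_simp
    ring
  · simp

/-- `ω^{1l} = -(e^μ ∂_μ Φ) ē^l`: the extrinsic curvature of the spheres in space. -/
lemma rotationConnection_spherical_zero_succ (hO : IsOpen O) (h : IsAdmissible (Ioi 0) O χ)
    (hp : baseCoord p ∈ O) (l : Fin n) (μ : Fin (n + 1 + 1)) :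
    rotationConnection (sphericalClock χ) (sphericalCoframe χ) 0 l.succ p μ
      = (Pi.single l.succ.succ (-derivE χ (baseCoord p) * roundFactor p) :
          Fin (n + 1 + 1) → ℝ) μ := by
  have hD := (h.2 _ hp).1.ne'
  have hΦ : dil χ (baseCoord p) ≠ 0 := ne_of_gt (h.2 _ hp).2
  have hρ := (roundFactor_pos p).ne'
  have de := differentiableAt_ruler_component hO h hp
  have dX := differentiableAt_of_contDiffOn hO h.contDiffOn_dil hp
  rw [rotationConnection_eq_contraction]
  simp only [sum_spatialFrame_spherical_zero hD hΦ, sum_spatialFrame_spherical_succ hD hΦ,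
    Fin.sum_univ_succ (fun c : Fin (n + 1) => _ * _), sphericalCoframe_zero, sphericalCoframe_succ,
    curl_pullBack_sphere_right de, curl_single, pd_zero_warped dX, pd_one_warped dX, Fin.succ_inj,
    zero_ne_succ_succ, one_ne_succ_succ, if_false, sub_zero, Pi.single_apply]
  have hs : ∀ x : Fin n, (if μ = x.succ.succ then dil χ (baseCoord p) * roundFactor p else 0) *
      (vecE χ (baseCoord p) 0 * ((if l = x then pd 0 (dil χ) (baseCoord p) * roundFactor p else 0)
          / (dil χ (baseCoord p) * roundFactor p))
        + vecE χ (baseCoord p) 1 * ((if l = x then pd 1 (dil χ) (baseCoord p) * roundFactor p else 0)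
          / (dil χ (baseCoord p) * roundFactor p)))
      = if l = x then (if μ = l.succ.succ then derivE χ (baseCoord p) * roundFactor p else 0)
          else 0 := by
    intro x
    by_cases h1 : l = x
    · subst h1
      simp only [if_true, derivE, Fin.sum_univ_two]
      split_ifs
      · field_simp
      · simp
    · simp [h1]
  simp only [hs, Finset.sum_ite_eq, Finset.mem_univ, if_true]
  simp only [derivE, Fin.sum_univ_two]
  split_ifs
  · ring
  · simp

lemma rotationConnection_antisymm {d : ℕ} (τ : (Fin (d + 1) → ℝ) → Fin (d + 1) → ℝ)
    (e : Fin d → (Fin (d + 1) → ℝ) → Fin (d + 1) → ℝ) (a b : Fin d)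
    (x : Fin (d + 1) → ℝ) (μ : Fin (d + 1)) :
    rotationConnection τ e a b x μ = -rotationConnection τ e b a x μ := by
  have : ∀ c, ∑ ρ, ∑ ν, e c x μ * spatialFrame τ e a x ρ * spatialFrame τ e b x ν
        * curl (e c) ρ ν x
      = -∑ ρ, ∑ ν, e c x μ * spatialFrame τ e b x ρ * spatialFrame τ e a x ν
        * curl (e c) ρ ν x := by
    intro c
    rw [Finset.sum_comm, ← Finset.sum_neg_distrib]
    refine Finset.sum_congr rfl fun ρ _ => ?_
    rw [← Finset.sum_neg_distrib]
    refine Finset.sum_congr rfl fun ν _ => ?_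
    rw [curl_antisymm]; ring
  simp only [rotationConnection, this, Finset.sum_neg_distrib, Finset.sum_sub_distrib]
  ring

lemma rotationConnection_self {d : ℕ} (τ : (Fin (d + 1) → ℝ) → Fin (d + 1) → ℝ)
    (e : Fin d → (Fin (d + 1) → ℝ) → Fin (d + 1) → ℝ) (a : Fin d)
    (x : Fin (d + 1) → ℝ) (μ : Fin (d + 1)) : rotationConnection τ e a a x μ = 0 := by
  linarith [rotationConnection_antisymm τ e a a x μ]

/-- The Levi-Civita connection of the unit sphere in stereographic coordinates. -/
lemma rotationConnection_spherical_succ_succ (hO : IsOpen O) (h : IsAdmissible (Ioi 0) O χ)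
    (hp : baseCoord p ∈ O) (l m : Fin n) (μ : Fin (n + 1 + 1)) :
    rotationConnection (sphericalClock χ) (sphericalCoframe χ) l.succ m.succ p μ
      = (Pi.single m.succ.succ (roundFactor p * sphereCoord p l) : Fin (n + 1 + 1) → ℝ) μ
        - (Pi.single l.succ.succ (roundFactor p * sphereCoord p m) : Fin (n + 1 + 1) → ℝ) μ := by
  by_cases hlm : l = m
  · subst hlm; rw [rotationConnection_self]; simp
  have hD := (h.2 _ hp).1.ne'
  have hΦ : dil χ (baseCoord p) ≠ 0 := ne_of_gt (h.2 _ hp).2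
  have hρ := (roundFactor_pos p).ne'
  have de := differentiableAt_ruler_component hO h hp
  have dX := differentiableAt_of_contDiffOn hO h.contDiffOn_dil hp
  rw [rotationConnection_eq_contraction]
  simp only [sum_spatialFrame_spherical_succ hD hΦ,
    Fin.sum_univ_succ (fun c : Fin (n + 1) => _ * _), sphericalCoframe_zero, sphericalCoframe_succ,
    curl_pullBack_sphere_right de, curl_single, pd_sphere_warped dX, Pi.single_apply,
    Fin.succ_inj, if_neg hlm, if_neg (Ne.symm hlm)]
  have hs : ∀ x : Fin n, (if μ = x.succ.succ then dil χ (baseCoord p) * roundFactor p else 0) *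
      (((if m = x then -dil χ (baseCoord p) * roundFactor p ^ 2 * sphereCoord p l else 0)
        - (if l = x then -dil χ (baseCoord p) * roundFactor p ^ 2 * sphereCoord p m else 0))
        / (dil χ (baseCoord p) * roundFactor p) / (dil χ (baseCoord p) * roundFactor p))
      = (if m = x then (if μ = m.succ.succ then -roundFactor p * sphereCoord p l else 0) else 0)
        - (if l = x then (if μ = l.succ.succ then -roundFactor p * sphereCoord p m else 0)
          else 0) := by
    intro x
    by_cases h1 : m = x
    · subst h1
      simp only [if_true, if_neg hlm]
      split_ifs <;> field_simp
      · ring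
      · ring
    · by_cases h2 : l = x
      · subst h2
        simp only [if_true, if_neg h1]
        split_ifs
        · field_simp
          ring
        · simp
      · simp [h1, h2]
  simp only [hs, Finset.sum_sub_distrib, Finset.sum_ite_eq, Finset.mem_univ, if_true]
  by_cases h1 : μ = m.succ.succ
  · have h2 : μ ≠ l.succ.succ := fun h2 => hlm (by
      rw [h1] at h2; exact (Fin.succ_injective _ (Fin.succ_injective _ h2)).symm)
    simp [h1, Ne.symm hlm]
    field_simp
    ring
  · by_cases h2 : μ = l.succ.succ
    · simp [h2, hlm]
      field_simp
      ring
    · simp [h1, h2]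

end SphericalConnection

section SphericalCurvature

variable {n : ℕ} {O : Set Plane} {χ : Fields} {p : Fin (n + 1 + 1) → ℝ}

lemma rotationConnection_spherical_succ_zero (hO : IsOpen O) (h : IsAdmissible (Ioi 0) O χ)
    (hp : baseCoord p ∈ O) (l : Fin n) (μ : Fin (n + 1 + 1)) :
    rotationConnection (sphericalClock χ) (sphericalCoframe χ) l.succ 0 p μ
      = (Pi.single l.succ.succ (derivE χ (baseCoord p) * roundFactor p) :
          Fin (n + 1 + 1) → ℝ) μ := by
  rw [rotationConnection_antisymm, rotationConnection_spherical_zero_succ hO h hp]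
  simp only [Pi.single_apply]
  split_ifs <;> ring

/-- The rotation connection has no components along the plane. -/
lemma rotationConnection_spherical_base (hO : IsOpen O) (h : IsAdmissible (Ioi 0) O χ)
    (hp : baseCoord p ∈ O) (a b : Fin (n + 1)) {μ : Fin (n + 1 + 1)} (hμ : μ = 0 ∨ μ = 1) :
    rotationConnection (sphericalClock χ) (sphericalCoframe χ) a b p μ = 0 := by
  have hne : ∀ l : Fin n, μ ≠ l.succ.succ := fun l => by rcases hμ with rfl | rfl <;> simp
  refine Fin.cases ?_ (fun l => ?_) a <;> refine Fin.cases ?_ (fun m => ?_) b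
  · exact rotationConnection_self _ _ _ _ _
  · rw [rotationConnection_spherical_zero_succ hO h hp, Pi.single_eq_of_ne (hne _)]
  · rw [rotationConnection_spherical_succ_zero hO h hp, Pi.single_eq_of_ne (hne _)]
  · rw [rotationConnection_spherical_succ_succ hO h hp, Pi.single_eq_of_ne (hne _),
      Pi.single_eq_of_ne (hne _), sub_zero]

lemma boostConnection_spherical_succ_base (hO : IsOpen O) (h : IsAdmissible (Ioi 0) O χ)
    (hp : baseCoord p ∈ O) (l : Fin n) {μ : Fin (n + 1 + 1)} (hμ : μ = 0 ∨ μ = 1) :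
    boostConnection (sphericalClock χ) (sphericalCoframe χ) (sphericalC χ) l.succ p μ = 0 := by
  rw [boostConnection_spherical_succ hO h hp]
  exact Pi.single_eq_of_ne (by rcases hμ with rfl | rfl <;> simp) _

lemma boostCurvature_spherical_zero (hO : IsOpen O) (h : IsAdmissible (Ioi 0) O χ)
    (hp : baseCoord p ∈ O) {μ ν : Fin (n + 1 + 1)} (hμ : μ = 0 ∨ μ = 1) (hν : ν = 0 ∨ ν = 1) :
    boostCurvature (sphericalClock χ) (sphericalCoframe χ) (sphericalC χ) 0 μ ν p
      = curl (pullBack (reducedBoost χ)) μ ν p := by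
  simp only [boostCurvature, rotationConnection_spherical_base hO h hp _ _ hμ,
    rotationConnection_spherical_base hO h hp _ _ hν, zero_mul, sub_zero, Finset.sum_const_zero,
    add_zero]
  exact curl_congr_of_isOpen (isOpen_preimage_baseCoord hO) hp
    (fun q hq i => boostConnection_spherical_zero hO h hq i) μ ν

lemma boostCurvature_spherical_succ (hO : IsOpen O) (h : IsAdmissible (Ioi 0) O χ)
    (hp : baseCoord p ∈ O) (l : Fin n) {μ : Fin (n + 1 + 1)} (hμ : μ = 0 ∨ μ = 1) :
    boostCurvature (sphericalClock χ) (sphericalCoframe χ) (sphericalC χ) l.succ μ l.succ.succ p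
      = pd μ (fun q => fieldP χ (baseCoord q) * roundFactor q) p
        - derivE χ (baseCoord p) * roundFactor p * pullBack (reducedBoost χ) p μ := by
  have hne : μ ≠ l.succ.succ := by rcases hμ with rfl | rfl <;> simp
  have hcurl : curl (boostConnection (sphericalClock χ) (sphericalCoframe χ) (sphericalC χ) l.succ)
      μ l.succ.succ p = pd μ (fun q => fieldP χ (baseCoord q) * roundFactor q) p := by
    rw [curl_congr_of_isOpen (isOpen_preimage_baseCoord hO) hp
      (fun q hq i => boostConnection_spherical_succ hO h hq l i), curl_single]
    simp [hne]
  rw [boostCurvature, hcurl, Fin.sum_univ_succ]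
  simp only [rotationConnection_spherical_base hO h hp _ _ hμ,
    boostConnection_spherical_succ_base hO h hp _ hμ, boostConnection_spherical_zero hO h hp,
    rotationConnection_spherical_succ_zero hO h hp, Pi.single_eq_same]
  simp
  ring

lemma rotationCurvature_spherical_zero_zero (hO : IsOpen O) (h : IsAdmissible (Ioi 0) O χ)
    (hp : baseCoord p ∈ O) {μ ν : Fin (n + 1 + 1)} (hμ : μ = 0 ∨ μ = 1) (hν : ν = 0 ∨ ν = 1) :
    rotationCurvature (sphericalClock χ) (sphericalCoframe χ) 0 0 μ ν p = 0 := by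
  simp only [rotationCurvature, rotationConnection_spherical_base hO h hp _ _ hμ,
    rotationConnection_spherical_base hO h hp _ _ hν, curl, rotationConnection_self, pd_const]
  simp

lemma rotationCurvature_spherical_zero_succ (hO : IsOpen O) (h : IsAdmissible (Ioi 0) O χ)
    (hp : baseCoord p ∈ O) (l : Fin n) {μ : Fin (n + 1 + 1)} (hμ : μ = 0 ∨ μ = 1) :
    rotationCurvature (sphericalClock χ) (sphericalCoframe χ) 0 l.succ μ l.succ.succ p
      = -pd μ (fun q => derivE χ (baseCoord q) * roundFactor q) p := by
  have hne : μ ≠ l.succ.succ := by rcases hμ with rfl | rfl <;> simp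
  simp only [rotationCurvature, rotationConnection_spherical_base hO h hp _ _ hμ]
  rw [curl_congr_of_isOpen (isOpen_preimage_baseCoord hO) hp
      (fun q hq i => rotationConnection_spherical_zero_succ hO h hq l i), curl_single]
  simp only [neg_mul, pd_neg]
  simp [hne]

lemma rotationCurvature_spherical_succ_zero (hO : IsOpen O) (h : IsAdmissible (Ioi 0) O χ)
    (hp : baseCoord p ∈ O) (l : Fin n) {ν : Fin (n + 1 + 1)} (hν : ν = 0 ∨ ν = 1) :
    rotationCurvature (sphericalClock χ) (sphericalCoframe χ) l.succ 0 l.succ.succ ν p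
      = -pd ν (fun q => derivE χ (baseCoord q) * roundFactor q) p := by
  have hne : ν ≠ l.succ.succ := by rcases hν with rfl | rfl <;> simp
  simp only [rotationCurvature, rotationConnection_spherical_base hO h hp _ _ hν]
  rw [curl_congr_of_isOpen (isOpen_preimage_baseCoord hO) hp
      (fun q hq i => rotationConnection_spherical_succ_zero hO h hq l i), curl_single]
  simp [hne]

lemma pd_sphere_roundFactor_mul_sphereCoord (l : Fin n) :
    pd l.succ.succ (fun q : Fin (n + 1 + 1) → ℝ => roundFactor q * sphereCoord q l) p
      = roundFactor p - roundFactor p ^ 2 * sphereCoord p l ^ 2 := by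
  rw [pd_mul differentiableAt_roundFactor ((contDiff_sphereCoord l).differentiable (by simp) p),
    pd_sphere_roundFactor]
  simp only [sphereCoord, pd_coord, if_true]
  ring

/-- Gauss' equation: the spheres of radius `Φ` have sectional curvature `1 / Φ²`, and their extrinsic
curvature subtracts `(e^μ ∂_μ Φ)² / Φ²`. The factor `ρ²` makes up for the coordinate components. -/
lemma rotationCurvature_spherical_succ_succ (hO : IsOpen O) (h : IsAdmissible (Ioi 0) O χ)
    (hp : baseCoord p ∈ O) (l m : Fin n) :
    rotationCurvature (sphericalClock χ) (sphericalCoframe χ) l.succ m.succ l.succ.succ m.succ.succ p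
      = if l = m then 0 else roundFactor p ^ 2 * (1 - derivE χ (baseCoord p) ^ 2) := by
  split_ifs with hlm
  · subst hlm
    simp [rotationCurvature, curl_self]
  have hml : ¬ m = l := fun h => hlm h.symm
  have e1 : pd l.succ.succ (fun q => rotationConnection (sphericalClock χ) (sphericalCoframe χ)
      l.succ m.succ q m.succ.succ) p = roundFactor p - roundFactor p ^ 2 * sphereCoord p l ^ 2 := by
    rw [← pd_sphere_roundFactor_mul_sphereCoord]
    refine pd_congr_of_isOpen (isOpen_preimage_baseCoord hO) hp fun q hq => ?_
    rw [rotationConnection_spherical_succ_succ hO h hq]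
    simp [hml]
  have e2 : pd m.succ.succ (fun q => rotationConnection (sphericalClock χ) (sphericalCoframe χ)
      l.succ m.succ q l.succ.succ) p
      = -(roundFactor p - roundFactor p ^ 2 * sphereCoord p m ^ 2) := by
    rw [← pd_sphere_roundFactor_mul_sphereCoord, ← pd_neg]
    refine pd_congr_of_isOpen (isOpen_preimage_baseCoord hO) hp fun q hq => ?_
    rw [rotationConnection_spherical_succ_succ hO h hq]
    simp [hlm]
  have e3 : ∀ k : Fin n, roundFactor p ^ 2 * ((if l = k then sphereCoord p l else 0)
        - sphereCoord p k) * (sphereCoord p k - if m = k then sphereCoord p m else 0)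
      = (if l = k then roundFactor p ^ 2 * sphereCoord p l ^ 2 else 0)
        + (if m = k then roundFactor p ^ 2 * sphereCoord p m ^ 2 else 0)
        - roundFactor p ^ 2 * sphereCoord p k ^ 2 := by
    intro k
    by_cases h1 : l = k
    · subst h1
      simp [hml]
    · by_cases h2 : m = k
      · subst h2
        simp [hlm]
      · simp [h1, h2]; ring
  have e4 : ∀ k : Fin n,
      rotationConnection (sphericalClock χ) (sphericalCoframe χ) l.succ k.succ p l.succ.succ
        * rotationConnection (sphericalClock χ) (sphericalCoframe χ) k.succ m.succ p m.succ.succ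
      - rotationConnection (sphericalClock χ) (sphericalCoframe χ) l.succ k.succ p m.succ.succ
        * rotationConnection (sphericalClock χ) (sphericalCoframe χ) k.succ m.succ p l.succ.succ
      = (if l = k then roundFactor p ^ 2 * sphereCoord p l ^ 2 else 0)
        + (if m = k then roundFactor p ^ 2 * sphereCoord p m ^ 2 else 0)
        - roundFactor p ^ 2 * sphereCoord p k ^ 2 := by
    intro k
    rw [← e3 k]
    simp only [rotationConnection_spherical_succ_succ hO h hp, Pi.single_apply, Fin.succ_inj, hlm,
      hml, if_true, if_false]
    by_cases h1 : l = k
    · subst h1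
      simp [hml]
    · by_cases h2 : m = k
      · subst h2
        simp [hlm]
      · simp [h1, h2]; ring
  rw [rotationCurvature, curl, e1, e2, Fin.sum_univ_succ]
  simp only [e4, Finset.sum_sub_distrib, Finset.sum_add_distrib, Finset.sum_ite_eq,
    Finset.mem_univ, if_true, ← Finset.mul_sum, roundFactor_sq_mul,
    rotationConnection_spherical_zero_succ hO h hp, rotationConnection_spherical_succ_zero hO h hp,
    Pi.single_apply, Fin.succ_inj, hlm, hml, if_false]
  ring

/-- `v^μ ∂_μ f`. -/
def alongV (ψ : Fields) (f : Plane → ℝ) (x : Plane) : ℝ :=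
  vecV ψ x 0 * pd 0 f x + vecV ψ x 1 * pd 1 f x

/-- `e^μ ∂_μ f`. -/
def alongE (ψ : Fields) (f : Plane → ℝ) (x : Plane) : ℝ :=
  vecE ψ x 0 * pd 0 f x + vecE ψ x 1 * pd 1 f x

/-- The Carroll curvature scalar of a spherically symmetric configuration, in terms of the radius
`Φ`, the fields `C` and `φ`, and the geometry of the plane. -/
def reducedScalar (n : ℕ) (χ : Fields) (x : Plane) : ℝ :=
  scalarR χ x + 2 * fieldC χ x * extrinsicK χ x - 2 * alongV χ (fieldC χ) x
    - 2 * n / dil χ x * (alongV χ (fieldP χ) x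
        - derivE χ x * (curl (clock χ) 0 1 x / frameDet χ x))
    - 2 * n / dil χ x * alongE χ (derivE χ) x
    + n * (n - 1) * (1 - derivE χ x ^ 2) / dil χ x ^ 2

lemma curl_reducedBoost (hO : IsOpen O) (h : IsAdmissible (Ioi 0) O χ) {x : Plane} (hx : x ∈ O) :
    curl (reducedBoost χ) 0 1 x / frameDet χ x
      = scalarR χ x / 2 + fieldC χ x * extrinsicK χ x - alongV χ (fieldC χ) x := by
  have hD := (h.2 x hx).1.ne'
  have dω := fun i => differentiableAt_of_contDiffOn hO (h.contDiffOn_omegaHat hO i) hx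
  have dC := differentiableAt_of_contDiffOn hO h.contDiffOn_fieldC hx
  have de := fun i => differentiableAt_of_contDiffOn hO (h.contDiffOn_ruler i) hx
  have e : reducedBoost χ = fun y i => omegaHat χ y i
      + (fun z j => fieldC χ z * ruler χ z j) y i := rfl
  rw [e, curl_add dω (fun i => dC.fun_mul (de i)), curl_mul dC de, scalarR_eq hD, extrinsicK_eq hD,
    alongV]
  simp only [vecV, Matrix.cons_val_zero, Matrix.cons_val_one]
  field_simp
  ring

theorem carrollScalar_spherical (hO : IsOpen O) (h : IsAdmissible (Ioi 0) O χ)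
    (hp : baseCoord p ∈ O) :
    carrollScalar (sphericalClock χ) (sphericalCoframe χ) (sphericalC χ) p
      = reducedScalar n χ (baseCoord p) := by
  have hD := (h.2 _ hp).1.ne'
  have hΦ : dil χ (baseCoord p) ≠ 0 := ne_of_gt (h.2 _ hp).2
  have hρ := (roundFactor_pos p).ne'
  have dP := differentiableAt_of_contDiffOn hO h.contDiffOn_fieldP hp
  have dE := differentiableAt_of_contDiffOn hO (h.contDiffOn_derivE hO) hp
  have db : ∀ i, DifferentiableAt ℝ (fun y => reducedBoost χ y i) (baseCoord p) := fun i =>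
    differentiableAt_of_contDiffOn hO ((h.contDiffOn_omegaHat hO i).add
      (h.contDiffOn_fieldC.mul (h.contDiffOn_ruler i))) hp
  have z0 : (0 : Fin (n + 1 + 1)) = 0 ∨ (0 : Fin (n + 1 + 1)) = 1 := Or.inl rfl
  have z1 : (1 : Fin (n + 1 + 1)) = 0 ∨ (1 : Fin (n + 1 + 1)) = 1 := Or.inr rfl
  have hcurl := curl_pullBack_base db
  have hcurl' : curl (pullBack (n := n) (reducedBoost χ)) 1 0 p
      = -curl (reducedBoost χ) 0 1 (baseCoord p) := by rw [curl_antisymm, hcurl]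
  rw [carrollScalar_eq_contraction]
  simp only [sum_carrollVector_spherical hD hΦ, Fin.sum_univ_succ (n := n),
    sum_spatialFrame_spherical_zero hD hΦ, sum_spatialFrame_spherical_succ hD hΦ,
    boostCurvature_spherical_zero hO h hp z0 z0, boostCurvature_spherical_zero hO h hp z0 z1,
    boostCurvature_spherical_zero hO h hp z1 z0, boostCurvature_spherical_zero hO h hp z1 z1,
    boostCurvature_spherical_succ hO h hp _ z0, boostCurvature_spherical_succ hO h hp _ z1,
    rotationCurvature_spherical_zero_zero hO h hp z0 z0,
    rotationCurvature_spherical_zero_zero hO h hp z0 z1,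
    rotationCurvature_spherical_zero_zero hO h hp z1 z0,
    rotationCurvature_spherical_zero_zero hO h hp z1 z1,
    rotationCurvature_spherical_zero_succ hO h hp _ z0,
    rotationCurvature_spherical_zero_succ hO h hp _ z1,
    rotationCurvature_spherical_succ_zero hO h hp _ z0,
    rotationCurvature_spherical_succ_zero hO h hp _ z1,
    rotationCurvature_spherical_succ_succ hO h hp, curl_self, hcurl, hcurl', pullBack_zero,
    pullBack_one, pd_zero_warped dP, pd_one_warped dP, pd_zero_warped dE, pd_one_warped dE,
    Finset.sum_add_distrib, Finset.sum_const, Finset.card_univ, Fintype.card_fin, nsmul_eq_mul]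
  have hsum : ∑ l : Fin n, ∑ m : Fin n,
      (if l = m then 0 else roundFactor p ^ 2 * (1 - derivE χ (baseCoord p) ^ 2))
        / (dil χ (baseCoord p) * roundFactor p) / (dil χ (baseCoord p) * roundFactor p)
      = n * (n - 1) * (1 - derivE χ (baseCoord p) ^ 2) / dil χ (baseCoord p) ^ 2 := by
    have : ∀ l m : Fin n,
      (if l = m then 0 else roundFactor p ^ 2 * (1 - derivE χ (baseCoord p) ^ 2))
        / (dil χ (baseCoord p) * roundFactor p) / (dil χ (baseCoord p) * roundFactor p)
      = (1 - derivE χ (baseCoord p) ^ 2) / dil χ (baseCoord p) ^ 2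
        - if l = m then (1 - derivE χ (baseCoord p) ^ 2) / dil χ (baseCoord p) ^ 2 else 0 := by
      intro l m
      split_ifs
      · simp
      · field_simp
        ring
    simp only [this, Finset.sum_sub_distrib, Finset.sum_const, Finset.card_univ, Fintype.card_fin,
      nsmul_eq_mul, Finset.sum_ite_eq, Finset.mem_univ, if_true]
    ring
  rw [hsum, reducedScalar]
  have hb := curl_reducedBoost hO h hp
  have hfr : vecV χ (baseCoord p) 0 * vecE χ (baseCoord p) 1
      - vecV χ (baseCoord p) 1 * vecE χ (baseCoord p) 0 = -1 / frameDet χ (baseCoord p) := by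
    simp only [vecV, vecE, Matrix.cons_val_zero, Matrix.cons_val_one]
    field_simp
    simp only [frameDet]
    ring
  have hω : vecV χ (baseCoord p) 0 * reducedBoost χ (baseCoord p) 0
      + vecV χ (baseCoord p) 1 * reducedBoost χ (baseCoord p) 1
      = curl (clock χ) 0 1 (baseCoord p) / frameDet χ (baseCoord p) := by
    simp only [reducedBoost, omegaHat_eq]
    linear_combination -(curl (clock χ) 0 1 (baseCoord p) / frameDet χ (baseCoord p))
      * sum_clock_vecV hD + fieldC χ (baseCoord p) * sum_ruler_vecV (ψ := χ) (x := baseCoord p)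
  rw [← hω]
  simp only [alongV, alongE] at hb ⊢
  generalize curl (reducedBoost χ) 0 1 (baseCoord p) = cb at *
  linear_combination (norm := skip) -2 * cb * hfr + 2 * hb
  field_simp
  ring

end SphericalCurvature

/-! ### The product structure of the spherically symmetric region -/

section ProductStructure

variable {n : ℕ}

/-- The splitting of `n + 2` coordinates into those of the plane and those of the sphere. -/
def splitIndex (n : ℕ) : Fin 2 ⊕ Fin n ≃ Fin (n + 1 + 1) :=
  finSumFinEquiv.trans (finCongr (by ring))

lemma splitIndex_inl_zero : splitIndex n (Sum.inl 0) = 0 := by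
  apply Fin.ext; simp [splitIndex]

lemma splitIndex_inl_one : splitIndex n (Sum.inl 1) = 1 := by
  apply Fin.ext; simp [splitIndex]

lemma splitIndex_inr (l : Fin n) : splitIndex n (Sum.inr l) = l.succ.succ := by
  apply Fin.ext; simp [splitIndex]

/-- The product decomposition of coordinate space. -/
def splitCoord (n : ℕ) : Plane × (Fin n → ℝ) ≃ᵐ (Fin (n + 1 + 1) → ℝ) :=
  (MeasurableEquiv.sumPiEquivProdPi (fun _ : Fin 2 ⊕ Fin n => ℝ)).symm.trans
    (MeasurableEquiv.piCongrLeft (fun _ => ℝ) (splitIndex n))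

lemma measurePreserving_splitCoord : MeasurePreserving (splitCoord n) :=
  (volume_measurePreserving_piCongrLeft (fun _ => ℝ) (splitIndex n)).comp
    (volume_measurePreserving_sumPiEquivProdPi_symm (fun _ : Fin 2 ⊕ Fin n => ℝ))

lemma splitCoord_apply (q : Plane × (Fin n → ℝ)) (i : Fin 2 ⊕ Fin n) :
    splitCoord n q (splitIndex n i) = Sum.elim q.1 q.2 i := by
  simp only [splitCoord, MeasurableEquiv.trans_apply, MeasurableEquiv.coe_piCongrLeft,
    Equiv.piCongrLeft_apply_apply]
  rcases i with i | i <;> rfl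

lemma baseCoord_splitCoord (q : Plane × (Fin n → ℝ)) : baseCoord (splitCoord n q) = q.1 := by
  funext i
  fin_cases i
  · exact (congrArg (splitCoord n q) splitIndex_inl_zero).symm.trans
      (splitCoord_apply q (Sum.inl 0))
  · exact (congrArg (splitCoord n q) splitIndex_inl_one).symm.trans
      (splitCoord_apply q (Sum.inl 1))

lemma sphereCoord_splitCoord (q : Plane × (Fin n → ℝ)) : sphereCoord (splitCoord n q) = q.2 := by
  funext l
  exact (congrArg (splitCoord n q) (splitIndex_inr l)).symm.trans
    (splitCoord_apply q (Sum.inr l))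

/-- Fubini's theorem for a product function on the spherically symmetric region over `D`. -/
lemma integral_base_mul_sphere {D : Set Plane} {F : Plane → ℝ} {g : (Fin n → ℝ) → ℝ}
    (hF : IntegrableOn F D) (hg : Integrable g) :
    IntegrableOn (fun p : Fin (n + 1 + 1) → ℝ => F (baseCoord p) * g (sphereCoord p))
        {p | baseCoord p ∈ D} ∧
      ∫ p in {p : Fin (n + 1 + 1) → ℝ | baseCoord p ∈ D}, F (baseCoord p) * g (sphereCoord p)
        = (∫ x in D, F x) * ∫ y, g y := by
  have hpre : splitCoord n ⁻¹' {p | baseCoord p ∈ D} = D ×ˢ univ := by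
    ext q; simp [baseCoord_splitCoord]
  have hres : (volume : Measure (Plane × (Fin n → ℝ))).restrict (D ×ˢ univ)
      = (volume.restrict D).prod volume := by
    rw [Measure.volume_eq_prod, ← Measure.prod_restrict, Measure.restrict_univ]
  constructor
  · rw [← measurePreserving_splitCoord.integrableOn_comp_preimage
      (splitCoord n).measurableEmbedding, hpre, IntegrableOn, hres]
    refine (hF.mul_prod hg).congr (Eventually.of_forall fun q => ?_)
    simp [baseCoord_splitCoord, sphereCoord_splitCoord]
  · rw [← measurePreserving_splitCoord.setIntegral_preimage_emb
      (splitCoord n).measurableEmbedding, hpre, hres]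
    simp only [baseCoord_splitCoord, sphereCoord_splitCoord]
    exact integral_prod_mul F g

lemma det_coframeMatrix_spherical (χ : Fields) (p : Fin (n + 1 + 1) → ℝ) :
    (coframeMatrix (sphericalClock χ) (sphericalCoframe χ) p).det
      = frameDet χ (baseCoord p) * (dil χ (baseCoord p) * roundFactor p) ^ n := by
  have hB : (coframeMatrix (sphericalClock χ) (sphericalCoframe χ) p).submatrix
        (splitIndex n) (splitIndex n)
      = Matrix.fromBlocks (Matrix.of ![clock χ (baseCoord p), ruler χ (baseCoord p)]) 0 0
          (Matrix.diagonal fun _ => dil χ (baseCoord p) * roundFactor p) := by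
    ext a b
    rcases a with a | a <;> rcases b with b | b
    · fin_cases a <;> fin_cases b <;>
        simp [splitIndex_inl_zero, splitIndex_inl_one, coframeMatrix, sphericalClock]
    · fin_cases a
      · simp [splitIndex_inl_zero, splitIndex_inr, coframeMatrix, sphericalClock]
      · simp [splitIndex_inl_one, splitIndex_inr, coframeMatrix]
    · fin_cases b <;>
        simp [splitIndex_inl_zero, splitIndex_inl_one, splitIndex_inr, coframeMatrix]
    · simp [splitIndex_inr, coframeMatrix, Pi.single_apply, Matrix.diagonal_apply, eq_comm]
  rw [← Matrix.det_submatrix_equiv_self (splitIndex n), hB, Matrix.det_fromBlocks_zero₁₂,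
    Matrix.det_diagonal, Matrix.det_fin_two]
  simp [frameDet]

end ProductStructure

/-! ### The volume of the unit sphere -/

section SphereVolume

open Real

lemma integral_gaussian_pi (n : ℕ) {t : ℝ} (ht : 0 < t) :
    Integrable (fun y : Fin n → ℝ => exp (-t * ∑ l, y l ^ 2)) ∧
      ∫ y : Fin n → ℝ, exp (-t * ∑ l, y l ^ 2) = (π / t) ^ ((n : ℝ) / 2) := by
  have e : (fun y : Fin n → ℝ => exp (-t * ∑ l, y l ^ 2))
      = fun y => ∏ l, exp (-t * y l ^ 2) := by
    funext y; rw [Finset.mul_sum, exp_sum]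
  rw [e]
  constructor
  · exact Integrable.fintype_prod (f := fun _ x => exp (-t * x ^ 2))
      fun _ => integrable_exp_neg_mul_sq ht
  · rw [integral_fintype_prod_volume_eq_pow (fun x : ℝ => exp (-t * x ^ 2)), integral_gaussian,
      Fintype.card_fin, sqrt_eq_rpow, ← rpow_natCast, ← rpow_mul (by positivity)]
    congr 1; ring

lemma lintegral_gamma {a r : ℝ} (ha : 0 < a) (hr : 0 < r) :
    ∫⁻ t in Ioi (0 : ℝ), ENNReal.ofReal (t ^ (a - 1) * exp (-(r * t)))
      = ENNReal.ofReal ((1 / r) ^ a * Gamma a) := by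
  rw [← integral_rpow_mul_exp_neg_mul_Ioi ha hr, ofReal_integral_eq_lintegral_ofReal]
  · have := integrableOn_rpow_mul_exp_neg_mul_rpow (p := 1) (s := a - 1) (b := r)
      (by linarith) one_pos hr
    simpa [IntegrableOn] using this
  · filter_upwards [ae_restrict_mem measurableSet_Ioi] with t ht
    have : (0 : ℝ) < t := ht
    positivity

/-- `∫ dⁿy (1 + |y|²)⁻ⁿ = π^{n/2} Γ(n/2) / Γ(n)`: write the power as a Gamma integral over `t` and
exchange it with the Gaussian integral over `y`. -/
lemma lintegral_one_add_sq_rpow {n : ℕ} (hn : 1 ≤ n) :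
    ENNReal.ofReal (Gamma n) *
        ∫⁻ y : Fin n → ℝ, ENNReal.ofReal ((1 / (1 + ∑ l, y l ^ 2)) ^ (n : ℝ))
      = ENNReal.ofReal (π ^ ((n : ℝ) / 2) * Gamma ((n : ℝ) / 2)) := by
  have hn0 : (0 : ℝ) < n := by exact_mod_cast hn
  have hpos : ∀ y : Fin n → ℝ, 0 < 1 + ∑ l, y l ^ 2 := fun y => by positivity
  have hm : Measurable (Function.uncurry fun (y : Fin n → ℝ) (t : ℝ) =>
      ENNReal.ofReal (t ^ ((n : ℝ) - 1) * exp (-((1 + ∑ l, y l ^ 2) * t)))) := by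
    unfold Function.uncurry; fun_prop
  have hinner : ∀ t ∈ Ioi (0 : ℝ), ∫⁻ y : Fin n → ℝ,
      ENNReal.ofReal (t ^ ((n : ℝ) - 1) * exp (-((1 + ∑ l, y l ^ 2) * t)))
      = ENNReal.ofReal (π ^ ((n : ℝ) / 2)) *
        ENNReal.ofReal (t ^ ((n : ℝ) / 2 - 1) * exp (-(1 * t))) := by
    intro t ht
    have ht' : (0 : ℝ) < t := ht
    obtain ⟨g1, g2⟩ := integral_gaussian_pi n ht'
    have e : ∀ y : Fin n → ℝ, t ^ ((n : ℝ) - 1) * exp (-((1 + ∑ l, y l ^ 2) * t))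
        = t ^ ((n : ℝ) - 1) * exp (-t) * exp (-t * ∑ l, y l ^ 2) := fun y => by
      rw [mul_assoc, ← exp_add]; congr 2; ring
    simp only [e]
    rw [← ofReal_integral_eq_lintegral_ofReal (g1.const_mul _)
      (Eventually.of_forall fun y => by positivity), integral_const_mul, g2,
      ← ENNReal.ofReal_mul (by positivity), div_rpow pi_pos.le ht'.le,
      show (n : ℝ) - 1 = (n : ℝ) / 2 + ((n : ℝ) / 2 - 1) by ring, rpow_add ht', one_mul]
    congr 1
    field_simp
  calc _ = ∫⁻ y : Fin n → ℝ, ∫⁻ t in Ioi (0 : ℝ),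
        ENNReal.ofReal (t ^ ((n : ℝ) - 1) * exp (-((1 + ∑ l, y l ^ 2) * t))) := by
        rw [← lintegral_const_mul' _ _ ENNReal.ofReal_ne_top]
        refine lintegral_congr fun y => ?_
        rw [lintegral_gamma hn0 (hpos y), ← ENNReal.ofReal_mul (Gamma_pos_of_pos hn0).le, mul_comm]
    _ = ∫⁻ t in Ioi (0 : ℝ), ∫⁻ y : Fin n → ℝ,
        ENNReal.ofReal (t ^ ((n : ℝ) - 1) * exp (-((1 + ∑ l, y l ^ 2) * t))) :=
        lintegral_lintegral_swap hm.aemeasurable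
    _ = _ := by
        rw [setLIntegral_congr_fun measurableSet_Ioi hinner,
          lintegral_const_mul' _ _ ENNReal.ofReal_ne_top, lintegral_gamma (by positivity) one_pos,
          ← ENNReal.ofReal_mul (by positivity)]
        simp

/-- In stereographic coordinates the unit sphere `S^n` has volume `2 π^{(n+1)/2} / Γ((n+1)/2)`. -/
theorem integral_stereographic_volume {n : ℕ} (hn : 1 ≤ n) :
    Integrable (fun y : Fin n → ℝ => (2 / (1 + ∑ l, y l ^ 2)) ^ n) ∧
      ∫ y : Fin n → ℝ, (2 / (1 + ∑ l, y l ^ 2)) ^ n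
        = 2 * π ^ (((n : ℝ) + 1) / 2) / Gamma (((n : ℝ) + 1) / 2) := by
  have hn0 : (0 : ℝ) < n := by exact_mod_cast hn
  have hΓ := Gamma_pos_of_pos hn0
  have hpos : ∀ y : Fin n → ℝ, 0 < 1 + ∑ l, y l ^ 2 := fun y => by positivity
  have hval : ∫⁻ y : Fin n → ℝ, ENNReal.ofReal ((1 / (1 + ∑ l, y l ^ 2)) ^ (n : ℝ))
      = ENNReal.ofReal (π ^ ((n : ℝ) / 2) * Gamma ((n : ℝ) / 2) / Gamma n) := by
    rw [ENNReal.ofReal_div_of_pos hΓ, ← lintegral_one_add_sq_rpow hn, mul_comm]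
    exact (ENNReal.mul_div_cancel_right (by simpa using hΓ) ENNReal.ofReal_ne_top).symm
  have hmeas : AEStronglyMeasurable (fun y : Fin n → ℝ => (1 / (1 + ∑ l, y l ^ 2)) ^ (n : ℝ)) :=
    (by fun_prop : Measurable fun y : Fin n → ℝ =>
      (1 / (1 + ∑ l, y l ^ 2)) ^ (n : ℝ)).aestronglyMeasurable
  have hnn : 0 ≤ᵐ[volume] fun y : Fin n → ℝ => (1 / (1 + ∑ l, y l ^ 2)) ^ (n : ℝ) :=
    Eventually.of_forall fun y => by have := hpos y; positivity
  have hint : Integrable (fun y : Fin n → ℝ => (1 / (1 + ∑ l, y l ^ 2)) ^ (n : ℝ)) := by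
    rw [← lintegral_ofReal_ne_top_iff_integrable hmeas hnn, hval]
    exact ENNReal.ofReal_ne_top
  have hI : ∫ y : Fin n → ℝ, (1 / (1 + ∑ l, y l ^ 2)) ^ (n : ℝ)
      = π ^ ((n : ℝ) / 2) * Gamma ((n : ℝ) / 2) / Gamma n := by
    rw [integral_eq_lintegral_of_nonneg_ae hnn hmeas, hval, ENNReal.toReal_ofReal]
    have := Gamma_pos_of_pos (half_pos hn0)
    positivity
  have e : (fun y : Fin n → ℝ => (2 / (1 + ∑ l, y l ^ 2)) ^ n)
      = fun y => 2 ^ (n : ℝ) * (1 / (1 + ∑ l, y l ^ 2)) ^ (n : ℝ) := by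
    funext y
    rw [rpow_natCast, rpow_natCast, ← mul_pow, mul_one_div]
  rw [e]
  refine ⟨hint.const_mul _, ?_⟩
  rw [integral_const_mul, hI]
  have hdup := Gamma_mul_Gamma_add_half ((n : ℝ) / 2)
  rw [show 2 * ((n : ℝ) / 2) = n by ring, show (n : ℝ) / 2 + 1 / 2 = ((n : ℝ) + 1) / 2 by ring]
    at hdup
  have hΓ2 : 0 < Gamma (((n : ℝ) + 1) / 2) := Gamma_pos_of_pos (by positivity)
  have hp : π ^ (((n : ℝ) + 1) / 2) = π ^ ((n : ℝ) / 2) * √π := by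
    rw [sqrt_eq_rpow, ← rpow_add pi_pos]; congr 1; ring
  have h2 : (2 : ℝ) ^ (n : ℝ) * 2 ^ (1 - (n : ℝ)) = 2 := by
    rw [← rpow_add two_pos]; simp
  rw [hp]
  field_simp
  linear_combination 2 ^ (n : ℝ) * hdup + Gamma n * √π * h2

end SphereVolume

/-! ### The field redefinition -/

section Redefinition

variable {n : ℕ} {lam X : ℝ}

/-- `X^{1/n}`, which is the radius `Φ` up to the factor `n / λ`. -/
def dilRoot (n : ℕ) (X : ℝ) : ℝ := X ^ (1 / (n : ℝ))

lemma dilRoot_pos (hX : 0 < X) : 0 < dilRoot n X := Real.rpow_pos_of_pos hX _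

lemma dilRoot_pow (hn : 1 ≤ n) (hX : 0 < X) : dilRoot n X ^ n = X := by
  rw [dilRoot, one_div, Real.rpow_inv_natCast_pow hX.le (by omega)]

lemma dilRoot_of_pow (hn : 1 ≤ n) {a : ℝ} (ha : 0 < a) : dilRoot n (a ^ n) = a := by
  rw [dilRoot, one_div, Real.pow_rpow_inv_natCast ha.le (by omega)]

lemma hasDerivAt_dilRoot (hX : 0 < X) :
    HasDerivAt (dilRoot n) (dilRoot n X / (n * X)) X := by
  have := Real.hasDerivAt_rpow_const (x := X) (p := 1 / (n : ℝ)) (Or.inl hX.ne')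
  refine this.congr_deriv ?_
  rw [Real.rpow_sub_one hX.ne', dilRoot]
  ring

/-- All powers of `X` in the field redefinition are rational in `X` and `X^{1/n}`. -/
lemma fieldRedef_eq (hn : 1 ≤ n) (hlam : 0 < lam) {w : FieldVal} (hw : 0 < w.2.2.1) :
    fieldRedef (n + 1) lam w = (w.1, w.2.1, n / lam * dilRoot n w.2.2.1,
      w.2.2.2.1 + (n - 1) / n * (w.2.2.2.2 / w.2.2.1),
      -(w.2.2.2.2 / lam) * (dilRoot n w.2.2.1 / w.2.2.1)) := by
  have hn0 : (n : ℝ) ≠ 0 := by positivity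
  have hr := dilRoot_pos (n := n) hw
  have e0 : ((n + 1 : ℕ) : ℝ) - 1 = n := by push_cast; ring
  have e1 : w.2.2.1 ^ ((2 - ((n + 1 : ℕ) : ℝ)) / (((n + 1 : ℕ) : ℝ) - 1))
      = dilRoot n w.2.2.1 / w.2.2.1 := by
    rw [e0, dilRoot, ← Real.rpow_sub_one hw.ne']
    congr 1; push_cast; field_simp; ring
  have e2 : w.2.2.1 ^ (1 / (1 - ((n + 1 : ℕ) : ℝ))) = (dilRoot n w.2.2.1)⁻¹ := by
    rw [dilRoot, ← Real.rpow_neg hw.le, show 1 - ((n + 1 : ℕ) : ℝ) = -n by push_cast; ring]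
    congr 1; ring
  have e3 : w.2.2.1 ^ (1 / (((n + 1 : ℕ) : ℝ) - 1)) = dilRoot n w.2.2.1 := by rw [e0]; rfl
  have e4 : ((n + 1 : ℕ) : ℝ) - 2 = n - 1 := by push_cast; ring
  simp only [fieldRedef]
  rw [e1, e2, e3, e4, e0]
  simp only [Prod.mk.injEq, true_and, and_true]
  field_simp
  ring

lemma sphericalV_eq (hn : 1 ≤ n) (hX : 0 < X) :
    sphericalV (n + 1) lam X = lam ^ 2 * ((n - 1) / (2 * n)) * (X / dilRoot n X ^ 2) := by
  have hn0 : (n : ℝ) ≠ 0 := by positivity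
  have e : X ^ ((((n + 1 : ℕ) : ℝ) - 3) / (((n + 1 : ℕ) : ℝ) - 1)) = X / dilRoot n X ^ 2 := by
    have : X ^ ((((n + 1 : ℕ) : ℝ) - 3) / (((n + 1 : ℕ) : ℝ) - 1))
        = X ^ (1 - 1 / (n : ℝ) * (2 : ℕ)) := by
      congr 1; push_cast
      rw [show (n : ℝ) + 1 - 1 = n by ring, show (n : ℝ) + 1 - 3 = n - 2 by ring]
      field_simp
    rw [this, Real.rpow_sub hX, Real.rpow_one, Real.rpow_mul hX.le, Real.rpow_natCast, dilRoot]
  rw [sphericalV, e]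
  push_cast
  ring

lemma sphericalU_eq : sphericalU (n + 1) X = -((n : ℝ) - 1) / (n * X) := by
  rw [sphericalU]; push_cast; congr 1 <;> ring

theorem bijOn_fieldRedef (hn : 1 ≤ n) (hlam : 0 < lam) :
    Set.BijOn (fieldRedef (n + 1) lam) {w | 0 < w.2.2.1} {w | 0 < w.2.2.1} := by
  have hn0 : (0 : ℝ) < n := by exact_mod_cast hn
  refine ⟨fun w hw => ?_, fun w hw w' hw' h => ?_, fun z hz => ?_⟩
  · have hr := dilRoot_pos (n := n) (show 0 < w.2.2.1 from hw)
    rw [fieldRedef_eq hn hlam hw]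
    change 0 < n / lam * dilRoot n w.2.2.1
    positivity
  · have hX : 0 < w.2.2.1 := hw
    have hX' : 0 < w'.2.2.1 := hw'
    rw [fieldRedef_eq hn hlam hw, fieldRedef_eq hn hlam hw'] at h
    obtain ⟨τ, e, X, C, P⟩ := w
    obtain ⟨τ', e', X', C', P'⟩ := w'
    simp only [Prod.mk.injEq] at h hX hX' ⊢
    obtain ⟨h1, h2, h3, h4, h5⟩ := h
    have hroot : dilRoot n X = dilRoot n X' :=
      mul_left_cancel₀ (by positivity : (n : ℝ) / lam ≠ 0) h3
    have hXX : X = X' := by rw [← dilRoot_pow hn hX, hroot, dilRoot_pow hn hX']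
    subst hXX
    have hr := dilRoot_pos (n := n) hX
    have hPP : P = P' := by field_simp at h5; linarith
    subst hPP
    exact ⟨h1, h2, rfl, by linarith, rfl⟩
  · obtain ⟨τ, e, Φ, C, φ⟩ := z
    have hΦ : 0 < Φ := hz
    have ha : 0 < lam * Φ / n := by positivity
    refine ⟨(τ, e, (lam * Φ / n) ^ n,
      C - (n - 1) / n * ((-lam * φ * ((lam * Φ / n) ^ n / (lam * Φ / n))) / (lam * Φ / n) ^ n),
      -lam * φ * ((lam * Φ / n) ^ n / (lam * Φ / n))), pow_pos ha n, ?_⟩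
    rw [fieldRedef_eq hn hlam (pow_pos ha n)]
    simp only [dilRoot_of_pow hn ha, Prod.mk.injEq, true_and]
    refine ⟨?_, ?_, ?_⟩
    · field_simp
    · ring
    · have := (pow_pos ha n).ne'
      generalize (lam * Φ / n) ^ n = Y at *
      field_simp

lemma contDiffOn_dilRoot : ContDiffOn ℝ ∞ (dilRoot n) (Ioi 0) := fun _ hx =>
  (Real.contDiffAt_rpow_const_of_ne (ne_of_gt hx)).contDiffWithinAt

lemma contDiffOn_sphericalU (n : ℕ) : ContDiffOn ℝ ∞ (sphericalU (n + 1)) (Ioi 0) := by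
  by_cases hn : (n : ℝ) = 0
  · have : sphericalU (n + 1) = fun _ => 0 := by
      funext X; rw [sphericalU_eq, hn]; simp
    rw [this]; exact contDiffOn_const
  · have : sphericalU (n + 1) = fun X => -((n : ℝ) - 1) / (n * X) := funext fun X => sphericalU_eq
    rw [this]
    exact contDiffOn_const.div (contDiffOn_const.mul contDiffOn_id)
      fun x hx => mul_ne_zero hn (ne_of_gt hx)

lemma contDiffOn_sphericalV (d : ℕ) (lam : ℝ) : ContDiffOn ℝ ∞ (sphericalV d lam) (Ioi 0) :=
  contDiffOn_const.mul fun _ hx =>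
    (Real.contDiffAt_rpow_const_of_ne (ne_of_gt hx)).contDiffWithinAt

end Redefinition

/-! ### Reduction of the Lagrangian -/

section Reduction

variable {n : ℕ} {lam : ℝ} {O : Set Plane} {ψ : Fields} {x : Plane}

lemma isAdmissible_fieldRedef (hn : 1 ≤ n) (hlam : 0 < lam)
    (h : IsAdmissible (Ioi 0) O ψ) :
    IsAdmissible (Ioi 0) O (fun x => fieldRedef (n + 1) lam (ψ x)) := by
  have hX : ∀ x ∈ O, 0 < dil ψ x := fun x hx => (h.2 x hx).2
  have hr : ContDiffOn ℝ ∞ (fun x => dilRoot n (dil ψ x)) O :=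
    contDiffOn_dilRoot.comp h.contDiffOn_dil hX
  refine ⟨?_, fun x hx => ⟨(h.2 x hx).1, (bijOn_fieldRedef hn hlam).mapsTo (hX x hx)⟩⟩
  refine ContDiffOn.congr ?_ fun x hx => fieldRedef_eq hn hlam (hX x hx)
  exact h.1.fst.prodMk (h.1.snd.fst.prodMk ((contDiffOn_const.mul hr).prodMk
    ((h.contDiffOn_fieldC.add (contDiffOn_const.mul
      (h.contDiffOn_fieldP.div h.contDiffOn_dil fun x hx => (hX x hx).ne'))).prodMk
    ((h.contDiffOn_fieldP.div_const _).neg.mul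
      (hr.div h.contDiffOn_dil fun x hx => (hX x hx).ne')))))

/-- The current `(-2 X C' + (2/n) X_P) det(τ, e) v^μ - 2 (e^ν ∂_ν X) det(τ, e) e^μ`, a function of the
first jet of the fields. -/
def reductionCurrent (n : ℕ) : Current := fun w =>
  let A := -2 * w.1.2.2.1 * w.1.2.2.2.1 + 2 / n * w.1.2.2.2.2
  let B := (-w.1.1 1 * (w.2 (Pi.single 0 1)).2.2.1 + w.1.1 0 * (w.2 (Pi.single 1 1)).2.2.1)
    / (w.1.1 0 * w.1.2.1 1 - w.1.1 1 * w.1.2.1 0)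
  ![2 * (B * w.1.1 1) - A * w.1.2.1 1, A * w.1.2.1 0 - 2 * (B * w.1.1 0)]

lemma reductionCurrent_eval (hO : IsOpen O) (h : IsAdmissible (Ioi 0) O ψ) (hx : x ∈ O) :
    (reductionCurrent n).eval ψ x =
      ![2 * (derivE ψ x * clock ψ x 1)
          - (-2 * dil ψ x * fieldC ψ x + 2 / n * fieldP ψ x) * ruler ψ x 1,
        (-2 * dil ψ x * fieldC ψ x + 2 / n * fieldP ψ x) * ruler ψ x 0
          - 2 * (derivE ψ x * clock ψ x 0)] := by
  have hd := differentiableAt_of_contDiffOn hO h.1 hx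
  have e : derivE ψ x = (-clock ψ x 1 * pd 0 (dil ψ) x + clock ψ x 0 * pd 1 (dil ψ) x)
      / (clock ψ x 0 * ruler ψ x 1 - clock ψ x 1 * ruler ψ x 0) := by
    simp only [derivE, Fin.sum_univ_two, vecE, Matrix.cons_val_zero, Matrix.cons_val_one, frameDet]
    ring
  simp only [Current.eval, reductionCurrent, fderiv_dil_apply hd, e]
  rfl

lemma contDiffOn_reductionCurrent (hO : IsOpen O) (h : IsAdmissible (Ioi 0) O ψ) :
    ContDiffOn ℝ ∞ ((reductionCurrent n).eval ψ) O := by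
  refine ContDiffOn.congr (contDiffOn_pi.2 fun μ => ?_) fun y hy => reductionCurrent_eval hO h hy
  have hA : ContDiffOn ℝ ∞ (fun x => -2 * dil ψ x * fieldC ψ x + 2 / n * fieldP ψ x) O :=
    ((contDiffOn_const.mul h.contDiffOn_dil).mul h.contDiffOn_fieldC).add
      (contDiffOn_const.mul h.contDiffOn_fieldP)
  have hB := h.contDiffOn_derivE hO
  fin_cases μ
  · exact (contDiffOn_const.mul (hB.mul (h.contDiffOn_clock 1))).sub (hA.mul (h.contDiffOn_ruler 1))
  · exact (hA.mul (h.contDiffOn_ruler 0)).sub (contDiffOn_const.mul (hB.mul (h.contDiffOn_clock 0)))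

lemma clock_eq_neg_mul_vecE (hD : frameDet ψ x ≠ 0) :
    clock ψ x 1 = -(frameDet ψ x * vecE ψ x 0) ∧ clock ψ x 0 = frameDet ψ x * vecE ψ x 1 := by
  simp only [vecE, Matrix.cons_val_zero, Matrix.cons_val_one]
  constructor <;> field_simp

lemma ruler_eq_neg_mul_vecV (hD : frameDet ψ x ≠ 0) :
    ruler ψ x 1 = -(frameDet ψ x * vecV ψ x 0) ∧ ruler ψ x 0 = frameDet ψ x * vecV ψ x 1 := by
  simp only [vecV, Matrix.cons_val_zero, Matrix.cons_val_one]
  constructor <;> field_simp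

lemma divergence_reductionCurrent (hO : IsOpen O) (h : IsAdmissible (Ioi 0) O ψ) (hx : x ∈ O) :
    divergence ((reductionCurrent n).eval ψ) x = frameDet ψ x *
      (-2 * (fieldC ψ x * alongV ψ (dil ψ) x + dil ψ x * alongV ψ (fieldC ψ) x)
        + 2 / n * alongV ψ (fieldP ψ) x
        - (-2 * dil ψ x * fieldC ψ x + 2 / n * fieldP ψ x) * extrinsicK ψ x
        - 2 * alongE ψ (derivE ψ) x
        + 2 * derivE ψ x * (curl (clock ψ) 0 1 x / frameDet ψ x)) := by
  have hD := (h.2 x hx).1.ne'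
  have dX := differentiableAt_of_contDiffOn hO h.contDiffOn_dil hx
  have dC := differentiableAt_of_contDiffOn hO h.contDiffOn_fieldC hx
  have dP := differentiableAt_of_contDiffOn hO h.contDiffOn_fieldP hx
  have dE := differentiableAt_of_contDiffOn hO (h.contDiffOn_derivE hO) hx
  have dt := fun i => differentiableAt_of_contDiffOn hO (h.contDiffOn_clock i) hx
  have de := fun i => differentiableAt_of_contDiffOn hO (h.contDiffOn_ruler i) hx
  have dA : DifferentiableAt ℝ (fun y => -2 * dil ψ y * fieldC ψ y + 2 / n * fieldP ψ y) x :=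
    ((dX.const_mul _).fun_mul dC).fun_add (dP.const_mul _)
  have hA : ∀ μ, pd μ (fun y => -2 * dil ψ y * fieldC ψ y + 2 / n * fieldP ψ y) x
      = -2 * (pd μ (dil ψ) x * fieldC ψ x + dil ψ x * pd μ (fieldC ψ) x)
        + 2 / n * pd μ (fieldP ψ) x := by
    intro μ
    rw [pd_add ((dX.const_mul _).fun_mul dC) (dP.const_mul _), pd_mul (dX.const_mul _) dC,
      pd_const_mul _ dX, pd_const_mul _ dP]
    ring
  have e := fun μ : Fin 2 => pd_congr_of_isOpen (μ := μ) hO hx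
    (fun y hy => congrFun (reductionCurrent_eval (n := n) hO h hy) μ)
  simp only [divergence, Fin.sum_univ_two, e]
  simp only [Matrix.cons_val_zero, Matrix.cons_val_one]
  rw [pd_sub ((dE.fun_mul (dt 1)).const_mul _) (dA.fun_mul (de 1)),
    pd_sub (dA.fun_mul (de 0)) ((dE.fun_mul (dt 0)).const_mul _),
    pd_const_mul _ (dE.fun_mul (dt 1)), pd_const_mul _ (dE.fun_mul (dt 0)),
    pd_mul dE (dt 1), pd_mul dE (dt 0), pd_mul dA (de 1), pd_mul dA (de 0), hA, hA,
    extrinsicK_eq hD]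
  simp only [curl, alongV, alongE]
  rw [(clock_eq_neg_mul_vecE hD).1, (clock_eq_neg_mul_vecE hD).2, (ruler_eq_neg_mul_vecV hD).1,
    (ruler_eq_neg_mul_vecV hD).2]
  field_simp
  ring

lemma derivV_eq_alongV : derivV ψ x = alongV ψ (dil ψ) x := Fin.sum_univ_two _

lemma derivE_eq_alongE : derivE ψ x = alongE ψ (dil ψ) x := Fin.sum_univ_two _

/-- The reduced Lagrangian is, after the field redefinition, the dilaton gravity Lagrangian plus a
divergence. The terms `X_P v^μ ∂_μ X` cancel because of the shift between `C` and `C'`. -/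
theorem reducedLagrangian_eq (hn : 1 ≤ n) (hlam : 0 < lam) (hO : IsOpen O)
    (h : IsAdmissible (Ioi 0) O ψ) (hx : x ∈ O) :
    dil ψ x * (frameDet ψ x * reducedScalar n (fun x => fieldRedef (n + 1) lam (ψ x)) x)
      = carrollDilatonLagrangian (sphericalU (n + 1)) (sphericalV (n + 1) lam) ψ x
        + divergence ((reductionCurrent n).eval ψ) x := by
  have hn0 : (0 : ℝ) < n := by exact_mod_cast hn
  have hD := (h.2 x hx).1.ne'
  have hX : ∀ y ∈ O, 0 < dil ψ y := fun y hy => (h.2 y hy).2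
  have hX0 := hX x hx
  have dX := differentiableAt_of_contDiffOn hO h.contDiffOn_dil hx
  have dC := differentiableAt_of_contDiffOn hO h.contDiffOn_fieldC hx
  have dP := differentiableAt_of_contDiffOn hO h.contDiffOn_fieldP hx
  have dE := differentiableAt_of_contDiffOn hO (h.contDiffOn_derivE hO) hx
  have hr := dilRoot_pos (n := n) hX0
  have hr' : ∀ y ∈ O, DifferentiableAt ℝ (fun y => dilRoot n (dil ψ y)) y := fun y hy =>
    (hasDerivAt_dilRoot (hX y hy)).differentiableAt.comp y
      (differentiableAt_of_contDiffOn hO h.contDiffOn_dil hy)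
  have dr := hr' x hx
  have pr : ∀ y ∈ O, ∀ μ, pd μ (fun y => dilRoot n (dil ψ y)) y
      = dilRoot n (dil ψ y) / (n * dil ψ y) * pd μ (dil ψ) y := fun y hy μ =>
    pd_comp (hasDerivAt_dilRoot (hX y hy)) (differentiableAt_of_contDiffOn hO h.contDiffOn_dil hy)
  set χ : Fields := fun x => fieldRedef (n + 1) lam (ψ x) with hχ
  have cΦ : ∀ y ∈ O, dil χ y = n / lam * dilRoot n (dil ψ y) := fun y hy =>
    congrArg (fun w : FieldVal => w.2.2.1) (fieldRedef_eq hn hlam (hX y hy))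
  have cC : ∀ y ∈ O, fieldC χ y = fieldC ψ y + (n - 1) / n * (fieldP ψ y / dil ψ y) := fun y hy =>
    congrArg (fun w : FieldVal => w.2.2.2.1) (fieldRedef_eq hn hlam (hX y hy))
  have cφ : ∀ y ∈ O, fieldP χ y = -1 / lam * (fieldP ψ y * (dilRoot n (dil ψ y) / dil ψ y)) :=
    fun y hy => (congrArg (fun w : FieldVal => w.2.2.2.2)
      (fieldRedef_eq hn hlam (hX y hy))).trans (by simp only [fieldP, dil]; ring)
  have cE : ∀ y ∈ O, derivE χ y = 1 / lam * (dilRoot n (dil ψ y) / dil ψ y * derivE ψ y) := by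
    intro y hy
    have hXy := hX y hy
    have e : ∀ μ, pd μ (dil χ) y
        = n / lam * (dilRoot n (dil ψ y) / (n * dil ψ y) * pd μ (dil ψ) y) := fun μ => by
      rw [pd_congr_of_isOpen hO hy cΦ, pd_const_mul _ (hr' y hy), pr y hy]
    simp only [derivE, Fin.sum_univ_two, e]
    rw [show vecE χ = vecE ψ from rfl]
    field_simp
  have pq : ∀ μ, pd μ (fun y => dilRoot n (dil ψ y) / dil ψ y) x
      = (dilRoot n (dil ψ x) / (n * dil ψ x) * pd μ (dil ψ) x * dil ψ x
        - dilRoot n (dil ψ x) * pd μ (dil ψ) x) / dil ψ x ^ 2 := fun μ => by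
    rw [pd_div dr dX hX0.ne', pr x hx]
  have dq : DifferentiableAt ℝ (fun y => dilRoot n (dil ψ y) / dil ψ y) x := by
    simp only [div_eq_mul_inv]
    exact dr.fun_mul (dX.fun_inv hX0.ne')
  have dPX : DifferentiableAt ℝ (fun y => fieldP ψ y / dil ψ y) x := by
    simp only [div_eq_mul_inv]
    exact dP.fun_mul (dX.fun_inv hX0.ne')
  have pC : ∀ μ, pd μ (fieldC χ) x = pd μ (fieldC ψ) x + (n - 1) / n *
      ((pd μ (fieldP ψ) x * dil ψ x - fieldP ψ x * pd μ (dil ψ) x) / dil ψ x ^ 2) := fun μ => by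
    rw [pd_congr_of_isOpen hO hx cC, pd_add dC (dPX.const_mul _), pd_const_mul _ dPX,
      pd_div dP dX hX0.ne']
  have pφ : ∀ μ, pd μ (fieldP χ) x = -1 / lam * (pd μ (fieldP ψ) x * (dilRoot n (dil ψ x) / dil ψ x)
      + fieldP ψ x * ((dilRoot n (dil ψ x) / (n * dil ψ x) * pd μ (dil ψ) x * dil ψ x
        - dilRoot n (dil ψ x) * pd μ (dil ψ) x) / dil ψ x ^ 2)) := fun μ => by
    rw [pd_congr_of_isOpen hO hx cφ, pd_const_mul _ (dP.fun_mul dq), pd_mul dP dq, pq]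
  have pE : ∀ μ, pd μ (derivE χ) x = 1 / lam *
      ((dilRoot n (dil ψ x) / (n * dil ψ x) * pd μ (dil ψ) x * dil ψ x
        - dilRoot n (dil ψ x) * pd μ (dil ψ) x) / dil ψ x ^ 2 * derivE ψ x
      + dilRoot n (dil ψ x) / dil ψ x * pd μ (derivE ψ) x) := fun μ => by
    rw [pd_congr_of_isOpen hO hx cE, pd_const_mul _ (dq.fun_mul dE), pd_mul dq dE, pq]
  have gE : derivE ψ x = vecE ψ x 0 * pd 0 (dil ψ) x + vecE ψ x 1 * pd 1 (dil ψ) x :=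
    derivE_eq_alongE
  rw [divergence_reductionCurrent hO h hx, carrollDilatonLagrangian, reducedScalar,
    sphericalU_eq, sphericalV_eq hn hX0, derivV_eq_alongV]
  rw [show scalarR χ = scalarR ψ from rfl, show extrinsicK χ = extrinsicK ψ from rfl,
    show frameDet χ = frameDet ψ from rfl, show clock χ = clock ψ from rfl]
  simp only [alongV, alongE, pC, pφ, pE, cΦ x hx, cC x hx, cE x hx]
  rw [show vecV χ = vecV ψ from rfl, show vecE χ = vecE ψ from rfl]
  generalize dilRoot n (dil ψ x) = a at *
  -- In `e^μ ∂_μ (e^ν ∂_ν Φ)` the derivative of `X^{1/n} / X` produces one more `e^μ ∂_μ X`, which has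
  -- to be recognized as `derivE ψ x`.
  linear_combination (norm := skip)
    2 * frameDet ψ x * (1 / n - 1) * derivE ψ x / dil ψ x * gE
  field_simp
  ring

end Reduction

/-! ### Reduction of the action -/

section ReducedAction

variable {n : ℕ} {lam : ℝ} {O : Set Plane} {ψ : Fields}

lemma contDiffOn_carrollDilatonLagrangian {I : Set ℝ} {U V : ℝ → ℝ} (hU : ContDiffOn ℝ ∞ U I)
    (hV : ContDiffOn ℝ ∞ V I) (hO : IsOpen O) (h : IsAdmissible I O ψ) :
    ContDiffOn ℝ ∞ (carrollDilatonLagrangian U V ψ) O := by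
  have hX := h.contDiffOn_dil
  have hUX : ContDiffOn ℝ ∞ (fun x => U (dil ψ x)) O := hU.comp hX fun x hx => (h.2 x hx).2
  have hVX : ContDiffOn ℝ ∞ (fun x => V (dil ψ x)) O := hV.comp hX fun x hx => (h.2 x hx).2
  exact h.contDiffOn_frameDet.mul (((((hX.mul (h.contDiffOn_scalarR hO)).add
    ((contDiffOn_const.mul h.contDiffOn_fieldC).mul (h.contDiffOn_derivV hO))).add
    ((contDiffOn_const.mul h.contDiffOn_fieldP).mul (h.contDiffOn_extrinsicK hO))).sub
    (hUX.mul ((h.contDiffOn_derivE hO).pow 2))).add (contDiffOn_const.mul hVX))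

/-- The Lagrangian of a spherically symmetric configuration is the product of the reduced Lagrangian
and the volume density of the unit sphere; here `det(τ, e^a) = det(τ, e) Φ^n ρ^n` and
`Φ^n = (n/λ)^n X`. -/
lemma magneticLagrangian_spherical (hn : 1 ≤ n) (hlam : 0 < lam) (hO : IsOpen O)
    (h : IsAdmissible (Ioi 0) O ψ) {p : Fin (n + 1 + 1) → ℝ} (hp : baseCoord p ∈ O) :
    magneticLagrangian (d := n + 1)
        (sphericalClock (fun x => fieldRedef (n + 1) lam (ψ x)))
        (sphericalCoframe (fun x => fieldRedef (n + 1) lam (ψ x)))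
        (sphericalC (fun x => fieldRedef (n + 1) lam (ψ x))) p
      = ((n / lam) ^ n * (carrollDilatonLagrangian (sphericalU (n + 1)) (sphericalV (n + 1) lam) ψ
            (baseCoord p) + divergence ((reductionCurrent n).eval ψ) (baseCoord p)))
          * (2 / (1 + ∑ l, sphereCoord p l ^ 2)) ^ n := by
  have hχ := isAdmissible_fieldRedef hn hlam h
  have hX : 0 < dil ψ (baseCoord p) := (h.2 _ hp).2
  have hΦ : dil (fun x => fieldRedef (n + 1) lam (ψ x)) (baseCoord p)
      = n / lam * dilRoot n (dil ψ (baseCoord p)) :=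
    congrArg (fun w : FieldVal => w.2.2.1) (fieldRedef_eq hn hlam hX)
  rw [magneticLagrangian, det_coframeMatrix_spherical, carrollScalar_spherical hO hχ hp, hΦ,
    ← reducedLagrangian_eq hn hlam hO h hp, mul_pow, mul_pow, dilRoot_pow hn hX]
  rw [show frameDet (fun x => fieldRedef (n + 1) lam (ψ x)) = frameDet ψ from rfl]
  rw [roundFactor]
  ring

/-- The coupling constants match: the volume of the sphere turns `1 / (16 π G)` into `k / (4 π)`. -/
lemma sphericalK_eq (n : ℕ) {lam G : ℝ} (hG : 0 < G) :
    sphericalK (n + 1) lam G / (4 * Real.pi)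
      = 1 / (16 * Real.pi * G) * (2 * Real.pi ^ (((n : ℝ) + 1) / 2)
          / Real.Gamma (((n : ℝ) + 1) / 2)) * (n / lam) ^ n := by
  have hΓ : 0 < Real.Gamma (((n : ℝ) + 1) / 2) := Real.Gamma_pos_of_pos (by positivity)
  have hπ := Real.pi_pos
  have e : ((n + 1 : ℕ) : ℝ) - 1 = n := by push_cast; ring
  rw [sphericalK, e, Real.rpow_natCast]
  push_cast
  field_simp
  ring

/-- Spherical reduction of magnetic Carroll gravity. -/
theorem sphericalAction_eq (hn : 1 ≤ n) (hlam : 0 < lam) {G : ℝ} (hG : 0 < G) (hO : IsOpen O)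
    (h : IsAdmissible (Ioi 0) O ψ) {D : Set Plane} (hD : IsCompact D) (hDO : D ⊆ O) :
    IntegrableOn (magneticLagrangian (d := n + 1)
        (sphericalClock (fun x => fieldRedef (n + 1) lam (ψ x)))
        (sphericalCoframe (fun x => fieldRedef (n + 1) lam (ψ x)))
        (sphericalC (fun x => fieldRedef (n + 1) lam (ψ x)))) {p | baseCoord p ∈ D} ∧
      sphericalAction n G (fun x => fieldRedef (n + 1) lam (ψ x)) D
        = carrollDilatonAction (sphericalK (n + 1) lam G) (sphericalU (n + 1))
            (sphericalV (n + 1) lam) ψ D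
          + sphericalK (n + 1) lam G / (4 * Real.pi)
            * ∫ x in D, divergence ((reductionCurrent n).eval ψ) x := by
  have iL := ContDiffOn.integrableOn_compact (contDiffOn_carrollDilatonLagrangian
    (contDiffOn_sphericalU n) (contDiffOn_sphericalV (n + 1) lam) hO h) hD hDO
  have iJ := ContDiffOn.integrableOn_compact
    (contDiffOn_divergence hO (contDiffOn_reductionCurrent (n := n) hO h)) hD hDO
  obtain ⟨ig, hvol⟩ := integral_stereographic_volume hn
  have iF : IntegrableOn (fun x => ((n : ℝ) / lam) ^ n * (carrollDilatonLagrangian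
      (sphericalU (n + 1)) (sphericalV (n + 1) lam) ψ x
        + divergence ((reductionCurrent n).eval ψ) x)) D := (iL.add iJ).const_mul _
  obtain ⟨i1, i2⟩ := integral_base_mul_sphere iF ig
  have hmeas : MeasurableSet {p : Fin (n + 1 + 1) → ℝ | baseCoord p ∈ D} :=
    contDiff_baseCoord.continuous.measurable hD.measurableSet
  have hcongr : EqOn (magneticLagrangian (d := n + 1)
      (sphericalClock (fun x => fieldRedef (n + 1) lam (ψ x)))
      (sphericalCoframe (fun x => fieldRedef (n + 1) lam (ψ x)))
      (sphericalC (fun x => fieldRedef (n + 1) lam (ψ x)))) _ {p | baseCoord p ∈ D} :=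
    fun p hp => magneticLagrangian_spherical hn hlam hO h (hDO hp)
  refine ⟨(integrableOn_congr_fun hcongr hmeas).2 i1, ?_⟩
  rw [sphericalAction, magneticAction, setIntegral_congr_fun hmeas hcongr, i2, hvol,
    integral_const_mul, integral_add iL iJ, carrollDilatonAction, sphericalK_eq n hG]
  ring

end ReducedAction

end CarrollGravity

end

theorem mainTheorem6 :
    -- Route 1: spherical reduction of magnetic Carroll gravity in `d + 1 = n + 2` dimensions.
    (∀ (n : ℕ), 1 ≤ n → ∀ (lam : ℝ), 0 < lam → ∀ (G : ℝ), 0 < G →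
      Set.BijOn (fieldRedef (n + 1) lam) {w | 0 < w.2.2.1} {w | 0 < w.2.2.1} ∧
      ∃ j : Current, ∀ (O : Set Plane), IsOpen O →
        (∀ ψ : Fields, IsAdmissible (Ioi 0) O ψ →
          ContDiffOn ℝ ∞ (j.eval ψ) O ∧
          ∀ D : Set Plane, IsCompact D → D ⊆ O →
            IntegrableOn
              (magneticLagrangian (d := n + 1)
                (sphericalClock (fun x => fieldRedef (n + 1) lam (ψ x)))
                (sphericalCoframe (fun x => fieldRedef (n + 1) lam (ψ x)))
                (sphericalC (fun x => fieldRedef (n + 1) lam (ψ x))))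
              {p | baseCoord p ∈ D} ∧
            sphericalAction n G (fun x => fieldRedef (n + 1) lam (ψ x)) D
              = carrollDilatonAction (sphericalK (n + 1) lam G) (sphericalU (n + 1))
                  (sphericalV (n + 1) lam) ψ D
                + sphericalK (n + 1) lam G / (4 * Real.pi)
                  * ∫ x in D, divergence (j.eval ψ) x) ∧
        -- The magnetic limit of the Lorentzian model with the same `k`, `U`, `V` is this action.
        (∀ (ε : ℝ), 0 < ε → ∀ Ψ : ℝ → Fields,
          IsPreCarrollFamily (Ioi 0) (sphericalU (n + 1)) ε O Ψ →
          ∀ D : Set Plane, IsCompact D → D ⊆ O →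
            Tendsto (fun c : ℝ => auxAction c (sphericalK (n + 1) lam G / c ^ 4)
                (sphericalU (n + 1)) (sphericalV (n + 1) lam) (Ψ (c ^ 2)) D) (𝓝[>] 0)
              (𝓝 (sphericalAction n G (fun x => fieldRedef (n + 1) lam (Ψ 0 x)) D
                - sphericalK (n + 1) lam G / (4 * Real.pi)
                  * ∫ x in D, divergence (j.eval (Ψ 0)) x)))) ∧
    -- Route 2: magnetic expansion of Lorentzian dilaton gravity with arbitrary potentials.
    (∀ (I : Set ℝ) (U V : ℝ → ℝ), IsOpen I → ContDiffOn ℝ ∞ U I → ContDiffOn ℝ ∞ V I →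
      -- The Lorentzian action is `c^2 I_2 + c^4 I_4`, up to a boundary term.
      (∀ (c : ℝ), 0 < c → ∃ j : Current, ∀ (O : Set Plane), IsOpen O →
        ∀ ψ : Fields, IsAdmissible I O ψ →
          ContDiffOn ℝ ∞ (j.eval ψ) O ∧
          ∀ (krel : ℝ) (D : Set Plane), IsCompact D → D ⊆ O →
            lorentzianAction c krel U V (preCarrollMetric c ψ) (dil ψ) D
              = krel / (4 * Real.pi)
                  * (c ^ 2 * (∫ x in D, lagrangianTwo U ψ x)
                    + c ^ 4 * (∫ x in D, lagrangianFour U V ψ x)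
                    + ∫ x in D, divergence (j.eval ψ) x)) ∧
      -- Eliminating the auxiliary fields by their equations of motion gives back `I_2`.
      (∀ (c : ℝ), 0 < c → ∀ (O : Set Plane), IsOpen O →
        ∀ ψ : Fields, IsAdmissible I O ψ → IsNondegenerate U O ψ →
          (∃ ψ' : Fields, IsAdmissible I O ψ' ∧
            (∀ x ∈ O, clock ψ' x = clock ψ x ∧ ruler ψ' x = ruler ψ x ∧ dil ψ' x = dil ψ x ∧
              AuxOnShell c U ψ' x)) ∧
          ((∀ x ∈ O, AuxOnShell c U ψ x) →
            ∀ x ∈ O, lagrangianTwoAux c U ψ x = lagrangianTwo U ψ x)) ∧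
      -- With `k = k_rel c^4` held fixed, the limit `c → 0` is the magnetic Carroll action.
      (∀ (k ε : ℝ), 0 < ε → ∀ (O : Set Plane), IsOpen O → ∀ Ψ : ℝ → Fields,
        IsPreCarrollFamily I U ε O Ψ → ∀ D : Set Plane, IsCompact D → D ⊆ O →
          Tendsto (fun c : ℝ => auxAction c (k / c ^ 4) U V (Ψ (c ^ 2)) D) (𝓝[>] 0)
            (𝓝 (carrollDilatonAction k U V (Ψ 0) D)))) := by
  refine ⟨fun n hn lam hlam G hG => ⟨bijOn_fieldRedef hn hlam, reductionCurrent n,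
    fun O hO => ⟨fun ψ hψ => ⟨contDiffOn_reductionCurrent hO hψ, fun D hD hDO =>
      sphericalAction_eq hn hlam hG hO hψ hD hDO⟩, fun ε hε Ψ hΨ D hD hDO => ?_⟩⟩,
    fun I U V _ hU hV => ⟨fun c hc => ⟨magneticCurrent c, fun O hO ψ hψ =>
      ⟨contDiffOn_magneticCurrent hO hψ, fun krel D hD hDO =>
        lorentzianAction_eq hc hU hV hO hψ krel hD hDO⟩⟩,
      fun c hc O hO ψ hψ hnd => ⟨exists_auxOnShell c hU hO hψ hnd, fun hshell x hx =>
        lagrangianTwoAux_eq_of_auxOnShell hc.ne' (hnd x hx).1 (hnd x hx).2 (hshell x hx)⟩,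
      fun k ε hε O hO Ψ hΨ D hD hDO => tendsto_auxAction hU hV k hε hO hΨ hD hDO⟩⟩
  have hlim := tendsto_auxAction (contDiffOn_sphericalU n) (contDiffOn_sphericalV (n + 1) lam)
    (sphericalK (n + 1) lam G) hε hO hΨ hD hDO
  rwa [eq_sub_of_add_eq
    (sphericalAction_eq hn hlam hG hO (hΨ.2.1 0 ⟨le_rfl, hε⟩) hD hDO).2.symm] at hlim
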